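/- **Setting.** A (finite) metric graph $G$ is a compact path-connected metric space that is locally isometric to stars; a *natural vertex* is a point of valence $>2$, a *natural edge* is an edge path between natural vertices with no natural vertex in its interior. $G$ is a *core graph of rank $n$* if it has no vertices of valence $\le 1$ and $\pi_1(G)$ is free of rank $n$. A *fold* $f:G\to H$ is the quotient map that, for two directed natural edges with the same initial vertex and unit speed parametrizations $e_1,e_2$, and some $0<L\le\min(\ell_1,\ell_2)$ with $e_1((0,L])\cap e_2((0,L])=\emptyset$, identifies $e_1(t)$ with $e_2(t)$ for $t\in[0,L]$ and nothing else; it is a local isometry off the two folded segments. A *split sequence* $\zeta$ of rank $n$ is an inverse sequence of folds $G_0\xleftarrow{f_{-1}}G_{-1}\xleftarrow{f_{-2}}\cdots$ between core metric graphs of rank $n$ such that each composition $f^j_0:G_j\to G_0$ is locally injective off the natural vertices of $G_j$. It is *proper* if the natural vertices of all $G_j$ have only finitely many images in $G_0$. The *solenoid* $X=X(\zeta)$ is the inverse limit $\varprojlim G_j$, with projections $\pi_j:X\to G_j$; write $x_j=\pi_j(x)$. $\mathrm{Star}(m)$, $m\ge2$, is $m$ copies of $[0,1)$ glued at $0$ (its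 *center*; its *open prongs* are the $m$ copies of $(0,1)$); an $m$-pronged *star set* of a space $Y$ is a subset homeomorphic to $\mathrm{Star}(m)$, and a *turn* of a star set is the union of its center and two distinct open prongs (for $m=2$ any point may be taken as the center). A point of $G_j$ is *special* if some image of it in a $G_i$, $i\ge j$, is a natural vertex, or some preimage of it in a $G_i$, $i\le j$, is a natural vertex. A *standard star neighborhood* $V\subseteq G_j$ is an open star set with no special point except possibly its center; a turn of it is a *standard turn* of level $j$, and $\pi_j^{-1}(V)$ is a *standard neighborhood* of $X$. A *plaque* of $O\subseteq X$ is a path component of $O$; a *standard plaque* is a plaque of a standard neighborhood. A *singularity* is a point $x\in X$ whose plaque in every standard neighborhood of $x$ is a star set with more than two prongs; $\mathrm{Sing}(X)$ is the set of singularities. A standard plaque is *singular* if it is a star set centered at a singularity. A *singular segment* is a turn of a singular plaque, and a *leaf segment* is a turn of a standard plaque that is itself a non-singular standard plaque. A set $L\subseteq X$ *sustains* $I\subseteq G_j$ if there is a homeomorphism $l:I\to L$ with $\pi_j\circ l=\mathrm{id}_I$; a leaf segment that sustains $I$ is said to *take* $I$. A *pre-singularity* is a point $x$ with $x_j$ natural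 for all sufficiently negative $j$. The sequence $\zeta$ is *stabilized* if (1) every fiber $\pi_j^{-1}(q)$ contains at most one pre-singularity, and none if $q$ is not natural; (2) no $3$-pronged star set $U\subseteq X$ has $\pi_j(U)$ equal to a standard turn of level $j$; (3) for every singular segment $L$ that sustains a standard turn, either for every $j$ some leaf segment takes $\pi_j(L)$, or no leaf segment takes $\pi_0(L)$. An *optimal point* of $G_0$ is a special point or the midpoint of a natural edge that is a loop. An *optimal star neighborhood* is a standard star neighborhood in $G_0$ whose center is its only optimal point and which is maximal among such neighborhoods with the same center; an *optimal plaque* is a plaque of $\pi_0^{-1}(V)$, $V$ an optimal star neighborhood. A *leaf* of $X$ is a class of the relation "$x,y$ lie in a union $V_1\cup\dots\cup V_m$ of optimal plaques such that each $V_i\cap V_{i+1}$ contains a leaf segment". A *partial leaf* is a class of the relation on $X-\mathrm{Sing}(X)$ obtained by replacing optimal plaques by leaf segments. For a leaf or partial leaf $L$, $\Gamma_L$ is the set $L$ with the topology generated by the prong-maximal star sets of the subspace $L$, where an $m$-pronged star set $S$ of $L$ with center $c$ is *prong-maximal* if no star set of $L$ centered at $c$ has more than $m$ prongs and no star set of $L$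 centered at another point of $S$ has more than $2$ prongs. For a turn $I$ of a standard star neighborhood $V\subseteq G_j$ with center $p$, the *turn tunnel* $\mathrm{Tun}_I$ is the union of the leaf segments that take $I$, $C_I=\mathrm{Tun}_I\cap\pi_j^{-1}(p)$, and $h_I:C_I\times I\to \mathrm{Tun}_I$ sends $(y,t)$ to the point over $t$ of the leaf segment through $y$ that takes $I$. The *turn transversals* are the sets $H_{I,q}=h_I(C_I\times\{q\})$, $q\in I$. A *transversal* is a set $\phi(B)$, where $B\subseteq C_I$ is Borel and $\phi:C_I\to\mathrm{Tun}_I$ is a homeomorphism onto its image of the form $\phi(y)=h_I(y,\sigma(y))$ with $\sigma:C_I\to I$ continuous. **Theorem.** Let $\zeta$ be a stabilized proper split sequence and $X=X(\zeta)$. 1. A subset of $X$ is a leaf (resp. a partial leaf) of $X$ if and only if it is a path component of $X$ (resp. of $X-\mathrm{Sing}(X)$). 2. For every leaf $L$, $\Gamma_L$ is a topological graph (second countable, Hausdorff, every point having an open neighborhood that is a star set centered at it), and the identity $\Gamma_L\to L$ is a bijective topological immersion (continuous, and locally a homeomorphism onto its image). For every partial leaf $L$ the same holds with $\Gamma_L$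 a $1$-manifold. 3. Every transversal of $X$ is totally disconnected. 4. Every turn transversal $H$ of $X$ is compact or has a one-point compactification in $X$, i.e. for some $p\in X-H$ the subspace $H\cup\{p\}$ is the one-point compactification of $H$. 5. For every turn transversal $H$ of $X$, the turn transversals contained in $H$ form a basis of the topology of $H$. -/

import Mathlib

open Set Topology

universe u

namespace SplitSolenoid

/-! ### Star sets -/

/-- The `n`-pronged star with prongs of length `r`, i.e. `n` copies of `[0, r)` glued at `0`,
realised as the union of the `n` half-open coordinate segments of `ℝⁿ`. -/
def starSet (n : ℕ) (r : ℝ) : Set (Fin n → ℝ) :=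
  {v | (∀ i, 0 ≤ v i ∧ v i < r) ∧ ∀ i j, i ≠ j → v i = 0 ∨ v j = 0}

/-- The model `n`-pronged star set `Star(n)`, with the topology of a subspace of `ℝⁿ`. -/
abbrev ModelStar (n : ℕ) : Type := ↥(starSet n 1)

/-- The center of `Star(n)`. -/
def ModelStar.center (n : ℕ) : ModelStar n :=
  ⟨0, fun _ => ⟨le_rfl, zero_lt_one⟩, fun _ _ _ => Or.inl rfl⟩

section Stars

variable {Y : Type*} [TopologicalSpace Y]

/-- `S` is an `n`-pronged star set of `Y` (`n ≥ 2`), centered at `c`.  When `n = 2` every point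
of `S` may serve as the center; when `n > 2` the center is determined by `S`. -/
def IsStarSet (S : Set Y) (n : ℕ) (c : Y) : Prop :=
  2 ≤ n ∧ ∃ h : ModelStar n ≃ₜ ↥S, (h (ModelStar.center n) : Y) = c

/-- `I` is a turn of the star set `S` centered at `c`: the union of the center and two distinct
open prongs. -/
def IsTurnOf (S : Set Y) (c : Y) (I : Set Y) : Prop :=
  ∃ n, 2 ≤ n ∧ ∃ h : ModelStar n ≃ₜ ↥S, (h (ModelStar.center n) : Y) = c ∧
    ∃ a b : Fin n, a ≠ b ∧
      I = {y | ∃ v : ModelStar n, (∀ k, k ≠ a → k ≠ b → v.1 k = 0) ∧ (h v : Y) = y}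

/-- A star set `S` of `Y` is prong-maximal if it has at each of its points as many prongs as any
star set of `Y` centered at that point: no star set of `Y` with the same center has more prongs,
and no star set of `Y` centered at another point of `S` has more than two prongs. -/
def IsProngMaximal (S : Set Y) : Prop :=
  ∃ n c, IsStarSet S n c ∧ (∀ m W, IsStarSet W m c → m ≤ n) ∧
    ∀ z ∈ S, z ≠ c → ∀ m W, IsStarSet W m z → m ≤ 2

/-- `Y` is a topological graph: second countable, Hausdorff, and locally a star with at least two
prongs (so there are no isolated points and no vertices of valence one). -/
def IsTopologicalGraph (Y : Type*) [TopologicalSpace Y] : Prop :=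
  T2Space Y ∧ SecondCountableTopology Y ∧
    ∀ y : Y, ∃ U n, IsOpen U ∧ IsStarSet U n y

/-- `Y` is a (possibly disconnected) 1-manifold without boundary. -/
def IsOneManifold (Y : Type*) [TopologicalSpace Y] : Prop :=
  T2Space Y ∧ SecondCountableTopology Y ∧
    ∀ y : Y, ∃ U : Set Y, IsOpen U ∧ y ∈ U ∧ Nonempty (↥U ≃ₜ ℝ)

/-- A topological immersion: a continuous map such that every point has a neighborhood that is
mapped homeomorphically onto its image. -/
def IsTopologicalImmersion {Y Z : Type*} [TopologicalSpace Y] [TopologicalSpace Z]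
    (g : Y → Z) : Prop :=
  Continuous g ∧ ∀ y, ∃ U ∈ 𝓝 y, IsEmbedding (U.domRestrict g)

/-- The graph-immersion `Γ_L` of a subset `L`: the set `L`, with the topology generated by the
prong-maximal star sets of the subspace `L`. -/
def GraphImmersion (L : Set Y) : Type _ := ↥L

instance (L : Set Y) : TopologicalSpace (GraphImmersion L) :=
  TopologicalSpace.generateFrom {S : Set ↥L | IsProngMaximal S}

/-- The identity map `Γ_L → L`. -/
def GraphImmersion.toSubspace (L : Set Y) : GraphImmersion L → ↥L := fun x => x

end Stars

/-! ### Metric graphs and folds -/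

section Graphs

/-- The point `p` has valence `n`: some ball around `p` is isometric to the star with `n` prongs,
centered at `p`.  On the star, the length distance is the `ℓ¹` distance of `ℝⁿ`. -/
def HasValence {G : Type*} [MetricSpace G] (p : G) (n : ℕ) : Prop :=
  ∃ r > 0, ∃ φ : G → (Fin n → ℝ), BijOn φ (Metric.ball p r) (starSet n r) ∧ φ p = 0 ∧
    ∀ x ∈ Metric.ball p r, ∀ y ∈ Metric.ball p r, dist x y = ∑ i, |φ x i - φ y i|

/-- A natural vertex is a point of valence at least three. -/
def IsNatural {G : Type*} [MetricSpace G] (p : G) : Prop := ∃ n, 2 < n ∧ HasValence p n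

/-- `G` is a (finite) metric graph that is a core graph of rank `n`: a compact path connected
space that is locally isometric to stars, without vertices of valence one (or zero), and with
fundamental group free of rank `n`. -/
structure IsCoreMetricGraph (G : Type*) [MetricSpace G] (n : ℕ) : Prop where
  compact : CompactSpace G
  connected : PathConnectedSpace G
  valence : ∀ p : G, ∃ m, 2 ≤ m ∧ HasValence p m
  rank : ∀ p : G, Nonempty (FundamentalGroup G p ≃* FreeGroup (Fin n))

/-- `e : [0, ℓ] → G` is the arc length parametrization of a directed natural edge of length `ℓ`. -/
structure IsNaturalEdge {G : Type*} [MetricSpace G] (e : ℝ → G) (ℓ : ℝ) : Prop where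
  pos : 0 < ℓ
  continuousOn : ContinuousOn e (Icc 0 ℓ)
  initial : IsNatural (e 0)
  terminal : IsNatural (e ℓ)
  interior : ∀ t ∈ Ioo 0 ℓ, ¬ IsNatural (e t)
  injOn : InjOn e (Ioo 0 ℓ)
  unitSpeed : ∀ t ∈ Ioo 0 ℓ, ∃ δ > 0, ∀ s ∈ Ioo (t - δ) (t + δ), ∀ s' ∈ Ioo (t - δ) (t + δ),
    dist (e s) (e s') = |s - s'|

/-- `f : G → H` is a fold: for two directed natural edges `e₁`, `e₂` with the same initial vertex
and some `0 < L ≤ min ℓ₁ ℓ₂` such that `e₁ (0, L]` and `e₂ (0, L]` are disjoint, `f` is the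
quotient map that identifies `e₁ t` with `e₂ t` for `t ∈ [0, L]` (and makes no other
identifications), and `f` is a local isometry off the two folded segments. -/
def IsFold {G H : Type*} [MetricSpace G] [MetricSpace H] (f : G → H) : Prop :=
  ∃ (e₁ e₂ : ℝ → G) (ℓ₁ ℓ₂ L : ℝ), IsNaturalEdge e₁ ℓ₁ ∧ IsNaturalEdge e₂ ℓ₂ ∧ e₁ 0 = e₂ 0 ∧
    0 < L ∧ L ≤ ℓ₁ ∧ L ≤ ℓ₂ ∧ Disjoint (e₁ '' Ioc 0 L) (e₂ '' Ioc 0 L) ∧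
    IsQuotientMap f ∧
    (∀ x y, f x = f y ↔ x = y ∨
      ∃ t ∈ Icc 0 L, (x = e₁ t ∧ y = e₂ t) ∨ (x = e₂ t ∧ y = e₁ t)) ∧
    ∀ x, x ∉ e₁ '' Icc 0 L → x ∉ e₂ '' Icc 0 L →
      ∃ r > 0, ∀ y ∈ Metric.ball x r, ∀ z ∈ Metric.ball x r, dist (f y) (f z) = dist y z

end Graphs

/-! ### Split sequences and their solenoids -/

/-- A split sequence of rank `n`.  `G j` is the level graph of level `-j`; `map : G j → G i`
(`i ≤ j`) is the composition of the folds `G j → G (j - 1) → ⋯ → G i`, the identity if `i = j`.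
No backtracking: each composition `G j → G 0` is locally injective off the natural vertices. -/
structure SplitSequence (n : ℕ) where
  G : ℕ → Type u
  [metric : ∀ j, MetricSpace (G j)]
  map : ∀ {i j : ℕ}, i ≤ j → G j → G i
  map_self : ∀ (j : ℕ) (x : G j), map le_rfl x = x
  map_map : ∀ {i j k : ℕ} (hij : i ≤ j) (hjk : j ≤ k) (x : G k),
    map hij (map hjk x) = map (hij.trans hjk) x
  core : ∀ j, IsCoreMetricGraph (G j) n
  fold : ∀ j, IsFold (map (Nat.le_succ j))
  noBacktracking : ∀ j, IsLocallyInjective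
    (fun x : {x : G j // ¬ IsNatural x} => map (Nat.zero_le j) x.1)

attribute [instance] SplitSequence.metric

namespace SplitSequence

variable {n : ℕ} (ζ : SplitSequence.{u} n)

/-- The split sequence is proper if the natural vertices of all levels have only finitely many
images in the level `0` graph. -/
def IsProper : Prop :=
  {p : ζ.G 0 | ∃ (j : ℕ) (v : ζ.G j), IsNatural v ∧ ζ.map (Nat.zero_le j) v = p}.Finite

/-- The solenoid `X(ζ)`: the inverse limit, as a subspace of the product of the level graphs. -/
abbrev X : Type u := {x : ∀ j, ζ.G j // ∀ j, ζ.map (Nat.le_succ j) (x (j + 1)) = x j}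

/-- The coordinate projection `π_K`. -/
def proj (K : ℕ) (x : ζ.X) : ζ.G K := x.1 K

/-- `p` is a special point of its level graph: one of its images in the lower-indexed levels is a
natural vertex, or it is the image of a natural vertex of some deeper level (the levels with
`j = K` are included). -/
def IsSpecial {K : ℕ} (p : ζ.G K) : Prop :=
  (∃ (i : ℕ) (h : i ≤ K), IsNatural (ζ.map h p)) ∨
    ∃ (j : ℕ) (h : K ≤ j) (v : ζ.G j), IsNatural v ∧ ζ.map h v = p

/-- `V` is a standard star neighborhood of the level graph `G K`, centered at `p`. -/
def IsStandardStarNhd {K : ℕ} (V : Set (ζ.G K)) (p : ζ.G K) : Prop :=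
  IsOpen V ∧ (∃ m, IsStarSet V m p) ∧ ∀ q ∈ V, q ≠ p → ¬ ζ.IsSpecial q

/-- A standard turn in `ζ`: a turn of a standard star neighborhood. -/
def IsStandardTurn {K : ℕ} (I : Set (ζ.G K)) : Prop :=
  ∃ V p, ζ.IsStandardStarNhd V p ∧ IsTurnOf V p I

/-- A standard neighborhood of `X`: the preimage of a standard star neighborhood. -/
def IsStandardNhd (O : Set ζ.X) : Prop :=
  ∃ (K : ℕ) (V : Set (ζ.G K)) (p : ζ.G K), ζ.IsStandardStarNhd V p ∧ O = ζ.proj K ⁻¹' V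

/-- `P` is a plaque (a path component) of the set `O`. -/
def IsPlaqueOf (O P : Set ζ.X) : Prop := ∃ x ∈ O, P = pathComponentIn O x

/-- A standard plaque: a plaque of a standard neighborhood. -/
def IsStandardPlaque (P : Set ζ.X) : Prop := ∃ O, ζ.IsStandardNhd O ∧ ζ.IsPlaqueOf O P

/-- The set of singularities of `X`: the points `x` such that the plaque of `x` in every standard
neighborhood of `x` is a star set with more than two prongs. -/
def Sing : Set ζ.X :=
  {x | ∀ O, ζ.IsStandardNhd O → x ∈ O → ∃ m c, 2 < m ∧ IsStarSet (pathComponentIn O x) m c}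

/-- A singular plaque: a standard plaque that is a star set centered at the singularity `s`. -/
def IsSingularPlaque (P : Set ζ.X) (s : ζ.X) : Prop :=
  ζ.IsStandardPlaque P ∧ s ∈ ζ.Sing ∧ ∃ m, IsStarSet P m s

/-- A pre-leaf segment: a turn of a standard plaque. -/
def IsPreLeafSegment (L : Set ζ.X) : Prop :=
  ∃ P c, ζ.IsStandardPlaque P ∧ IsTurnOf P c L

/-- A leaf segment: a pre-leaf segment that is itself a non-singular standard plaque. -/
def IsLeafSegment (L : Set ζ.X) : Prop :=
  ζ.IsPreLeafSegment L ∧ ζ.IsStandardPlaque L ∧ ¬ ∃ s, ζ.IsSingularPlaque L s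

/-- A singular segment: a turn of a singular plaque. -/
def IsSingularSegment (L : Set ζ.X) : Prop :=
  ∃ P s, ζ.IsSingularPlaque P s ∧ IsTurnOf P s L

/-- `L` sustains `I` (one says that `L` takes `I` if `L` is a leaf segment): there is a
homeomorphism `l : I → L` with `π_K ∘ l = id`. -/
def Sustains {K : ℕ} (I : Set (ζ.G K)) (L : Set ζ.X) : Prop :=
  ∃ l : ↥I ≃ₜ ↥L, ∀ t : ↥I, ζ.proj K (l t) = t

/-- `L` is a leaf segment that takes `I`. -/
def Takes {K : ℕ} (I : Set (ζ.G K)) (L : Set ζ.X) : Prop :=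
  ζ.IsLeafSegment L ∧ ζ.Sustains I L

/-! ### The stabilizing hypotheses -/

/-- A pre-singularity: a point whose projections to all sufficiently deep levels are natural. -/
def IsPreSingularity (x : ζ.X) : Prop := ∃ K, ∀ j, K ≤ j → IsNatural (ζ.proj j x)

/-- The stabilizing hypotheses: the two vertex stabilizing criteria and the two turn stabilizing
criteria. -/
structure IsStabilized : Prop where
  natural_fiber : ∀ (j : ℕ) (q : ζ.G j), IsNatural q →
    {x | ζ.IsPreSingularity x ∧ ζ.proj j x = q}.Subsingleton
  other_fiber : ∀ (j : ℕ) (q : ζ.G j), ¬ IsNatural q →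
    ∀ x, ζ.proj j x = q → ¬ ζ.IsPreSingularity x
  no_three_star : ∀ (K : ℕ) (I : Set (ζ.G K)), ζ.IsStandardTurn I →
    ¬ ∃ U c, IsStarSet U 3 c ∧ ζ.proj K '' U = I
  singular_segment : ∀ (K : ℕ) (I : Set (ζ.G K)), ζ.IsStandardTurn I →
    ∀ L, ζ.IsSingularSegment L → ζ.Sustains I L →
      (∀ j, ∃ L', ζ.Takes (ζ.proj j '' L) L') ∨ ¬ ∃ L', ζ.Takes (ζ.proj 0 '' L) L'

/-! ### Leaves and partial leaves -/

/-- An optimal point of `G K`: a special point, or the midpoint of a natural edge that is a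
loop. -/
def IsOptimalPoint {K : ℕ} (p : ζ.G K) : Prop :=
  ζ.IsSpecial p ∨ ∃ (e : ℝ → ζ.G K) (ℓ : ℝ), IsNaturalEdge e ℓ ∧ e 0 = e ℓ ∧ p = e (ℓ / 2)

/-- A pre-optimal star neighborhood centered at `p`. -/
def IsPreOptimalStarNhd {K : ℕ} (V : Set (ζ.G K)) (p : ζ.G K) : Prop :=
  ζ.IsStandardStarNhd V p ∧ ζ.IsOptimalPoint p ∧ ∀ q ∈ V, q ≠ p → ¬ ζ.IsOptimalPoint q

/-- An optimal star neighborhood: a pre-optimal one that is not properly contained in another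
pre-optimal star neighborhood with the same center. -/
def IsOptimalStarNhd {K : ℕ} (V : Set (ζ.G K)) (p : ζ.G K) : Prop :=
  ζ.IsPreOptimalStarNhd V p ∧ ∀ W, ζ.IsPreOptimalStarNhd W p → ¬ V ⊂ W

/-- An optimal plaque: a plaque of a level `0` optimal neighborhood of `X`. -/
def IsOptimalPlaque (P : Set ζ.X) : Prop :=
  ∃ (V : Set (ζ.G 0)) (p : ζ.G 0), ζ.IsOptimalStarNhd V p ∧ ζ.IsPlaqueOf (ζ.proj 0 ⁻¹' V) P

/-- `x` and `y` lie in a concatenation of sets of the class `C`: a union of finitely many members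
`V 0, …, V m` of `C` such that each `V i ∩ V (i + 1)` contains a leaf segment. -/
def InConcatenation (C : Set ζ.X → Prop) (x y : ζ.X) : Prop :=
  ∃ (m : ℕ) (V : Fin (m + 1) → Set ζ.X), (∀ i, C (V i)) ∧
    (∀ i : Fin m, ∃ L, ζ.IsLeafSegment L ∧ L ⊆ V i.castSucc ∩ V i.succ) ∧
    x ∈ ⋃ i, V i ∧ y ∈ ⋃ i, V i

/-- Plaque equivalence on `X`. -/
def PlaqueEquiv (x y : ζ.X) : Prop := ζ.InConcatenation ζ.IsOptimalPlaque x y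

/-- Leaf equivalence, for points of `X - Sing(X)`. -/
def LeafEquiv (x y : ζ.X) : Prop := ζ.InConcatenation ζ.IsLeafSegment x y

/-- A leaf of `X`: a plaque equivalence class. -/
def IsLeaf (L : Set ζ.X) : Prop := ∃ x, L = {y | ζ.PlaqueEquiv x y}

/-- A partial leaf of `X`: a leaf equivalence class of `X - Sing(X)`. -/
def IsPartialLeaf (L : Set ζ.X) : Prop :=
  ∃ x, x ∉ ζ.Sing ∧ L = {y | y ∉ ζ.Sing ∧ ζ.LeafEquiv x y}

/-! ### Transversals -/

/-- The graph of the canonically given parametrization `h_I` of the turn tunnel `Tun_I`: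
`h_I (y, t) = z` means that `z` is the point over `t` of the leaf segment that takes `I` and
contains `y`. -/
def TunnelParam {K : ℕ} (I : Set (ζ.G K)) (y : ζ.X) (t : ζ.G K) (z : ζ.X) : Prop :=
  ∃ L, ζ.Takes I L ∧ y ∈ L ∧ z ∈ L ∧ ζ.proj K z = t

/-- The turn tunnel `Tun_I`: the union of all leaf segments that take `I`. -/
def turnTunnel {K : ℕ} (I : Set (ζ.G K)) : Set ζ.X := ⋃₀ {L | ζ.Takes I L}

/-- The central cross-section `C_I = F_p ∩ Tun_I`, where `p` is the center and `F_p` the fiber. -/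
def centralSection {K : ℕ} (I : Set (ζ.G K)) (p : ζ.G K) : Set ζ.X :=
  ζ.proj K ⁻¹' {p} ∩ ζ.turnTunnel I

/-- A turn transversal `H_{I,q} = h_I (C_I × {q})`, for a standard turn `I` and `q ∈ I`. -/
def IsTurnTransversal (H : Set ζ.X) : Prop :=
  ∃ (K : ℕ) (V : Set (ζ.G K)) (p : ζ.G K) (I : Set (ζ.G K)) (q : ζ.G K),
    ζ.IsStandardStarNhd V p ∧ IsTurnOf V p I ∧ q ∈ I ∧
      H = {z | ∃ y ∈ ζ.centralSection I p, ζ.TunnelParam I y q z}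

/-- A flow map `φ : C_I → Tun_I`: a homeomorphism onto its image of the form
`φ y = h_I (y, σ y)` for a continuous `σ : C_I → I`. -/
def IsFlowMap {K : ℕ} (I : Set (ζ.G K)) (p : ζ.G K) (φ : ↥(ζ.centralSection I p) → ζ.X) : Prop :=
  IsEmbedding φ ∧ ∃ σ : ↥(ζ.centralSection I p) → ↥I, Continuous σ ∧
    ∀ y : ↥(ζ.centralSection I p), ζ.TunnelParam I y (σ y) (φ y)

/-- A transversal of `X`: the image of a Borel subset of `C_I` under a flow map of `Tun_I`, for a
standard turn `I`. -/
def IsTransversal (F : Set ζ.X) : Prop :=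
  ∃ (K : ℕ) (V : Set (ζ.G K)) (p : ζ.G K) (I : Set (ζ.G K)),
    ζ.IsStandardStarNhd V p ∧ IsTurnOf V p I ∧
      ∃ φ : ↥(ζ.centralSection I p) → ζ.X, ζ.IsFlowMap I p φ ∧
        ∃ B : Set ↥(ζ.centralSection I p), @MeasurableSet _ (borel _) B ∧ F = φ '' B

/-- `H` has a one-point compactification in `X`: for some point `p ∉ H` of `X`, the subspace
`H ∪ {p}` is the one-point compactification of `H`, with `p` as the point at infinity. -/
def HasOnePointCompactificationIn (H : Set ζ.X) : Prop :=
  ∃ p, p ∉ H ∧ ∃ e : OnePoint ↥H ≃ₜ ↥(insert p H),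
    (e OnePoint.infty : ζ.X) = p ∧ ∀ y : ↥H, (e (y : OnePoint ↥H) : ζ.X) = y

end SplitSequence

end SplitSolenoid

/-! Let `V` be a standard star neighborhood in the graph of level `K`, with center `p`. No point of
`V` other than `p` is special, so over the open prongs of `V` the maps from deeper graphs are local
homeomorphisms, and, the graphs being compact, coverings. Each prong of `V` therefore lifts uniquely
through every point above its interior. The lift converges at its start because fibers are finite,
and by uniqueness the lifts at the various levels fit together to lifts in `X` (`starLift_map`,
`starLift_proj`). Sliding points back along lifted prongs retracts the preimage of `V` onto the
fiber over `p`. At each level the fibers of this retraction, the sheets, are open, so no path can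
pass from one sheet to another. Hence the plaques in `X` are exactly the sheets
(`pathComponentIn_eq`).

The heart of the proof is that the sheet of a point `z` over `p` is a star with at least two prongs
on which the projection to `V` is injective. The set `ends` of prongs of `V` with a lift starting at
`z` is the decreasing intersection of its analogues at the levels, so it is attained at a finite
level. Three distinct lifts at `z` never share a prong of `V`: going up one fold at a time, either
all three would merge at once, but a fold is at most two-to-one off the natural vertices, or exactly
two would merge, which produces a `3`-pronged star projecting onto a standard turn (`three_prongs`).
Two ends exist by the fiber criterion for pre-singularities (`nontrivial_ends`), and a third prong
then separates any two lifts over the same end. It follows that `z` is a singularity exactly if it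
has more than two ends, that there are finitely many singularities, and that the leaf segments are
the standard plaques without singularity (`mem_Sing_iff`, `finite_Sing`, `isLeafSegment_iff`).

The transversal statements are read off from `ends`. A turn tunnel consists of the sheets whose set
of ends is a given pair, and it is open because ends stabilize at a finite level. Requiring the two
prongs to be ends, without excluding others, is a closed condition, and it adds at most the sheet of
a single singularity; this gives the possible point at infinity. Turn transversals lie in fibers of
a projection, which are profinite.

For leaves, optimal star neighborhoods cover `G 0`, being the open stars of a subdivision without
loops. Any two intersecting plaques share a leaf segment, so concatenation classes are path
components by an open-closed argument along paths (`setOf_inConcatenation_eq`). Finally, the plaques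
inside a leaf or partial leaf form a basis of the topology of `GraphImmersion`. They are embedded
stars, and countably many of them cover because a plaque meets only countably many plaques of each
basic neighborhood (`secondCountable_graphImmersion`). -/

namespace SplitSolenoid

/-! ### Star sets described by parametrized prongs and a height function. -/

section StarCharts

/-- The point at height `t` on the `j`-th prong of the model star (the center if `t ∉ [0, 1)`). -/
noncomputable def ModelStar.ray {n : ℕ} (j : Fin n) (t : ℝ) : ModelStar n := by
  classical
  exact ⟨Pi.single j (if t ∈ Ico (0 : ℝ) 1 then t else 0), fun i => by
      by_cases hi : i = j
      · subst hi
        by_cases ht : t ∈ Ico (0 : ℝ) 1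
        · rw [if_pos ht, Pi.single_eq_same]; exact ht
        · rw [if_neg ht, Pi.single_eq_same]; exact ⟨le_rfl, one_pos⟩
      · simp [hi],
    fun i k hik => by
      by_cases hi : i = j
      · right; subst hi; simp [Ne.symm hik]
      · left; simp [hi]⟩

theorem ModelStar.ray_apply {n : ℕ} (j : Fin n) {t : ℝ} (ht : t ∈ Ico (0 : ℝ) 1) :
    (ModelStar.ray j t).1 = Pi.single j t := by
  classical
  simp only [ModelStar.ray, if_pos ht]

/-- The height of a point of the model star over its center. -/
def ModelStar.height {n : ℕ} (v : ModelStar n) : ℝ := ∑ i, v.1 i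

theorem ModelStar.continuous_height {n : ℕ} : Continuous (ModelStar.height (n := n)) := by
  unfold ModelStar.height
  fun_prop

theorem ModelStar.height_ray {n : ℕ} (j : Fin n) {t : ℝ} (ht : t ∈ Ico (0 : ℝ) 1) :
    (ModelStar.ray j t).height = t := by
  classical
  simp [ModelStar.height, ModelStar.ray_apply j ht]

theorem ModelStar.continuousOn_ray {n : ℕ} (j : Fin n) :
    ContinuousOn (ModelStar.ray j) (Ico (0 : ℝ) 1) := by
  classical
  rw [Topology.IsInducing.subtypeVal.continuousOn_iff]
  have : ContinuousOn (fun t : ℝ => (Pi.single j t : Fin n → ℝ)) (Ico (0 : ℝ) 1) := by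
    have : Continuous (fun t : ℝ => (Pi.single j t : Fin n → ℝ)) := continuous_single (A := fun _ : Fin n => ℝ) j
    exact this.continuousOn
  exact this.congr fun t ht => ModelStar.ray_apply j ht

theorem ModelStar.continuous_coord {n : ℕ} (j : Fin n) :
    Continuous fun v : ModelStar n => v.1 j :=
  (continuous_apply j).comp continuous_subtype_val

theorem ModelStar.ray_zero {n : ℕ} (j : Fin n) : ModelStar.ray j 0 = ModelStar.center n := by
  classical
  apply Subtype.ext
  rw [ModelStar.ray_apply j (by simp)]
  simp [ModelStar.center]

theorem ModelStar.eq_ray {n : ℕ} (v : ModelStar n) (j : Fin n) (h : v.1 j ≠ 0) :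
    v = ModelStar.ray j (v.1 j) ∧ v.height = v.1 j := by
  classical
  have hz : ∀ i, i ≠ j → v.1 i = 0 := fun i hi => (v.2.2 i j hi).resolve_right h
  have hv : v = ModelStar.ray j (v.1 j) := by
    apply Subtype.ext
    rw [ModelStar.ray_apply j (v.2.1 j)]
    ext i
    by_cases hi : i = j
    · subst hi; simp
    · simp [hi, hz i hi]
  refine ⟨hv, ?_⟩
  conv_lhs => rw [hv]
  exact ModelStar.height_ray j (v.2.1 j)

theorem ModelStar.eq_center_or {n : ℕ} (v : ModelStar n) :
    v = ModelStar.center n ∨ ∃ j, 0 < v.1 j := by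
  by_cases h : ∃ j, 0 < v.1 j
  · exact Or.inr h
  · left
    push Not at h
    apply Subtype.ext
    ext i
    exact le_antisymm (h i) (v.2.1 i).1

variable {Y : Type*} [TopologicalSpace Y]

/-- `σ` parametrizes the prongs of the star `S` centered at `z`, with height function `η`. -/
structure IsStarChart {ι : Type*} (S : Set Y) (z : Y) (σ : ι → ℝ → Y) (η : Y → ℝ) : Prop where
  cont : ∀ j, ContinuousOn (σ j) (Ico 0 1)
  zero : ∀ j, σ j 0 = z
  contη : ContinuousOn η S
  ηz : η z = 0
  ησ : ∀ j, ∀ t ∈ Ico (0 : ℝ) 1, η (σ j t) = t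
  mem_iff : ∀ y, y ∈ S ↔ y = z ∨ ∃ j, ∃ t ∈ Ioo (0 : ℝ) 1, y = σ j t
  disj : ∀ j k, ∀ t ∈ Ioo (0 : ℝ) 1, σ j t = σ k t → j = k

namespace IsStarChart

variable {ι κ : Type*} {S : Set Y} {z : Y} {σ : ι → ℝ → Y} {η : Y → ℝ}

theorem center_mem (h : IsStarChart S z σ η) : z ∈ S := (h.mem_iff z).2 (Or.inl rfl)

theorem mem (h : IsStarChart S z σ η) (j : ι) {t : ℝ} (ht : t ∈ Ico (0 : ℝ) 1) : σ j t ∈ S := by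
  rcases eq_or_lt_of_le ht.1 with h0 | h0
  · rw [← h0, h.zero]; exact h.center_mem
  · exact (h.mem_iff _).2 (Or.inr ⟨j, t, ⟨h0, ht.2⟩, rfl⟩)

theorem η_mem (h : IsStarChart S z σ η) {y : Y} (hy : y ∈ S) : η y ∈ Ico (0 : ℝ) 1 := by
  rcases (h.mem_iff y).1 hy with rfl | ⟨j, t, ht, rfl⟩
  · rw [h.ηz]; simp
  · rw [h.ησ j t ⟨ht.1.le, ht.2⟩]; exact ⟨ht.1.le, ht.2⟩

theorem eq_σ (h : IsStarChart S z σ η) {y : Y} (hy : y ∈ S) (hz : y ≠ z) :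
    η y ∈ Ioo (0 : ℝ) 1 ∧ ∃ j, y = σ j (η y) := by
  rcases (h.mem_iff y).1 hy with rfl | ⟨j, t, ht, rfl⟩
  · exact absurd rfl hz
  · rw [h.ησ j t ⟨ht.1.le, ht.2⟩]; exact ⟨ht, j, rfl⟩

theorem σ_inj (h : IsStarChart S z σ η) {j k : ι} {s t : ℝ} (hs : s ∈ Ioo (0 : ℝ) 1)
    (ht : t ∈ Ico (0 : ℝ) 1) (he : σ j s = σ k t) : j = k ∧ s = t := by
  have h1 := h.ησ j s ⟨hs.1.le, hs.2⟩
  have h2 := h.ησ k t ht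
  have : s = t := by rw [← h1, he, h2]
  subst this
  exact ⟨h.disj j k s hs he, rfl⟩

theorem σ_ne (h : IsStarChart S z σ η) {j : ι} {t : ℝ} (ht : t ∈ Ioo (0 : ℝ) 1) : σ j t ≠ z := by
  intro he
  have := h.ησ j t ⟨ht.1.le, ht.2⟩
  rw [he, h.ηz] at this
  exact absurd this ht.1.ne

theorem σ_injOn (h : IsStarChart S z σ η) (j : ι) : InjOn (σ j) (Ico 0 1) := by
  intro s hs t ht he
  rw [← h.ησ j s hs, ← h.ησ j t ht, he]

/-- This is the coincidence set of the inclusion with `y ↦ σ j (η y)`, two continuous maps into a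
Hausdorff space. The height function serves to make this available. -/
theorem isClosed_prong [T2Space Y] (h : IsStarChart S z σ η) (j : ι) :
    IsClosed {y : S | y.1 = σ j (η y.1)} := by
  have h1 : Continuous fun y : S => η y.1 := continuousOn_iff_continuous_domRestrict.1 h.contη
  have h2 : Continuous fun y : S => σ j (η y.1) :=
    (h.cont j).comp_continuous h1 fun y => h.η_mem y.2
  exact isClosed_eq continuous_subtype_val h2

/-- The complement is the center together with the other closed prongs, a finite union of closed
sets. -/
theorem isOpen_prong [T2Space Y] [Finite ι] (h : IsStarChart S z σ η) (j : ι) :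
    IsOpen {y : S | y.1 ≠ z ∧ y.1 = σ j (η y.1)} := by
  have : {y : S | y.1 ≠ z ∧ y.1 = σ j (η y.1)} =
      ({y : S | y.1 = z} ∪ ⋃ k : {k : ι // k ≠ j}, {y : S | y.1 = σ k (η y.1)})ᶜ := by
    ext y
    simp only [mem_ofPred_eq, compl_union, mem_inter_iff, mem_compl_iff, mem_iUnion, not_exists,
      Subtype.forall]
    refine and_congr_right fun hz => ?_
    obtain ⟨h1, k, hk⟩ := h.eq_σ y.2 hz
    constructor
    · intro hj l hl hl'
      exact hl (h.disj l j _ h1 (hl'.symm.trans hj))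
    · intro hl
      by_cases hkj : k = j
      · rwa [← hkj]
      · exact absurd hk (hl k hkj)
  rw [this, isOpen_compl_iff]
  refine (isClosed_eq continuous_subtype_val continuous_const).union ?_
  exact isClosed_iUnion_of_finite fun k => h.isClosed_prong k.1

/-- A star with finitely many parametrized prongs is homeomorphic to the model star. -/
theorem exists_homeo [T2Space Y] {n : ℕ} {σ : Fin n → ℝ → Y} (h : IsStarChart S z σ η) :
    ∃ e : ModelStar n ≃ₜ S, (e (ModelStar.center n) : Y) = z ∧
      ∀ j, ∀ t ∈ Ico (0 : ℝ) 1, (e (ModelStar.ray j t) : Y) = σ j t := by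
  classical
  -- At most one coordinate of a point of the model star is positive, so the choice of prong is
  -- forced.
  let F : ModelStar n → S := fun v =>
    if hv : ∃ j, 0 < v.1 j then ⟨σ hv.choose (v.1 hv.choose), h.mem _ (v.2.1 _)⟩
    else ⟨z, h.center_mem⟩
  have Fray : ∀ j, ∀ t ∈ Ico (0 : ℝ) 1, (F (ModelStar.ray j t) : Y) = σ j t := by
    intro j t ht
    have hr := ModelStar.ray_apply j ht
    by_cases hv : ∃ i, 0 < (ModelStar.ray j t).1 i
    · have hc := hv.choose_spec
      have hj : hv.choose = j := by
        by_contra hne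
        have h0 := congrFun hr hv.choose
        rw [Pi.single_eq_of_ne hne] at h0
        exact hc.ne' h0
      simp only [F, dif_pos hv]
      rw [hj, hr]
      simp
    · have ht0 : t = 0 := by
        by_contra hne
        exact hv ⟨j, by rw [hr]; simpa using lt_of_le_of_ne ht.1 (Ne.symm hne)⟩
      simp only [F, dif_neg hv]
      rw [ht0, h.zero]
  have Fc : (F (ModelStar.center n) : Y) = z := by
    have : ¬ ∃ i, 0 < (ModelStar.center n).1 i := by simp [ModelStar.center]
    simp only [F, dif_neg this]
  let G : S → ModelStar n := fun y =>
    if hy : ∃ j, y.1 ≠ z ∧ y.1 = σ j (η y.1) then ModelStar.ray hy.choose (η y.1)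
    else ModelStar.center n
  have GF : ∀ v, G (F v) = v := by
    intro v
    rcases v.eq_center_or with rfl | ⟨j, hj⟩
    · have : ¬ ∃ j, (F (ModelStar.center n)).1 ≠ z ∧
          (F (ModelStar.center n)).1 = σ j (η (F (ModelStar.center n)).1) := by
        rintro ⟨j, hj, -⟩
        exact hj Fc
      simp only [G, dif_neg this]
    · have hv := (v.eq_ray j hj.ne').1
      have hI := v.2.1 j
      have h1 : (F v : Y) = σ j (v.1 j) := by
        conv_lhs => rw [hv]
        exact Fray j _ hI
      have h2 : η (F v : Y) = v.1 j := by rw [h1]; exact h.ησ j _ hI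
      have hy : ∃ j, (F v).1 ≠ z ∧ (F v).1 = σ j (η (F v).1) :=
        ⟨j, by rw [h1]; exact h.σ_ne ⟨hj, hI.2⟩, by rw [h2, h1]⟩
      have hc := hy.choose_spec
      have hcj : hy.choose = j := by
        refine h.disj _ _ (v.1 j) ⟨hj, hI.2⟩ ?_
        rw [← h1]
        exact (hc.2.trans (congrArg _ h2)).symm
      simp only [G, dif_pos hy]
      rw [hcj, h2, ← hv]
  have FG : ∀ y, F (G y) = y := by
    intro y
    apply Subtype.ext
    by_cases hy : ∃ j, y.1 ≠ z ∧ y.1 = σ j (η y.1)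
    · simp only [G, dif_pos hy]
      rw [Fray _ _ (h.η_mem y.2)]
      exact hy.choose_spec.2.symm
    · have hz : y.1 = z := by
        by_contra hz
        obtain ⟨-, j, hj⟩ := h.eq_σ y.2 hz
        exact hy ⟨j, hz, hj⟩
      simp only [G, dif_neg hy]
      rw [Fc, hz]
  have cF : Continuous F := by
    rw [continuous_induced_rng, continuous_iff_continuousAt]
    intro v
    rcases v.eq_center_or with rfl | ⟨j, hj⟩
    · rw [ContinuousAt]
      show Filter.Tendsto (fun v => (F v : Y)) _ (𝓝 (F (ModelStar.center n) : Y))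
      rw [Fc, Filter.tendsto_def]
      intro N hN
      -- There are finitely many prongs, so one neighborhood of the center serves all of them.
      have : ∀ᶠ v in 𝓝 (ModelStar.center n), ∀ j, σ j (v.1 j) ∈ N := by
        rw [Filter.eventually_all]
        intro j
        have h1 := h.cont j 0 (by simp)
        rw [ContinuousWithinAt, h.zero] at h1
        have h2 : Filter.Tendsto (fun v : ModelStar n => v.1 j) (𝓝 (ModelStar.center n))
            (𝓝[Ico 0 1] 0) := by
          refine tendsto_nhdsWithin_iff.2 ⟨?_, Filter.Eventually.of_forall fun v => v.2.1 j⟩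
          have : Continuous fun v : ModelStar n => v.1 j := ModelStar.continuous_coord j
          exact this.tendsto' _ _ rfl
        exact (h1.comp h2) hN
      filter_upwards [this] with v hv
      rcases v.eq_center_or with rfl | ⟨j, hj⟩
      · show (F _ : Y) ∈ N
        rw [Fc]; exact mem_of_mem_nhds hN
      · show (F v : Y) ∈ N
        rw [(v.eq_ray j hj.ne').1, Fray j _ (v.2.1 j)]
        exact hv j
    · have h1 : ContinuousAt (fun v : ModelStar n => σ j (v.1 j)) v := by
        have h3 : Continuous fun v : ModelStar n => v.1 j := ModelStar.continuous_coord j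
        refine ContinuousAt.comp (g := σ j) ?_ h3.continuousAt
        exact (h.cont j).continuousAt (Ico_mem_nhds hj (v.2.1 j).2)
      refine h1.congr ?_
      have h3 : Continuous fun v : ModelStar n => v.1 j := ModelStar.continuous_coord j
      filter_upwards [h3.continuousAt.eventually (lt_mem_nhds hj)] with w hw
      show _ = (F w : Y)
      conv_rhs => rw [(w.eq_ray j (ne_of_gt hw)).1]
      exact (Fray j _ (w.2.1 j)).symm
  have cG : Continuous G := by
    have hη : Continuous fun y : S => η y.1 := continuousOn_iff_continuous_domRestrict.1 h.contη
    rw [continuous_induced_rng]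
    refine continuous_pi fun j => ?_
    -- The `j`-th coordinate of the inverse is the height on prong `j` and zero elsewhere. At the
    -- center it is squeezed by the height; elsewhere the prong is locally constant because open
    -- prongs are open.
    have hG : ∀ y : S, (G y).1 j = if y.1 ≠ z ∧ y.1 = σ j (η y.1) then η y.1 else 0 := by
      intro y
      by_cases hy : ∃ j, y.1 ≠ z ∧ y.1 = σ j (η y.1)
      · have hc := hy.choose_spec
        have h1 := (h.eq_σ y.2 hc.1).1
        simp only [G, dif_pos hy]
        rw [ModelStar.ray_apply _ (h.η_mem y.2)]
        by_cases hj : y.1 ≠ z ∧ y.1 = σ j (η y.1)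
        · have : hy.choose = j := h.disj _ _ _ h1 (hc.2.symm.trans hj.2)
          rw [if_pos hj, this]; simp
        · rw [if_neg hj]
          have : j ≠ hy.choose := by
            rintro hjc
            exact hj (hjc ▸ hc)
          simp [this]
      · simp only [G, dif_neg hy]
        rw [if_neg (fun hj => hy ⟨j, hj⟩)]
        rfl
    show Continuous fun y : S => (G y).1 j
    simp_rw [hG]
    rw [continuous_iff_continuousAt]
    intro y
    by_cases hz : y.1 = z
    · have h0 : η y.1 = 0 := by rw [hz, h.ηz]
      rw [ContinuousAt, if_neg (fun hh => hh.1 hz)]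
      have := (hη.tendsto y)
      simp only [h0] at this
      refine squeeze_zero (fun w => ?_) (fun w => ?_) this
      · split_ifs
        · exact (h.η_mem w.2).1
        · exact le_rfl
      · split_ifs
        · exact le_rfl
        · exact (h.η_mem w.2).1
    · obtain ⟨h1, k, hk⟩ := h.eq_σ y.2 hz
      have ho := (h.isOpen_prong k).mem_nhds (x := y) ⟨hz, hk⟩
      by_cases hkj : k = j
      · subst hkj
        refine hη.continuousAt.congr ?_
        filter_upwards [ho] with w hw
        rw [if_pos hw]
      · refine (continuousAt_const (y := (0 : ℝ))).congr ?_
        filter_upwards [ho] with w hw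
        rw [if_neg]
        rintro ⟨hw1, hw2⟩
        exact hkj (h.disj _ _ _ (h.eq_σ w.2 hw1).1 (hw.2.symm.trans hw2))
  exact ⟨⟨⟨F, G, GF, FG⟩, cF, cG⟩, Fc, Fray⟩

/-- The star chart given by a homeomorphism with the model star. -/
theorem of_homeo {n : ℕ} (e : ModelStar n ≃ₜ S) (hz : (e (ModelStar.center n) : Y) = z) :
    ∃ η : Y → ℝ, IsStarChart S z (fun j t => (e (ModelStar.ray j t) : Y)) η ∧
      ∀ y : S, η y = (e.symm y).height := by
  classical
  let η : Y → ℝ := fun y => if hy : y ∈ S then (e.symm ⟨y, hy⟩).height else 0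
  have hη : ∀ y : S, η y = (e.symm y).height := fun y => by simp [η, y.2]
  have hc0 : (ModelStar.center n).height = 0 := by simp [ModelStar.height, ModelStar.center]
  refine ⟨η, ⟨?_, ?_, ?_, ?_, ?_, ?_, ?_⟩, hη⟩
  · intro j
    exact (continuous_subtype_val.comp e.continuous).comp_continuousOn (ModelStar.continuousOn_ray j)
  · intro j
    simp only [ModelStar.ray_zero, hz]
  · rw [continuousOn_iff_continuous_domRestrict]
    have : S.domRestrict η = fun y => (e.symm y).height := funext hη
    rw [this]
    exact ModelStar.continuous_height.comp e.symm.continuous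
  · rw [← hz, hη, e.symm_apply_apply, hc0]
  · intro j t ht
    rw [hη, e.symm_apply_apply, ModelStar.height_ray j ht]
  · intro y
    constructor
    · intro hy
      rcases (e.symm ⟨y, hy⟩).eq_center_or with hc | ⟨j, hj⟩
      · left
        rw [← hz, ← hc, e.apply_symm_apply]
      · right
        refine ⟨j, _, ⟨hj, ((e.symm ⟨y, hy⟩).2.1 j).2⟩, ?_⟩
        rw [← (ModelStar.eq_ray _ j hj.ne').1, e.apply_symm_apply]
    · rintro (rfl | ⟨j, t, -, rfl⟩)
      · rw [← hz]; exact Subtype.coe_prop _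
      · exact Subtype.coe_prop _
  · intro j k t ht hjk
    have h1 := e.injective (Subtype.ext hjk)
    have h2 := congrArg (fun v : ModelStar n => v.1 j) h1
    simp only [ModelStar.ray_apply _ (Ioo_subset_Ico_self ht)] at h2
    by_contra hne
    rw [Pi.single_eq_same, Pi.single_eq_of_ne hne] at h2
    exact ht.1.ne' h2

theorem reindex (h : IsStarChart S z σ η) (e : κ ≃ ι) : IsStarChart S z (σ ∘ e) η where
  cont j := h.cont (e j)
  zero j := h.zero (e j)
  contη := h.contη
  ηz := h.ηz
  ησ j := h.ησ (e j)
  mem_iff y := by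
    rw [h.mem_iff]
    exact or_congr_right (e.surjective.exists (p := fun j => ∃ t ∈ Ioo (0 : ℝ) 1, y = σ j t))
  disj j k t ht he := e.injective (h.disj _ _ t ht he)

/-- The substar formed by some of the prongs. -/
theorem sub (h : IsStarChart S z σ η) (φ : κ → ι) (hφ : Function.Injective φ) :
    IsStarChart {y | y = z ∨ ∃ j, ∃ t ∈ Ioo (0 : ℝ) 1, y = σ (φ j) t} z (fun j => σ (φ j)) η where
  cont j := h.cont _
  zero j := h.zero _
  contη := h.contη.mono <| by
    rintro y (rfl | ⟨j, t, ht, rfl⟩)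
    · exact h.center_mem
    · exact h.mem _ ⟨ht.1.le, ht.2⟩
  ηz := h.ηz
  ησ j := h.ησ _
  mem_iff y := Iff.rfl
  disj j k t ht he := hφ (h.disj _ _ t ht he)

/-- The substar of points of height less than `ε`. -/
theorem shrink (h : IsStarChart S z σ η) {ε : ℝ} (h0 : 0 < ε) (h1 : ε ≤ 1) :
    IsStarChart {y ∈ S | η y < ε} z (fun j t => σ j (ε * t)) (fun y => η y / ε) := by
  have key : ∀ t ∈ Ico (0 : ℝ) 1, ε * t ∈ Ico (0 : ℝ) 1 := fun t ht =>
    ⟨mul_nonneg h0.le ht.1, by nlinarith [ht.1, ht.2]⟩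
  refine ⟨fun j => ?_, fun j => ?_, ?_, ?_, ?_, ?_, ?_⟩
  · exact (h.cont j).comp (by fun_prop) key
  · simp [h.zero]
  · exact (h.contη.mono fun y hy => hy.1).div_const _
  · simp [h.ηz]
  · intro j t ht
    rw [h.ησ j _ (key t ht)]
    field_simp
  · intro y
    constructor
    · rintro ⟨hy, hε⟩
      by_cases hz : y = z
      · exact Or.inl hz
      · obtain ⟨h2, j, hj⟩ := h.eq_σ hy hz
        refine Or.inr ⟨j, η y / ε, ⟨div_pos h2.1 h0, (div_lt_one h0).2 hε⟩, ?_⟩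
        rw [mul_div_cancel₀ _ h0.ne']
        exact hj
    · rintro (rfl | ⟨j, t, ht, rfl⟩)
      · exact ⟨h.center_mem, by rwa [h.ηz]⟩
      · have ht' := key t ⟨ht.1.le, ht.2⟩
        refine ⟨h.mem _ ht', ?_⟩
        rw [h.ησ j _ ht']
        nlinarith [ht.2]
  · intro j k t ht he
    exact h.disj j k _ ⟨mul_pos h0 ht.1, (key t ⟨ht.1.le, ht.2⟩).2⟩ he

/-- A two-pronged star around an interior point of a prong. -/
theorem interior (h : IsStarChart S z σ η) (j : ι) {t₀ : ℝ} (ht₀ : t₀ ∈ Ioo (0 : ℝ) 1) {δ : ℝ}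
    (hδ : 0 < δ) (hδ0 : δ ≤ t₀) (hδ1 : δ ≤ 1 - t₀) :
    IsStarChart (σ j '' Ioo (t₀ - δ) (t₀ + δ)) (σ j t₀)
      (fun (i : Fin 2) s => σ j (if i = 0 then t₀ + δ * s else t₀ - δ * s))
      (fun y => |η y - t₀| / δ) := by
  have hI : ∀ t ∈ Ioo (t₀ - δ) (t₀ + δ), t ∈ Ico (0 : ℝ) 1 := fun t ht =>
    ⟨by linarith [ht.1], by linarith [ht.2]⟩
  have key : ∀ (i : Fin 2), ∀ s ∈ Ico (0 : ℝ) 1,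
      (if i = 0 then t₀ + δ * s else t₀ - δ * s) ∈ Ioo (t₀ - δ) (t₀ + δ) := by
    intro i s hs
    have h1 : δ * s < δ := by nlinarith [hs.2]
    have h2 : 0 ≤ δ * s := mul_nonneg hδ.le hs.1
    split_ifs
    · constructor <;> linarith
    · constructor <;> linarith
  refine ⟨fun i => ?_, fun i => ?_, ?_, ?_, ?_, ?_, ?_⟩
  · refine (h.cont j).comp (f := fun s => if i = 0 then t₀ + δ * s else t₀ - δ * s) ?_
      fun s hs => hI _ (key i s hs)
    split_ifs <;> fun_prop
  · simp
  · refine ContinuousOn.div_const ?_ _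
    refine ContinuousOn.abs ?_
    refine (h.contη.mono ?_).sub continuousOn_const
    rintro y ⟨t, ht, rfl⟩
    exact h.mem _ (hI t ht)
  · simp [h.ησ j t₀ ⟨ht₀.1.le, ht₀.2⟩]
  · intro i s hs
    rw [h.ησ j _ (hI _ (key i s hs))]
    have h2 : 0 ≤ δ * s := mul_nonneg hδ.le hs.1
    split_ifs
    · rw [add_sub_cancel_left, abs_of_nonneg h2]; field_simp
    · rw [show t₀ - δ * s - t₀ = -(δ * s) by ring, abs_neg, abs_of_nonneg h2]; field_simp
  · intro y
    constructor
    · rintro ⟨t, ht, rfl⟩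
      rcases lt_trichotomy t t₀ with h1 | h1 | h1
      · refine Or.inr ⟨1, (t₀ - t) / δ, ⟨div_pos (by linarith) hδ,
          (div_lt_one hδ).2 (by linarith [ht.1])⟩, ?_⟩
        simp [mul_div_cancel₀ _ hδ.ne']
      · left; rw [h1]
      · refine Or.inr ⟨0, (t - t₀) / δ, ⟨div_pos (by linarith) hδ,
          (div_lt_one hδ).2 (by linarith [ht.2])⟩, ?_⟩
        simp [mul_div_cancel₀ _ hδ.ne']
    · rintro (rfl | ⟨i, s, hs, rfl⟩)
      · exact ⟨t₀, by constructor <;> linarith, rfl⟩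
      · exact ⟨_, key i s ⟨hs.1.le, hs.2⟩, rfl⟩
  · intro i k s hs he
    have := h.σ_injOn j (hI _ (key i s ⟨hs.1.le, hs.2⟩)) (hI _ (key k s ⟨hs.1.le, hs.2⟩)) he
    have h2 : 0 < δ * s := mul_pos hδ hs.1
    fin_cases i <;> fin_cases k <;> simp at this ⊢ <;> linarith

/-- Disjoint arcs issuing from the center of a star lie initially in distinct prongs. -/
theorem arcs [T2Space Y] [Finite ι] {J : Type*} (h : IsStarChart S z σ η) {g : J → ℝ → Y}
    {ε : ℝ} (hε : 0 < ε) (gc : ∀ j, ContinuousOn (g j) (Ico 0 ε)) (g0 : ∀ j, g j 0 = z)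
    (gS : ∀ j, ∀ t ∈ Ioo 0 ε, g j t ∈ S) (gz : ∀ j, ∀ t ∈ Ioo 0 ε, g j t ≠ z)
    (gd : ∀ j k, j ≠ k → ∀ s ∈ Ioo 0 ε, ∀ t ∈ Ioo 0 ε, g j s ≠ g k t) :
    ∃ b : J → ι, Function.Injective b ∧ ∀ j, ∃ δ > 0, δ ≤ 1 ∧ ∀ s ∈ Ioo 0 δ, ∃ t ∈ Ioo 0 ε,
      g j t = σ (b j) s := by
  have main : ∀ j, ∃ k, ∃ δ > 0, δ ≤ 1 ∧ ∀ s ∈ Ioo 0 δ, ∃ t ∈ Ioo 0 ε, g j t = σ k s := by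
    intro j
    have gS' : ∀ t ∈ Ico 0 ε, g j t ∈ S := by
      intro t ht
      rcases eq_or_lt_of_le ht.1 with h0 | h0
      · rw [← h0, g0]; exact h.center_mem
      · exact gS j t ⟨h0, ht.2⟩
    have hm : ε / 2 ∈ Ioo 0 ε := ⟨by linarith, by linarith⟩
    obtain ⟨h1, k, hk⟩ := h.eq_σ (gS j _ hm) (gz j _ hm)
    have hT : ∀ l, IsClosed {t : Ioo 0 ε | g j t = σ l (η (g j t))} := by
      intro l
      have c1 : Continuous fun t : Ioo 0 ε => (⟨g j t, gS j t t.2⟩ : S) := by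
        refine Continuous.subtype_mk ?_ _
        exact ((gc j).mono Ioo_subset_Ico_self).comp_continuous continuous_subtype_val
          fun t => t.2
      exact (h.isClosed_prong l).preimage c1
    -- The prong on which the arc lies is locally constant, since the finitely many closed prongs
    -- partition the punctured star; the arc is connected, so it stays on one prong.
    have hclopen : IsClopen {t : Ioo 0 ε | g j t = σ k (η (g j t))} := by
      refine ⟨hT k, ?_⟩
      have : {t : Ioo 0 ε | g j t = σ k (η (g j t))} =
          (⋃ l : {l : ι // l ≠ k}, {t : Ioo 0 ε | g j t = σ l (η (g j t))})ᶜ := by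
        ext t
        obtain ⟨h2, l, hl⟩ := h.eq_σ (gS j t t.2) (gz j t t.2)
        simp only [mem_ofPred_eq, mem_compl_iff, mem_iUnion, Subtype.exists, not_exists]
        constructor
        · intro ht i hi hi'
          exact hi (h.disj _ _ _ h2 (hi'.symm.trans ht))
        · intro hi
          by_cases hlk : l = k
          · rwa [← hlk]
          · exact absurd hl (hi l hlk)
      rw [this, isOpen_compl_iff]
      exact isClosed_iUnion_of_finite fun l => hT l
    have : PreconnectedSpace (Ioo 0 ε) := Subtype.preconnectedSpace isPreconnected_Ioo
    have huniv := hclopen.eq_univ ⟨⟨ε / 2, hm⟩, hk⟩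
    have hall : ∀ t ∈ Ioo 0 ε, g j t = σ k (η (g j t)) := fun t ht =>
      (huniv ▸ mem_univ (⟨t, ht⟩ : Ioo 0 ε) : (⟨t, ht⟩ : Ioo 0 ε) ∈ _)
    have huc : ContinuousOn (fun t => η (g j t)) (Icc 0 (ε / 2)) :=
      (h.contη.comp (gc j) gS').mono fun t ht => ⟨ht.1, by linarith [ht.2]⟩
    refine ⟨k, η (g j (ε / 2)), h1.1, h1.2.le, fun s hs => ?_⟩
    have hs' : s ∈ Ioo (η (g j 0)) (η (g j (ε / 2))) := by
      rw [g0, h.ηz]; exact hs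
    -- Every height between zero and that of the midpoint is attained, so the arc sweeps out an
    -- initial segment of its prong.
    obtain ⟨t, ht, hts⟩ := intermediate_value_Ioo (by linarith : (0 : ℝ) ≤ ε / 2) huc hs'
    have ht' : t ∈ Ioo 0 ε := ⟨ht.1, by linarith [ht.2]⟩
    refine ⟨t, ht', ?_⟩
    rw [hall t ht']
    exact congrArg _ hts
  choose b δ hδ hδ1 hb using main
  refine ⟨b, ?_, fun j => ⟨δ j, hδ j, hδ1 j, hb j⟩⟩
  intro j k hjk
  by_contra hne
  -- Two arcs on the same prong would both sweep out its point at half of this height, although they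
  -- are disjoint.
  have hpos : 0 < min (δ j) (δ k) := lt_min (hδ j) (hδ k)
  obtain ⟨t, ht, e1⟩ := hb j (min (δ j) (δ k) / 2)
    ⟨by linarith, by linarith [min_le_left (δ j) (δ k)]⟩
  obtain ⟨t', ht', e2⟩ := hb k (min (δ j) (δ k) / 2)
    ⟨by linarith, by linarith [min_le_right (δ j) (δ k)]⟩
  refine gd j k hne t ht t' ht' ?_
  rw [e1, e2, hjk]

/-- This is the topological bound behind all comparisons of prong numbers below. -/
theorem card_arcs_le [T2Space Y] [Finite ι] {J : Type*} (h : IsStarChart S z σ η)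
    {g : J → ℝ → Y} {ε : ℝ} (hε : 0 < ε) (gc : ∀ j, ContinuousOn (g j) (Ico 0 ε))
    (g0 : ∀ j, g j 0 = z) (gS : ∀ j, ∀ t ∈ Ioo 0 ε, g j t ∈ S)
    (gz : ∀ j, ∀ t ∈ Ioo 0 ε, g j t ≠ z)
    (gd : ∀ j k, j ≠ k → ∀ s ∈ Ioo 0 ε, ∀ t ∈ Ioo 0 ε, g j s ≠ g k t) :
    Nat.card J ≤ Nat.card ι := by
  obtain ⟨b, hb, -⟩ := h.arcs hε gc g0 gS gz gd
  exact Nat.card_le_card_of_injective b hb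

/-- If there are as many disjoint arcs as prongs, the arcs cover a neighborhood of the center. -/
theorem arcs_cover [T2Space Y] [Finite ι] {J : Type*} [Finite J] (h : IsStarChart S z σ η)
    {g : J → ℝ → Y} {ε : ℝ} (hε : 0 < ε) (gc : ∀ j, ContinuousOn (g j) (Ico 0 ε))
    (g0 : ∀ j, g j 0 = z) (gS : ∀ j, ∀ t ∈ Ioo 0 ε, g j t ∈ S)
    (gz : ∀ j, ∀ t ∈ Ioo 0 ε, g j t ≠ z)
    (gd : ∀ j k, j ≠ k → ∀ s ∈ Ioo 0 ε, ∀ t ∈ Ioo 0 ε, g j s ≠ g k t)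
    (hcard : Nat.card ι ≤ Nat.card J) :
    ∃ δ > 0, δ ≤ 1 ∧ ∀ y ∈ S, y ≠ z → η y < δ → ∃ j, ∃ t ∈ Ioo 0 ε, g j t = y := by
  obtain ⟨b, hb, hcov⟩ := h.arcs hε gc g0 gS gz gd
  have hsurj : Function.Surjective b := by
    have := Fintype.ofFinite ι
    have := Fintype.ofFinite J
    have : Fintype.card J = Fintype.card ι := by
      have := Nat.card_le_card_of_injective b hb
      rw [← Nat.card_eq_fintype_card, ← Nat.card_eq_fintype_card]
      omega
    exact ((Fintype.bijective_iff_injective_and_card b).2 ⟨hb, this⟩).2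
  choose δ hδ hδ1 hcov using hcov
  obtain ⟨d, hd0, hd⟩ : ∃ d > 0, ∀ j, d ≤ δ j := by
    cases isEmpty_or_nonempty J
    · exact ⟨1, one_pos, fun j => isEmptyElim j⟩
    · obtain ⟨j, hj⟩ := Finite.exists_min δ
      exact ⟨δ j, hδ j, hj⟩
  refine ⟨min d 1, lt_min hd0 one_pos, min_le_right _ _, fun y hy hz hyd => ?_⟩
  obtain ⟨h1, k, hk⟩ := h.eq_σ hy hz
  obtain ⟨j, rfl⟩ := hsurj k
  obtain ⟨t, ht, e⟩ := hcov j (η y) ⟨h1.1, hyd.trans_le ((min_le_left _ _).trans (hd j))⟩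
  exact ⟨j, t, ht, e.trans hk.symm⟩

/-- Prongs eventually lie in any set that is a neighborhood of the center within the star. -/
theorem exists_small [Finite ι] (h : IsStarChart S z σ η) {N : Set Y} (hN : N ∈ 𝓝[S] z) :
    ∃ ε > 0, ε ≤ 1 ∧ ∀ j, ∀ t ∈ Ico 0 ε, σ j t ∈ N := by
  have : ∀ j, ∃ ε > 0, ∀ t ∈ Ico 0 ε, σ j t ∈ N := by
    intro j
    have h1 : Filter.Tendsto (σ j) (𝓝[Ico 0 1] 0) (𝓝[S] z) := by
      refine tendsto_nhdsWithin_iff.2 ⟨?_, ?_⟩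
      · have := h.cont j 0 (by simp)
        rwa [ContinuousWithinAt, h.zero] at this
      · filter_upwards [self_mem_nhdsWithin] with t ht using h.mem j ht
    have h2 := h1 hN
    rw [Filter.mem_map, mem_nhdsWithin] at h2
    obtain ⟨U, hU, h0, hsub⟩ := h2
    obtain ⟨ε, hε, hball⟩ := Metric.isOpen_iff.1 hU 0 h0
    refine ⟨min ε 1, lt_min hε one_pos, fun t ht => hsub ⟨hball ?_, ht.1, ?_⟩⟩
    · rw [Metric.mem_ball, Real.dist_eq, sub_zero, abs_of_nonneg ht.1]
      exact ht.2.trans_le (min_le_left _ _)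
    · exact ht.2.trans_le (min_le_right _ _)
  choose ε hε hN' using this
  obtain ⟨d, hd0, hd⟩ : ∃ d > 0, ∀ j, d ≤ ε j := by
    cases isEmpty_or_nonempty ι
    · exact ⟨1, one_pos, fun j => isEmptyElim j⟩
    · obtain ⟨j, hj⟩ := Finite.exists_min ε
      exact ⟨ε j, hε j, hj⟩
  exact ⟨min d 1, lt_min hd0 one_pos, min_le_right _ _, fun j t ht =>
    hN' j t ⟨ht.1, ht.2.trans_le ((min_le_left _ _).trans (hd j))⟩⟩

/-- Comparison of two stars with the same center, the first contained in the second near it. -/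
theorem card_le [T2Space Y] [Finite ι] [Finite κ] {S' : Set Y} {σ' : κ → ℝ → Y} {η' : Y → ℝ}
    (h : IsStarChart S z σ η) (h' : IsStarChart S' z σ' η') (hS : S' ∈ 𝓝[S] z) :
    Nat.card ι ≤ Nat.card κ ∧ (Nat.card κ ≤ Nat.card ι → S ∈ 𝓝[S'] z) := by
  obtain ⟨ε, hε, hε1, hsm⟩ := h.exists_small hS
  have hI : ∀ t ∈ Ioo 0 ε, t ∈ Ioo (0 : ℝ) 1 := fun t ht => ⟨ht.1, ht.2.trans_le hε1⟩
  have a1 : ∀ j, ContinuousOn (σ j) (Ico 0 ε) := fun j =>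
    (h.cont j).mono fun t ht => ⟨ht.1, ht.2.trans_le hε1⟩
  have a2 : ∀ j, ∀ t ∈ Ioo 0 ε, σ j t ∈ S' := fun j t ht => hsm j t ⟨ht.1.le, ht.2⟩
  have a3 : ∀ j, ∀ t ∈ Ioo 0 ε, σ j t ≠ z := fun j t ht => h.σ_ne (hI t ht)
  have a4 : ∀ j k, j ≠ k → ∀ s ∈ Ioo 0 ε, ∀ t ∈ Ioo 0 ε, σ j s ≠ σ k t := fun j k hjk s hs t ht e =>
    hjk (h.σ_inj (hI s hs) (Ioo_subset_Ico_self (hI t ht)) e).1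
  refine ⟨h'.card_arcs_le hε a1 h.zero a2 a3 a4, fun hc => ?_⟩
  -- The initial segments of the prongs of `S` are disjoint arcs in `S'`; when there are as many of
  -- them as prongs of `S'`, they exhaust `S'` near the center.
  obtain ⟨δ, hδ, hδ1, hcov⟩ := h'.arcs_cover hε a1 h.zero a2 a3 a4 hc
  have h1 := h'.contη z h'.center_mem
  rw [ContinuousWithinAt, h'.ηz] at h1
  filter_upwards [h1 (gt_mem_nhds hδ), self_mem_nhdsWithin] with y hy hyS
  by_cases hz : y = z
  · rw [hz]; exact h.center_mem
  · obtain ⟨j, t, ht, rfl⟩ := hcov y hyS hz hy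
    exact h.mem j (Ioo_subset_Ico_self (hI t ht))

theorem isStarSet [T2Space Y] {n : ℕ} (hn : 2 ≤ n) {σ : Fin n → ℝ → Y}
    (h : IsStarChart S z σ η) : IsStarSet S n z := by
  obtain ⟨e, he, -⟩ := h.exists_homeo
  exact ⟨hn, e, he⟩

theorem isPathConnected (h : IsStarChart S z σ η) : IsPathConnected S := by
  refine ⟨z, h.center_mem, fun {y} hy => ?_⟩
  by_cases hz : y = z
  · rw [hz]; exact JoinedIn.refl h.center_mem
  · obtain ⟨h1, j, hj⟩ := h.eq_σ hy hz
    have hI : ∀ t ∈ Icc 0 (η y), t ∈ Ico (0 : ℝ) 1 := fun t ht => ⟨ht.1, ht.2.trans_lt h1.2⟩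
    have h2 : IsPathConnected (σ j '' Icc 0 (η y)) :=
      ((convex_Icc 0 (η y)).isPathConnected (nonempty_Icc.2 h1.1.le)).image'
        ((h.cont j).mono hI)
    have h3 := h2.joinedIn z ⟨0, left_mem_Icc.2 h1.1.le, h.zero j⟩ y
      ⟨η y, right_mem_Icc.2 h1.1.le, hj.symm⟩
    refine h3.mono ?_
    rintro _ ⟨t, ht, rfl⟩
    exact h.mem j (hI t ht)

end IsStarChart

theorem IsStarSet.exists_chart {S : Set Y} {n : ℕ} {c : Y} (h : IsStarSet S n c) :
    ∃ (σ : Fin n → ℝ → Y) (η : Y → ℝ), IsStarChart S c σ η := by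
  obtain ⟨-, e, he⟩ := h
  obtain ⟨η, h1, -⟩ := IsStarChart.of_homeo e he
  exact ⟨_, η, h1⟩

end StarCharts

theorem IsStarChart.isOpen_prong_image {Y : Type*} [TopologicalSpace Y] [T2Space Y] {ι : Type*}
    [Finite ι] {S : Set Y} {z : Y} {σ : ι → ℝ → Y} {η : Y → ℝ} (h : IsStarChart S z σ η)
    (hS : IsOpen S) (j : ι) (a b : ℝ) : IsOpen (σ j '' (Ioo 0 1 ∩ Ioo a b)) := by
  have h1 := h.isOpen_prong j
  have h2 : IsOpen {y : S | η y.1 ∈ Ioo a b} :=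
    (isOpen_Ioo (a := a) (b := b)).preimage (continuousOn_iff_continuous_domRestrict.1 h.contη)
  convert hS.isOpenMap_subtype_val _ (h1.inter h2) using 1
  ext y
  constructor
  · rintro ⟨t, ⟨ht, ht'⟩, rfl⟩
    have hI := Ioo_subset_Ico_self ht
    exact ⟨⟨σ j t, h.mem j hI⟩, ⟨⟨h.σ_ne ht, by rw [h.ησ j t hI]⟩, by
      show η (σ j t) ∈ Ioo a b; rwa [h.ησ j t hI]⟩, rfl⟩
  · rintro ⟨y, ⟨⟨hz, hj⟩, hab⟩, rfl⟩
    exact ⟨η y.1, ⟨(h.eq_σ y.2 hz).1, hab⟩, hj.symm⟩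

/-! ### Metric graphs near a point, and unique continuation of local geodesics. -/

section LocalGraph

variable {G : Type*} [MetricSpace G]

/-- `l` parametrizes by arc length the prongs of the star `ball p r`. -/
structure ProngsAt (p : G) (m : ℕ) (r : ℝ) (l : Fin m → ℝ → G) : Prop where
  pos : 0 < r
  zero : ∀ k, l k 0 = p
  dist_same : ∀ k, ∀ s ∈ Ico 0 r, ∀ t ∈ Ico 0 r, dist (l k s) (l k t) = |s - t|
  dist_ne : ∀ j k, j ≠ k → ∀ s ∈ Ico 0 r, ∀ t ∈ Ico 0 r, dist (l j s) (l k t) = s + t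
  ball : ∀ x, dist x p < r → x = p ∨ ∃ k, ∃ s ∈ Ioo 0 r, x = l k s

/-- The prongs are the preimages of the coordinate segments. The `ℓ¹` distance is `|s - t|` within a
segment and `s + t` across two of them. -/
theorem HasValence.exists_prongs {p : G} {m : ℕ} (h : HasValence p m) :
    ∃ r l, ProngsAt p m r l := by
  classical
  obtain ⟨r, hr, φ, hbij, hp, hd⟩ := h
  have hsing : ∀ (k : Fin m) (s : ℝ), s ∈ Ico 0 r → Pi.single k s ∈ starSet m r := by
    intro k s hs
    refine ⟨fun i => ?_, fun i j hij => ?_⟩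
    · by_cases hi : i = k
      · subst hi; simpa using hs
      · simp [hi, hr]
    · by_cases hi : i = k
      · right; subst hi; simp [Ne.symm hij]
      · left; simp [hi]
  have hpre : ∀ (k : Fin m) (s : ℝ), ∃ x, s ∈ Ico 0 r → x ∈ Metric.ball p r ∧ φ x = Pi.single k s := by
    intro k s
    by_cases hs : s ∈ Ico 0 r
    · obtain ⟨x, hx, he⟩ := hbij.surjOn (hsing k s hs)
      exact ⟨x, fun _ => ⟨hx, he⟩⟩
    · exact ⟨p, fun h => absurd h hs⟩
  choose l hl using hpre
  have hpb : p ∈ Metric.ball p r := Metric.mem_ball_self hr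
  refine ⟨r, l, hr, fun k => ?_, fun k s hs t ht => ?_, fun j k hjk s hs t ht => ?_, fun x hx => ?_⟩
  · have := hl k 0 ⟨le_rfl, hr⟩
    exact hbij.injOn this.1 hpb (by rw [this.2, hp]; simp)
  · rw [hd _ (hl k s hs).1 _ (hl k t ht).1, (hl k s hs).2, (hl k t ht).2,
      Finset.sum_eq_single k]
    · simp
    · intro i _ hi; simp [hi]
    · simp
  · rw [hd _ (hl j s hs).1 _ (hl k t ht).1, (hl j s hs).2, (hl k t ht).2,
      Finset.sum_eq_add j k hjk]
    · simp [hjk, Ne.symm hjk, abs_of_nonneg hs.1, abs_of_nonneg ht.1]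
    · intro i _ hi; simp [hi.1, hi.2]
    · simp
    · simp
  · have hx' : x ∈ Metric.ball p r := hx
    have hv := hbij.mapsTo hx'
    by_cases h0 : φ x = 0
    · left; exact hbij.injOn hx' hpb (by rw [h0, hp])
    · right
      obtain ⟨k, hk⟩ := Function.ne_iff.1 h0
      have hk' : φ x k ≠ 0 := hk
      refine ⟨k, φ x k, ⟨lt_of_le_of_ne (hv.1 k).1 (Ne.symm hk'), (hv.1 k).2⟩, ?_⟩
      have := hl k (φ x k) (hv.1 k)
      refine hbij.injOn hx' this.1 ?_
      rw [this.2]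
      ext i
      by_cases hi : i = k
      · subst hi; simp
      · simp [hi, (hv.2 i k hi).resolve_right hk']

namespace ProngsAt

variable {p : G} {m : ℕ} {r : ℝ} {l : Fin m → ℝ → G}

theorem dist_center (h : ProngsAt p m r l) (k : Fin m) {s : ℝ} (hs : s ∈ Ico 0 r) :
    dist (l k s) p = s := by
  have := h.dist_same k s hs 0 ⟨le_rfl, h.pos⟩
  rwa [h.zero, sub_zero, abs_of_nonneg hs.1] at this

theorem shrink (h : ProngsAt p m r l) {r' : ℝ} (h0 : 0 < r') (h1 : r' ≤ r) :
    ProngsAt p m r' l where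
  pos := h0
  zero := h.zero
  dist_same k s hs t ht := h.dist_same k s ⟨hs.1, hs.2.trans_le h1⟩ t ⟨ht.1, ht.2.trans_le h1⟩
  dist_ne j k hjk s hs t ht :=
    h.dist_ne j k hjk s ⟨hs.1, hs.2.trans_le h1⟩ t ⟨ht.1, ht.2.trans_le h1⟩
  ball x hx := by
    rcases h.ball x (hx.trans_le h1) with rfl | ⟨k, s, hs, rfl⟩
    · exact Or.inl rfl
    · refine Or.inr ⟨k, s, ⟨hs.1, ?_⟩, rfl⟩
      rwa [h.dist_center k ⟨hs.1.le, hs.2⟩] at hx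

theorem chart (h : ProngsAt p m r l) :
    IsStarChart (Metric.ball p r) p (fun k t => l k (r * t)) (fun y => dist y p / r) := by
  have key : ∀ t ∈ Ico (0 : ℝ) 1, r * t ∈ Ico 0 r := fun t ht =>
    ⟨mul_nonneg h.pos.le ht.1, by nlinarith [ht.2, h.pos]⟩
  refine ⟨fun j => ?_, fun j => ?_, ?_, ?_, ?_, ?_, ?_⟩
  · have hc : ContinuousOn (l j) (Ico 0 r) := by
      refine (LipschitzOnWith.of_dist_le_mul (K := 1) fun s hs t ht => ?_).continuousOn
      rw [h.dist_same j s hs t ht, Real.dist_eq]; simp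
    exact hc.comp (by fun_prop) key
  · simp [h.zero]
  · fun_prop
  · simp
  · intro j t ht
    have := h.pos
    simp only [h.dist_center j (key t ht)]
    field_simp
  · intro y
    constructor
    · intro hy
      rcases h.ball y hy with rfl | ⟨k, s, hs, rfl⟩
      · exact Or.inl rfl
      · refine Or.inr ⟨k, s / r, ⟨div_pos hs.1 h.pos, (div_lt_one h.pos).2 hs.2⟩, ?_⟩
        rw [mul_div_cancel₀ _ h.pos.ne']
    · rintro (rfl | ⟨j, t, ht, rfl⟩)
      · exact Metric.mem_ball_self h.pos
      · rw [Metric.mem_ball, h.dist_center j (key t ⟨ht.1.le, ht.2⟩)]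
        exact (key t ⟨ht.1.le, ht.2⟩).2
  · intro j k t ht he
    by_contra hjk
    have ht' := key t ⟨ht.1.le, ht.2⟩
    have := h.dist_ne j k hjk _ ht' _ ht'
    rw [he, dist_self] at this
    nlinarith [mul_pos h.pos ht.1]

theorem inj (h : ProngsAt p m r l) {j k : Fin m} {s t : ℝ} (hs : s ∈ Ioo 0 r) (ht : t ∈ Ico 0 r)
    (he : l j s = l k t) : j = k ∧ s = t := by
  have h1 := h.dist_center j ⟨hs.1.le, hs.2⟩
  have h2 := h.dist_center k ht
  have hst : s = t := by rw [← h1, he, h2]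
  refine ⟨?_, hst⟩
  by_contra hjk
  have := h.dist_ne j k hjk s ⟨hs.1.le, hs.2⟩ t ht
  rw [he, dist_self] at this
  linarith [hs.1, ht.1]

end ProngsAt

/-- Inside a prong there is an open two-pronged star around the point, and comparison with it bounds
the number of prongs of any star ball there. -/
theorem ProngsAt.not_isNatural {p : G} {m : ℕ} {r : ℝ} {l : Fin m → ℝ → G}
    (h : ProngsAt p m r l) (k : Fin m) {s : ℝ} (hs : s ∈ Ioo 0 r) : ¬ IsNatural (l k s) := by
  rintro ⟨n, hn, hv⟩
  obtain ⟨r', l', hl'⟩ := hv.exists_prongs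
  have ht : s / r ∈ Ioo (0 : ℝ) 1 := ⟨div_pos hs.1 h.pos, (div_lt_one h.pos).2 hs.2⟩
  have hδ : 0 < min (s / r) (1 - s / r) := lt_min ht.1 (by linarith [ht.2])
  have hc := h.chart.interior k ht hδ (min_le_left _ _) (min_le_right _ _)
  have he : r * (s / r) = s := mul_div_cancel₀ _ h.pos.ne'
  have hopen := h.chart.isOpen_prong_image Metric.isOpen_ball k
    (s / r - min (s / r) (1 - s / r)) (s / r + min (s / r) (1 - s / r))
  rw [he] at hc
  have := (hl'.chart.card_le hc ?_).1
  · simp only [Nat.card_eq_fintype_card, Fintype.card_fin] at this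
    omega
  · refine mem_nhdsWithin_of_mem_nhds (Filter.mem_of_superset (hopen.mem_nhds ?_)
      (image_mono inter_subset_right))
    refine ⟨s / r, ⟨ht, by constructor <;> linarith⟩, ?_⟩
    show l k (r * (s / r)) = l k s
    rw [he]

/-- `L` parametrizes an open neighborhood of `L 0` isometrically by an interval. -/
structure LineAt (r : ℝ) (L : ℝ → G) : Prop where
  pos : 0 < r
  dist : ∀ s ∈ Ioo (-r) r, ∀ t ∈ Ioo (-r) r, dist (L s) (L t) = |s - t|
  nhds : L '' Ioo (-r) r ∈ 𝓝 (L 0)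

/-- The valence is two, and the two prongs, one of them reversed, join to an isometrically
parametrized line. -/
theorem exists_line (hG : ∀ p : G, ∃ m, 2 ≤ m ∧ HasValence p m) {p : G} (hp : ¬ IsNatural p) :
    ∃ r L, LineAt r L ∧ L 0 = p := by
  obtain ⟨m, hm, hv⟩ := hG p
  have hm2 : m = 2 := by
    by_contra hne
    exact hp ⟨m, by omega, hv⟩
  subst hm2
  obtain ⟨r, l, hl⟩ := hv.exists_prongs
  refine ⟨r, fun s => if 0 ≤ s then l 0 s else l 1 (-s), ⟨hl.pos, ?_, ?_⟩, by simp [hl.zero]⟩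
  · intro s hs t ht
    have h01 : (0 : Fin 2) ≠ 1 := by decide
    by_cases h1 : 0 ≤ s <;> by_cases h2 : 0 ≤ t <;> simp only [h1, h2, if_true, if_false]
    · exact hl.dist_same 0 s ⟨h1, hs.2⟩ t ⟨h2, ht.2⟩
    · push Not at h2
      rw [hl.dist_ne 0 1 h01 s ⟨h1, hs.2⟩ (-t) ⟨by linarith, by linarith [ht.1]⟩,
        abs_of_nonneg (by linarith)]
      ring
    · push Not at h1
      rw [hl.dist_ne 1 0 h01.symm (-s) ⟨by linarith, by linarith [hs.1]⟩ t ⟨h2, ht.2⟩,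
        abs_of_nonpos (by linarith)]
      ring
    · push Not at h1 h2
      rw [hl.dist_same 1 (-s) ⟨by linarith, by linarith [hs.1]⟩ (-t)
        ⟨by linarith, by linarith [ht.1]⟩, ← abs_neg]
      congr 1; ring
  · simp only [le_refl, if_true, hl.zero]
    refine Filter.mem_of_superset (Metric.ball_mem_nhds p hl.pos) fun x hx => ?_
    rcases hl.ball x hx with rfl | ⟨k, s, hs, rfl⟩
    · exact ⟨0, ⟨by linarith [hl.pos], hl.pos⟩, by simp [hl.zero]⟩
    · rcases Fin.exists_fin_two.1 ⟨k, rfl⟩ with h0 | h1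
      · subst h0; exact ⟨s, ⟨by linarith [hs.1, hl.pos], hs.2⟩, by simp [hs.1.le]⟩
      · subst h1
        refine ⟨-s, ⟨by linarith [hs.2], by linarith [hs.1, hl.pos]⟩, ?_⟩
        have : ¬ (0 ≤ -s) := by linarith [hs.1]
        simp [hs.1]

/-- A curve that is a local isometry on the interval `(a, b)`. -/
def IsLocalGeodesic (γ : ℝ → G) (a b : ℝ) : Prop :=
  ∀ t ∈ Ioo a b, ∃ δ > 0, ∀ s ∈ Ioo (t - δ) (t + δ), ∀ s' ∈ Ioo (t - δ) (t + δ),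
    dist (γ s) (γ s') = |s - s'|

namespace IsLocalGeodesic

variable {γ γ' : ℝ → G} {a b a' b' : ℝ}

theorem mono (h : IsLocalGeodesic γ a b) (ha : a ≤ a') (hb : b' ≤ b) : IsLocalGeodesic γ a' b' :=
  fun t ht => h t ⟨ha.trans_lt ht.1, ht.2.trans_le hb⟩

theorem continuousAt (h : IsLocalGeodesic γ a b) {t : ℝ} (ht : t ∈ Ioo a b) :
    ContinuousAt γ t := by
  obtain ⟨δ, hδ, hd⟩ := h t ht
  have : ContinuousOn γ (Ioo (t - δ) (t + δ)) := by
    refine (LipschitzOnWith.of_dist_le_mul (K := 1) fun s hs t ht => ?_).continuousOn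
    rw [hd s hs t ht, Real.dist_eq]; simp
  exact this.continuousAt (Ioo_mem_nhds (by linarith) (by linarith))

theorem continuousOn (h : IsLocalGeodesic γ a b) : ContinuousOn γ (Ioo a b) :=
  fun _ ht => (h.continuousAt ht).continuousWithinAt

theorem of_isometric (hd : ∀ s ∈ Ioo a b, ∀ t ∈ Ioo a b, dist (γ s) (γ t) = |s - t|) :
    IsLocalGeodesic γ a b := by
  intro t ht
  refine ⟨min (t - a) (b - t), lt_min (by linarith [ht.1]) (by linarith [ht.2]), ?_⟩
  have hsub : ∀ s ∈ Ioo (t - min (t - a) (b - t)) (t + min (t - a) (b - t)), s ∈ Ioo a b :=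
    fun s hs => ⟨by linarith [hs.1, min_le_left (t - a) (b - t)],
      by linarith [hs.2, min_le_right (t - a) (b - t)]⟩
  exact fun s hs s' hs' => hd s (hsub s hs) s' (hsub s' hs')

theorem congr (h : IsLocalGeodesic γ a b) (he : EqOn γ γ' (Ioo a b)) : IsLocalGeodesic γ' a b := by
  intro t ht
  obtain ⟨δ, hδ, hd⟩ := h t ht
  have hm : 0 < min δ (min (t - a) (b - t)) :=
    lt_min hδ (lt_min (by linarith [ht.1]) (by linarith [ht.2]))
  refine ⟨_, hm, ?_⟩
  have h1 := min_le_left δ (min (t - a) (b - t))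
  have h2 := (min_le_right δ (min (t - a) (b - t))).trans (min_le_left _ _)
  have h3 := (min_le_right δ (min (t - a) (b - t))).trans (min_le_right _ _)
  intro s hs s' hs'
  rw [← he ⟨by linarith [hs.1], by linarith [hs.2]⟩, ← he ⟨by linarith [hs'.1], by linarith [hs'.2]⟩]
  exact hd s ⟨by linarith [hs.1], by linarith [hs.2]⟩ s' ⟨by linarith [hs'.1], by linarith [hs'.2]⟩

theorem comp_affine (h : IsLocalGeodesic γ a b) {ε c : ℝ} (hε : ε = 1 ∨ ε = -1)
    (hm : ∀ w ∈ Ioo a' b', c + ε * w ∈ Ioo a b) :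
    IsLocalGeodesic (fun w => γ (c + ε * w)) a' b' := by
  intro t ht
  obtain ⟨δ, hδ, hd⟩ := h _ (hm t ht)
  refine ⟨δ, hδ, fun s hs s' hs' => ?_⟩
  rcases hε with rfl | rfl
  · rw [hd _ ⟨by linarith [hs.1], by linarith [hs.2]⟩ _ ⟨by linarith [hs'.1], by linarith [hs'.2]⟩]
    congr 1; ring
  · rw [hd _ ⟨by linarith [hs.2], by linarith [hs.1]⟩ _ ⟨by linarith [hs'.2], by linarith [hs'.1]⟩,
      ← abs_neg]
    congr 1; ring

/-- Near a point of an isometric segment, a local isometry moves along the segment. -/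
theorem local_form {r : ℝ} {L : ℝ → G} (hL : LineAt r L) (h : IsLocalGeodesic γ a b) {t : ℝ}
    (ht : t ∈ Ioo a b) (he : γ t = L 0) :
    ∃ ε, (ε = 1 ∨ ε = -1) ∧ ∃ δ > 0, ∀ w, |w| < δ → γ (t + w) = L (ε * w) := by
  obtain ⟨δ, hδ, hd⟩ := h t ht
  have h1 := (h.continuousAt ht)
  rw [ContinuousAt, he] at h1
  obtain ⟨δ', hδ', hball⟩ := Metric.mem_nhds_iff.1 (h1 hL.nhds)
  have hpos : 0 < min δ δ' := lt_min hδ hδ'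
  -- Comparing distances to `L 0` determines the parameter up to sign.
  have hu : ∀ w, |w| < min δ δ' → ∃ u ∈ Ioo (-r) r, γ (t + w) = L u ∧ |u| = |w| := by
    intro w hw
    have hw' : t + w ∈ Metric.ball t δ' := by
      rw [Metric.mem_ball, Real.dist_eq, add_sub_cancel_left]
      exact hw.trans_le (min_le_right _ _)
    obtain ⟨u, hu, hu'⟩ := hball hw'
    refine ⟨u, hu, hu'.symm, ?_⟩
    have h2 := hL.dist u hu 0 ⟨by linarith [hL.pos], hL.pos⟩
    have h3 := abs_lt.1 (hw.trans_le (min_le_left _ _))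
    rw [hu', ← he, hd (t + w) ⟨by linarith, by linarith⟩ t ⟨by linarith, by linarith⟩] at h2
    simp only [add_sub_cancel_left, sub_zero] at h2
    exact h2.symm
  set d := min δ δ' with hd_def
  -- The sign at the test point `d / 2` defines the direction; comparing distances to this point
  -- forces the same direction at every other `w`.
  obtain ⟨u0, hu0, he0, ha0⟩ := hu (d / 2) (by rw [abs_of_pos (by linarith)]; linarith)
  rw [abs_of_pos (show (0 : ℝ) < d / 2 by linarith)] at ha0
  obtain ⟨ε, hε, hue⟩ : ∃ ε : ℝ, (ε = 1 ∨ ε = -1) ∧ u0 = ε * (d / 2) := by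
    rcases abs_eq (show (0 : ℝ) ≤ d / 2 by linarith) |>.1 ha0 with h | h
    · exact ⟨1, Or.inl rfl, by linarith⟩
    · exact ⟨-1, Or.inr rfl, by linarith⟩
  refine ⟨ε, hε, d, hpos, fun w hw => ?_⟩
  obtain ⟨u, hu1, heu, hau⟩ := hu w hw
  rw [heu]
  congr 1
  have h3 := abs_lt.1 (hw.trans_le (min_le_left _ _))
  have hdle : d ≤ δ := min_le_left _ _
  have h4 := hL.dist u hu1 u0 hu0
  rw [← heu, ← he0, hd (t + w) ⟨by linarith, by linarith⟩ (t + d / 2)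
    ⟨by linarith, by linarith⟩] at h4
  rcases abs_choice u with hc | hc <;> rcases abs_choice w with hc' | hc' <;>
    rw [hc, hc'] at hau <;> rcases hε with rfl | rfl <;> subst hue
  all_goals first
    | linarith
    | (have hu' : u = w := by linarith
       have hu'' : u = -w ∨ w = 0 := by
        subst hu'
        right
        have := sq_abs (t + u - (t + d / 2))
        rw [h4, sq_abs] at this
        nlinarith
       rcases hu'' with h | h <;> linarith)
    | (have hu' : u = -w := by linarith
       have hu'' : w = 0 := by
        subst hu'
        have := sq_abs (t + w - (t + d / 2))
        rw [h4, sq_abs] at this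
        nlinarith
       linarith)

variable (hG : ∀ p : G, ∃ m, 2 ≤ m ∧ HasValence p m)
include hG

/-- The parameters near which the two curves agree form an open set. At a limit of such parameters
both curves move along one and the same line, and their directions agree because they coincide at
some nearby parameter other than the limit. -/
theorem eqOn_of_eventuallyEq (h : IsLocalGeodesic γ a b) (h' : IsLocalGeodesic γ' a b)
    (hn : ∀ t ∈ Ioo a b, ¬ IsNatural (γ t)) {t₀ : ℝ} (ht₀ : t₀ ∈ Ioo a b)
    (he : ∀ᶠ s in 𝓝 t₀, γ s = γ' s) : EqOn γ γ' (Ioo a b) := by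
  have hopen : IsOpen {t | ∀ᶠ s in 𝓝 t, γ s = γ' s} := isOpen_setOfPred_eventually_nhds
  have hsub : Ioo a b ⊆ {t | ∀ᶠ s in 𝓝 t, γ s = γ' s} := by
    refine isPreconnected_Ioo.subset_of_closure_inter_subset hopen ⟨t₀, ht₀, he⟩ ?_
    rintro t ⟨htc, ht⟩
    have hfreq : ∃ᶠ s in 𝓝 t, ∀ᶠ s' in 𝓝 s, γ s' = γ' s' := mem_closure_iff_frequently.1 htc
    have heq : γ t = γ' t := by
      have h1 : Filter.Tendsto (fun s => dist (γ s) (γ' s)) (𝓝 t) (𝓝 (dist (γ t) (γ' t))) :=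
        (h.continuousAt ht).tendsto.dist (h'.continuousAt ht).tendsto
      by_contra hne
      have hpos : 0 < dist (γ t) (γ' t) := dist_pos.2 hne
      obtain ⟨s, hs1, hs2⟩ := (hfreq.and_eventually (h1.eventually (lt_mem_nhds hpos))).exists
      rw [hs1.self_of_nhds, dist_self] at hs2
      exact lt_irrefl _ hs2
    obtain ⟨r, L, hL, hL0⟩ := exists_line hG (hn t ht)
    obtain ⟨ε, hε, δ, hδ, hw⟩ := h.local_form hL ht hL0.symm
    obtain ⟨ε', hε', δ', hδ', hw'⟩ := h'.local_form hL ht (heq.symm.trans hL0.symm)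
    have hmin : 0 < min r (min δ δ') := lt_min hL.pos (lt_min hδ hδ')
    have h1 := min_le_left r (min δ δ')
    have h2 := (min_le_right r (min δ δ')).trans (min_le_left _ _)
    have h3 := (min_le_right r (min δ δ')).trans (min_le_right _ _)
    have hεε : ε = ε' := by
      obtain ⟨s, hs1, hs2⟩ := (hfreq.and_eventually (Metric.ball_mem_nhds t hmin)).exists
      obtain ⟨δ'', hδ'', hs1'⟩ := Metric.eventually_nhds_iff.1 hs1
      -- A coincidence at `t` itself does not detect the direction, so if `s = t` it is replaced by
      -- a nearby larger parameter.
      obtain ⟨s', hs', hst, hsball⟩ : ∃ s', γ s' = γ' s' ∧ s' ≠ t ∧ dist s' t < min r (min δ δ') := by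
        by_cases hst : s = t
        · subst hst
          have hm2 : 0 < min δ'' (min r (min δ δ')) := lt_min hδ'' hmin
          have hd : dist (s + min δ'' (min r (min δ δ')) / 2) s =
              min δ'' (min r (min δ δ')) / 2 := by
            rw [Real.dist_eq, add_sub_cancel_left, abs_of_pos (by linarith)]
          refine ⟨s + min δ'' (min r (min δ δ')) / 2, hs1' ?_, by intro h0; linarith, ?_⟩
          · rw [hd]; linarith [min_le_left δ'' (min r (min δ δ'))]
          · rw [hd]; linarith [min_le_right δ'' (min r (min δ δ'))]
        · exact ⟨s, hs1.self_of_nhds, hst, hs2⟩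
      rw [Real.dist_eq] at hsball
      have e1 := hw (s' - t) (by linarith)
      have e2 := hw' (s' - t) (by linarith)
      rw [add_sub_cancel] at e1 e2
      rw [hs', e2] at e1
      have hb := abs_lt.1 hsball
      have := hL.dist (ε' * (s' - t)) ?_ (ε * (s' - t)) ?_
      · rw [e1, dist_self, ← sub_mul, abs_mul, eq_comm, mul_eq_zero, abs_eq_zero, abs_eq_zero] at this
        rcases this with h | h
        · linarith
        · exact absurd (by linarith) hst
      · rcases hε' with rfl | rfl <;> constructor <;> linarith
      · rcases hε with rfl | rfl <;> constructor <;> linarith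
    subst hεε
    show ∀ᶠ s in 𝓝 t, γ s = γ' s
    filter_upwards [Metric.ball_mem_nhds t hmin] with s hs
    rw [Metric.mem_ball, Real.dist_eq] at hs
    have e1 := hw (s - t) (by linarith)
    have e2 := hw' (s - t) (by linarith)
    rw [add_sub_cancel] at e1 e2
    rw [e1, e2]
  exact fun t ht => (hsub ht).self_of_nhds

/-- Two local isometries through the same point of valence two agree, up to direction. -/
theorem meet (h : IsLocalGeodesic γ a b) (h' : IsLocalGeodesic γ' a' b')
    (hn : ∀ t ∈ Ioo a b, ¬ IsNatural (γ t)) {t t' : ℝ} (ht : t ∈ Ioo a b) (ht' : t' ∈ Ioo a' b')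
    (he : γ t = γ' t') :
    ∃ ε : ℝ, (ε = 1 ∨ ε = -1) ∧ ∀ w, t + w ∈ Ioo a b → t' + ε * w ∈ Ioo a' b' →
      γ (t + w) = γ' (t' + ε * w) := by
  obtain ⟨r, L, hL, hL0⟩ := exists_line hG (hn t ht)
  obtain ⟨ε, hε, δ, hδ, hw⟩ := h.local_form hL ht hL0.symm
  obtain ⟨ε', hε', δ', hδ', hw'⟩ := h'.local_form hL ht' (he.symm.trans hL0.symm)
  have hee : ε * ε' = 1 ∨ ε * ε' = -1 := by
    rcases hε with rfl | rfl <;> rcases hε' with rfl | rfl <;> simp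
  have hev : ∀ᶠ w in 𝓝 (0 : ℝ), γ (t + 1 * w) = γ' (t' + ε * ε' * w) := by
    have hm : 0 < min δ δ' := lt_min hδ hδ'
    filter_upwards [Metric.ball_mem_nhds (0 : ℝ) hm] with w hwb
    rw [Metric.mem_ball, Real.dist_eq, sub_zero] at hwb
    have e1 := hw w (hwb.trans_le (min_le_left _ _))
    have e2 := hw' (ε * ε' * w) (by
      rw [abs_mul]
      rcases hee with h | h <;> rw [h] <;> simpa using hwb.trans_le (min_le_right _ _))
    rw [one_mul, e1, e2]
    congr 1
    rcases hε' with rfl | rfl <;> ring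
  refine ⟨ε * ε', hee, fun w hw1 hw2 => ?_⟩
  -- The parameters for which both curves are defined form an interval containing `0` and `w`, so
  -- unique continuation from `0` reaches `w`.
  have hI : ∃ α β, 0 ∈ Ioo α β ∧ w ∈ Ioo α β ∧ ∀ v ∈ Ioo α β,
      t + 1 * v ∈ Ioo a b ∧ t' + ε * ε' * v ∈ Ioo a' b' := by
    rcases hee with h | h <;> rw [h] at hw2 ⊢
    · refine ⟨max (a - t) (a' - t'), min (b - t) (b' - t'), ?_, ?_, fun v hv => ?_⟩
      · exact ⟨max_lt (by linarith [ht.1]) (by linarith [ht'.1]),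
          lt_min (by linarith [ht.2]) (by linarith [ht'.2])⟩
      · exact ⟨max_lt (by linarith [hw1.1]) (by linarith [hw2.1]),
          lt_min (by linarith [hw1.2]) (by linarith [hw2.2])⟩
      · have h1 := max_lt_iff.1 hv.1
        have h2 := lt_min_iff.1 hv.2
        exact ⟨⟨by linarith, by linarith⟩, ⟨by linarith, by linarith⟩⟩
    · refine ⟨max (a - t) (t' - b'), min (b - t) (t' - a'), ?_, ?_, fun v hv => ?_⟩
      · exact ⟨max_lt (by linarith [ht.1]) (by linarith [ht'.2]),
          lt_min (by linarith [ht.2]) (by linarith [ht'.1])⟩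
      · exact ⟨max_lt (by linarith [hw1.1]) (by linarith [hw2.2]),
          lt_min (by linarith [hw1.2]) (by linarith [hw2.1])⟩
      · have h1 := max_lt_iff.1 hv.1
        have h2 := lt_min_iff.1 hv.2
        exact ⟨⟨by linarith, by linarith⟩, ⟨by linarith, by linarith⟩⟩
  obtain ⟨α, β, h0, hwI, hv⟩ := hI
  have := (h.comp_affine (Or.inl rfl) fun v hv' => (hv v hv').1).eqOn_of_eventuallyEq hG
    (h'.comp_affine hee fun v hv' => (hv v hv').2)
    (fun v hv' => hn _ (hv v hv').1) h0 hev hwI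
  simpa using this

end IsLocalGeodesic
end LocalGraph

/-! ### Edges of a subdivision with finite vertex set `F`. -/

section Edges

variable {G : Type*} [MetricSpace G]

theorem LineAt.shrink {r : ℝ} {L : ℝ → G} (h : LineAt r L) {r' : ℝ} (h0 : 0 < r') (h1 : r' ≤ r) :
    LineAt r' L where
  pos := h0
  dist s hs t ht := h.dist s ⟨by linarith [hs.1], by linarith [hs.2]⟩ t
    ⟨by linarith [ht.1], by linarith [ht.2]⟩
  nhds := by
    filter_upwards [h.nhds, Metric.ball_mem_nhds (L 0) h0]
    rintro _ ⟨s, hs, rfl⟩ hs'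
    rw [Metric.mem_ball, h.dist s hs 0 ⟨by linarith, by linarith⟩, sub_zero] at hs'
    exact ⟨s, abs_lt.1 hs', rfl⟩

theorem LineAt.isLocalGeodesic {r : ℝ} {L : ℝ → G} (h : LineAt r L) :
    IsLocalGeodesic L (-r) r := IsLocalGeodesic.of_isometric h.dist

theorem ProngsAt.isLocalGeodesic {p : G} {m : ℕ} {r : ℝ} {l : Fin m → ℝ → G}
    (h : ProngsAt p m r l) (k : Fin m) : IsLocalGeodesic (l k) 0 r :=
  IsLocalGeodesic.of_isometric fun s hs t ht =>
    h.dist_same k s (Ioo_subset_Ico_self hs) t (Ioo_subset_Ico_self ht)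

variable (hG : ∀ p : G, ∃ m, 2 ≤ m ∧ HasValence p m)
include hG

/-- At a point of valence two the curve runs along a line that fills a neighborhood, so it is open
there. -/
theorem IsLocalGeodesic.image_mem_nhds {γ : ℝ → G} {a b : ℝ} (h : IsLocalGeodesic γ a b) {t : ℝ}
    (ht : t ∈ Ioo a b) (hn : ¬ IsNatural (γ t)) {U : Set ℝ} (hU : U ∈ 𝓝 t) :
    γ '' U ∈ 𝓝 (γ t) := by
  obtain ⟨r, L, hL, hL0⟩ := exists_line hG hn
  obtain ⟨ε, hε, δ, hδ, hw⟩ := h.local_form hL ht hL0.symm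
  obtain ⟨δ', hδ', hball⟩ := Metric.mem_nhds_iff.1 hU
  have hm : 0 < min r (min δ δ') := lt_min hL.pos (lt_min hδ hδ')
  have h3 := (min_le_right r (min δ δ')).trans (min_le_left _ _)
  have h4 := (min_le_right r (min δ δ')).trans (min_le_right _ _)
  have h2 := (hL.shrink hm (min_le_left _ _)).nhds
  rw [← hL0]
  refine Filter.mem_of_superset h2 ?_
  rintro _ ⟨u, hu, rfl⟩
  have hu' : |ε * u| < min r (min δ δ') := by
    rw [abs_lt]
    rcases hε with rfl | rfl <;> constructor <;> linarith [hu.1, hu.2]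
  refine ⟨t + ε * u, hball ?_, ?_⟩
  · rw [Metric.mem_ball, Real.dist_eq, add_sub_cancel_left]
    exact hu'.trans_le h4
  · rw [hw _ (hu'.trans_le h3)]
    congr 1
    rcases hε with rfl | rfl <;> ring

/-- A local isometry entering a star ball moves along a prong, and reaches the center. -/
theorem ProngsAt.reach {q : G} {m : ℕ} {r : ℝ} {l : Fin m → ℝ → G} (hl : ProngsAt q m r l)
    {γ : ℝ → G} {a b : ℝ} (h : IsLocalGeodesic γ a b) (hn : ∀ t ∈ Ioo a b, ¬ IsNatural (γ t))
    {t u : ℝ} {k : Fin m} (ht : t ∈ Ioo a b) (hu : u ∈ Ioo 0 r) (he : γ t = l k u) :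
    ∃ ε : ℝ, (ε = 1 ∨ ε = -1) ∧ (∀ w, t + w ∈ Ioo a b → u + ε * w ∈ Ioo 0 r →
      γ (t + w) = l k (u + ε * w)) ∧ (t - ε * u ∈ Ioo a b → γ (t - ε * u) = q) := by
  obtain ⟨ε, hε, hw⟩ := h.meet hG (hl.isLocalGeodesic k) hn ht hu he
  refine ⟨ε, hε, hw, fun hI => ?_⟩
  -- The distance to `q` as `c` increases to `u` is evaluated twice: by continuity of `γ`, and as `u
  -- - c` along the prong.
  have h1 : Filter.Tendsto (fun c : ℝ => dist (γ (t - ε * c)) q) (𝓝[<] u)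
      (𝓝 (dist (γ (t - ε * u)) q)) := by
    have : ContinuousAt (fun c : ℝ => γ (t - ε * c)) u :=
      ContinuousAt.comp (g := γ) (h.continuousAt hI) (by fun_prop)
    exact (this.tendsto.mono_left nhdsWithin_le_nhds).dist tendsto_const_nhds
  have h2 : Filter.Tendsto (fun c : ℝ => dist (γ (t - ε * c)) q) (𝓝[<] u) (𝓝 0) := by
    have h3 : Filter.Tendsto (fun c : ℝ => u - c) (𝓝[<] u) (𝓝 0) := by
      have : Continuous fun c : ℝ => u - c := by fun_prop
      exact (this.tendsto' u 0 (by simp)).mono_left nhdsWithin_le_nhds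
    refine h3.congr' ?_
    filter_upwards [Ioo_mem_nhdsLT hu.1] with c hc
    have hee : ε * (-ε * c) = - c := by rcases hε with rfl | rfl <;> ring
    have hc' : u - c ∈ Ioo 0 r := ⟨by linarith [hc.2], by linarith [hc.1, hu.2]⟩
    have := hw (-ε * c) ?_ (by rw [hee]; simpa [sub_eq_add_neg] using hc')
    · rw [hee] at this
      rw [show t - ε * c = t + -ε * c by ring, this, ← sub_eq_add_neg,
        hl.dist_center k ⟨hc'.1.le, hc'.2⟩]
    · rcases hε with rfl | rfl
      · constructor <;> linarith [hI.1, ht.2, hc.1, hc.2]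
      · constructor <;> linarith [hI.2, ht.1, hc.1, hc.2]
  exact dist_eq_zero.1 (tendsto_nhds_unique h1 h2)

/-- A local isometry accumulating at `q` initially runs along a prong of `q`. -/
theorem ProngsAt.exists_initial {q : G} {m : ℕ} {r : ℝ} {l : Fin m → ℝ → G}
    (hl : ProngsAt q m r l) {γ : ℝ → G} {T : ℝ} (hT : 0 < T) (h : IsLocalGeodesic γ 0 T)
    (hn : ∀ t ∈ Ioo 0 T, ¬ IsNatural (γ t)) (hq : ∀ t ∈ Ioo 0 T, γ t ≠ q)
    (hc : MapClusterPt q (𝓝[>] (0 : ℝ)) γ) :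
    ∃ k, ∃ δ > 0, δ ≤ T ∧ δ ≤ r ∧ ∀ s ∈ Ioo 0 δ, γ s = l k s := by
  have hr := hl.pos
  have hfreq : ∀ d > 0, ∃ᶠ t in 𝓝[>] (0 : ℝ), dist (γ t) q < d := fun d hd =>
    hc.frequently (Metric.ball_mem_nhds q hd)
  -- With both the time `t` and the distance `u` below `r / 4`, the prong formula stays in range on
  -- the part of `(0, t)` where it is needed.
  have hm : 0 < min T (r / 4) := lt_min hT (by linarith)
  obtain ⟨t, htd, ht⟩ := ((hfreq (r / 4) (by linarith)).and_eventually (Ioo_mem_nhdsGT hm)).exists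
  have htT : t ∈ Ioo 0 T := ⟨ht.1, ht.2.trans_le (min_le_left _ _)⟩
  have htr : t < r / 4 := ht.2.trans_le (min_le_right _ _)
  rcases hl.ball (γ t) (by linarith) with h0 | ⟨k, u, hu, he⟩
  · exact absurd h0 (hq t htT)
  have hur : u < r / 4 := by
    rw [he, hl.dist_center k ⟨hu.1.le, hu.2⟩] at htd; exact htd
  obtain ⟨ε, hε, hw, hreach⟩ := hl.reach hG h hn htT hu he
  have hdist : ∀ s ∈ Ioo 0 t, u + ε * (s - t) ∈ Ioo 0 r → dist (γ s) q = u + ε * (s - t) := by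
    intro s hs hI
    have := hw (s - t) (by rw [add_sub_cancel]; exact ⟨hs.1, hs.2.trans htT.2⟩) hI
    rw [add_sub_cancel] at this
    rw [this, hl.dist_center k ⟨hI.1.le, hI.2⟩]
  have hcontra : ∀ d > 0, ¬ ∀ s ∈ Ioo 0 t, d ≤ dist (γ s) q := by
    intro d hd hall
    obtain ⟨s, hs1, hs2⟩ := ((hfreq d hd).and_eventually (Ioo_mem_nhdsGT ht.1)).exists
    exact absurd (hall s hs2) (not_le.2 hs1)
  rcases hε with rfl | rfl
  -- Here the distance to `q` grows with time. If `u < t` the curve would have met `q`, and if `u >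
  -- t` it would stay at distance `u - t` from `q` on all of `(0, t)`; so `u = t`.
  · rcases lt_trichotomy u t with hut | hut | hut
    · have hI : t - 1 * u ∈ Ioo 0 T := ⟨by linarith, by linarith [htT.2, hu.1]⟩
      exact absurd (hreach hI) (hq _ hI)
    · refine ⟨k, t, ht.1, htT.2.le, by linarith, fun s hs => ?_⟩
      have := hw (s - t) (by rw [add_sub_cancel]; exact ⟨hs.1, hs.2.trans htT.2⟩)
        (by rw [hut]; constructor <;> linarith [hs.1, hs.2])
      rw [add_sub_cancel] at this
      rw [this, hut]
      congr 1; ring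
    · exfalso
      refine hcontra (u - t) (by linarith) fun s hs => ?_
      rw [hdist s hs ⟨by linarith [hs.1], by linarith [hs.2, hu.2]⟩]
      linarith [hs.1]
  -- Here the curve approaches `q`, so at all earlier times it was at distance at least `u`, against
  -- clustering.
  · exfalso
    refine hcontra u hu.1 fun s hs => ?_
    rw [hdist s hs ⟨by linarith [hs.2, hu.1], by linarith [hs.1]⟩]
    linarith [hs.2]

/-- A local isometry parametrized by `[0, ℓ]`, with endpoints in `F`, that is injective and
avoids `F` in the interior. -/
structure IsEdgeArc (F : Set G) (e : ℝ → G) (ℓ : ℝ) : Prop where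
  pos : 0 < ℓ
  continuousOn : ContinuousOn e (Icc 0 ℓ)
  geodesic : IsLocalGeodesic e 0 ℓ
  initial : e 0 ∈ F
  terminal : e ℓ ∈ F
  avoid : ∀ t ∈ Ioo 0 ℓ, e t ∉ F
  injOn : InjOn e (Ioo 0 ℓ)

omit hG in
theorem IsNaturalEdge.isEdgeArc {e : ℝ → G} {ℓ : ℝ} (h : IsNaturalEdge e ℓ) :
    IsEdgeArc {p | IsNatural p} e ℓ where
  pos := h.pos
  continuousOn := h.continuousOn
  geodesic := h.unitSpeed
  initial := h.initial
  terminal := h.terminal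
  avoid := h.interior
  injOn := h.injOn

namespace IsEdgeArc

variable {F : Set G} (hF : ∀ p : G, IsNatural p → p ∈ F) {e e' : ℝ → G} {ℓ ℓ' : ℝ}

omit hG in
theorem reverse (h : IsEdgeArc F e ℓ) : IsEdgeArc F (fun s => e (ℓ - s)) ℓ where
  pos := h.pos
  continuousOn := h.continuousOn.comp (by fun_prop) fun s hs =>
    ⟨by linarith [hs.2], by linarith [hs.1]⟩
  geodesic := by
    have := h.geodesic.comp_affine (a' := 0) (b' := ℓ) (ε := -1) (c := ℓ) (Or.inr rfl)
      fun w hw => ⟨by linarith [hw.2], by linarith [hw.1]⟩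
    simpa [sub_eq_add_neg] using this
  initial := by simpa using h.terminal
  terminal := by simpa using h.initial
  avoid t ht := h.avoid _ ⟨by linarith [ht.2], by linarith [ht.1]⟩
  injOn s hs t ht hst := by
    have := h.injOn (x₁ := ℓ - s) ⟨by linarith [hs.2], by linarith [hs.1]⟩
      (x₂ := ℓ - t) ⟨by linarith [ht.2], by linarith [ht.1]⟩ hst
    linarith

omit hG in
theorem tendsto_initial (h : IsEdgeArc F e ℓ) : Filter.Tendsto e (𝓝[>] 0) (𝓝 (e 0)) := by
  have h1 := h.continuousOn 0 ⟨le_rfl, h.pos.le⟩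
  have h2 : Filter.Tendsto e (𝓝[Ioo 0 ℓ] 0) (𝓝 (e 0)) :=
    h1.mono_left (nhdsWithin_mono _ Ioo_subset_Icc_self)
  rwa [nhdsWithin_Ioo_eq_nhdsGT h.pos] at h2

include hF

theorem exists_initial (h : IsEdgeArc F e ℓ) {m : ℕ} {r : ℝ} {l : Fin m → ℝ → G}
    (hl : ProngsAt (e 0) m r l) : ∃ k, ∃ δ > 0, δ ≤ ℓ ∧ δ ≤ r ∧ ∀ s ∈ Ioo 0 δ, e s = l k s :=
  hl.exists_initial hG h.pos h.geodesic (fun t ht hn => h.avoid t ht (hF _ hn))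
    (fun t ht he => h.avoid t ht (he ▸ h.initial)) h.tendsto_initial.mapClusterPt

/-- Continuation makes the arcs agree on the shorter interval. The shorter arc ends in `F`, which
the longer one avoids in its interior, so the lengths are equal. -/
theorem unique (h : IsEdgeArc F e ℓ) (h' : IsEdgeArc F e' ℓ') {δ : ℝ} (hδ : 0 < δ)
    (he : EqOn e e' (Ioo 0 δ)) : ℓ = ℓ' ∧ EqOn e e' (Icc 0 ℓ) := by
  have key : ∀ {e e' : ℝ → G} {ℓ ℓ' : ℝ}, IsEdgeArc F e ℓ → IsEdgeArc F e' ℓ' →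
      EqOn e e' (Ioo 0 δ) → ℓ ≤ ℓ' → ℓ = ℓ' ∧ EqOn e e' (Icc 0 ℓ) := by
    intro e e' ℓ ℓ' h h' he hle
    have h1 : EqOn e e' (Ioo 0 ℓ) := by
      have hm : 0 < min δ ℓ := lt_min hδ h.pos
      refine h.geodesic.eqOn_of_eventuallyEq hG (h'.geodesic.mono le_rfl hle)
        (fun t ht hn => h.avoid t ht (hF _ hn)) (t₀ := min δ ℓ / 2)
        ⟨by linarith, by linarith [min_le_right δ ℓ]⟩ ?_
      filter_upwards [Ioo_mem_nhds (show 0 < min δ ℓ / 2 by linarith)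
        (show min δ ℓ / 2 < δ by linarith [min_le_left δ ℓ])] with s hs using he hs
    have h2 : EqOn e e' (Icc 0 ℓ) := by
      have hcl : closure (Ioo 0 ℓ) = Icc 0 ℓ := closure_Ioo h.pos.ne
      have := h1.of_subset_closure h.continuousOn
        (h'.continuousOn.mono (Icc_subset_Icc le_rfl hle)) Ioo_subset_Icc_self hcl.ge
      exact this
    refine ⟨?_, h2⟩
    by_contra hne
    refine h'.avoid ℓ ⟨h.pos, lt_of_le_of_ne hle hne⟩ ?_
    rw [← h2 ⟨h.pos.le, le_rfl⟩]
    exact h.terminal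
  rcases le_total ℓ ℓ' with hle | hle
  · exact key h h' he hle
  · obtain ⟨h1, h2⟩ := key h' h he.symm hle
    exact ⟨h1.symm, h1 ▸ h2.symm⟩

/-- If `s < s'`, moving both arcs back until `e` reaches its start shows that `e 0`, a point of `F`,
is the interior point `e' (s' - s)`. -/
theorem same_direction (h : IsEdgeArc F e ℓ) (h' : IsEdgeArc F e' ℓ') {s s' : ℝ}
    (hs : s ∈ Ioo 0 ℓ) (hs' : s' ∈ Ioo 0 ℓ')
    (hw : ∀ w, s + w ∈ Ioo 0 ℓ → s' + w ∈ Ioo 0 ℓ' → e (s + w) = e' (s' + w)) :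
    s = s' ∧ ℓ = ℓ' ∧ EqOn e e' (Icc 0 ℓ) := by
  have key : ∀ {e e' : ℝ → G} {ℓ ℓ' s s' : ℝ}, IsEdgeArc F e ℓ → IsEdgeArc F e' ℓ' →
      s ∈ Ioo 0 ℓ → s' ∈ Ioo 0 ℓ' →
      (∀ w, s + w ∈ Ioo 0 ℓ → s' + w ∈ Ioo 0 ℓ' → e (s + w) = e' (s' + w)) → ¬ s < s' := by
    intro e e' ℓ ℓ' s s' h h' hs hs' hw hlt
    have h1 : Filter.Tendsto (fun c : ℝ => e' (s' - s + c)) (𝓝[>] 0) (𝓝 (e' (s' - s))) := by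
      have hI : s' - s ∈ Ioo 0 ℓ' := ⟨by linarith, by linarith [hs.1, hs'.2]⟩
      have : ContinuousAt (fun c : ℝ => e' (s' - s + c)) 0 := by
        refine ContinuousAt.comp (g := e') ?_ (by fun_prop)
        simpa using h'.geodesic.continuousAt hI
      have := this.tendsto.mono_left (nhdsWithin_le_nhds (s := Ioi 0))
      simpa using this
    have h2 : Filter.Tendsto e (𝓝[>] 0) (𝓝 (e' (s' - s))) := by
      refine h1.congr' ?_
      filter_upwards [Ioo_mem_nhdsGT hs.1] with c hc
      have := hw (c - s) ⟨by linarith [hc.1], by linarith [hc.2, hs.2]⟩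
        ⟨by linarith [hc.1], by linarith [hc.2, hs'.2]⟩
      rw [add_sub_cancel] at this
      rw [this]; congr 1; ring
    have := tendsto_nhds_unique h2 h.tendsto_initial
    exact h'.avoid (s' - s) ⟨by linarith, by linarith [hs.1, hs'.2]⟩ (this ▸ h.initial)
  have hss : s = s' := by
    rcases lt_trichotomy s s' with h1 | h1 | h1
    · exact absurd h1 (key h h' hs hs' hw)
    · exact h1
    · exact absurd h1 (key h' h hs' hs fun w h1 h2 => (hw w h2 h1).symm)
  subst hss
  refine ⟨rfl, h.unique hG hF h' hs.1 fun t ht => ?_⟩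
  have := hw (t - s) (by rw [add_sub_cancel]; exact ⟨ht.1, ht.2.trans hs.2⟩)
    (by rw [add_sub_cancel]; exact ⟨ht.1, ht.2.trans hs'.2⟩)
  rwa [add_sub_cancel] at this

/-- Two edge arcs that meet in their interiors agree up to direction. -/
theorem meet (h : IsEdgeArc F e ℓ) (h' : IsEdgeArc F e' ℓ') {s s' : ℝ}
    (hs : s ∈ Ioo 0 ℓ) (hs' : s' ∈ Ioo 0 ℓ') (he : e s = e' s') :
    ℓ = ℓ' ∧ ((s = s' ∧ EqOn e e' (Icc 0 ℓ)) ∨ EqOn e (fun x => e' (ℓ' - x)) (Icc 0 ℓ)) := by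
  obtain ⟨ε, hε, hw⟩ := h.geodesic.meet hG h'.geodesic (fun t ht hn => h.avoid t ht (hF _ hn))
    hs hs' he
  rcases hε with rfl | rfl
  · obtain ⟨h1, h2, h3⟩ := h.same_direction hG hF h' hs hs' fun w h1 h2 => by
      simpa using hw w h1 (by simpa using h2)
    exact ⟨h2, Or.inl ⟨h1, h3⟩⟩
  · obtain ⟨h1, h2, h3⟩ := h.same_direction hG hF h'.reverse hs (s' := ℓ' - s')
      ⟨by linarith [hs'.2], by linarith [hs'.1]⟩ fun w h1 h2 => by
        rw [hw w h1 ⟨by linarith [h2.2], by linarith [h2.1]⟩]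
        congr 1; ring
    exact ⟨h2, Or.inr h3⟩

end IsEdgeArc

/-! ### Extending a prong at a vertex to a whole edge. -/

section Rays

variable {F : Set G} (hF : ∀ p : G, IsNatural p → p ∈ F)

/-- A local isometry on `(0, T)` that avoids `F` and starts along the prong `l`. -/
structure IsRay (F : Set G) (l : ℝ → G) (r : ℝ) (γ : ℝ → G) (T : ℝ) : Prop where
  le : r ≤ T
  geodesic : IsLocalGeodesic γ 0 T
  avoid : ∀ t ∈ Ioo 0 T, γ t ∉ F
  initial : EqOn γ l (Ioo 0 r)

include hF

theorem IsRay.eqOn {l : ℝ → G} {r : ℝ} (hr : 0 < r) {γ γ' : ℝ → G} {T T' : ℝ}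
    (h : IsRay F l r γ T) (h' : IsRay F l r γ' T') (hT : T ≤ T') : EqOn γ γ' (Ioo 0 T) := by
  refine h.geodesic.eqOn_of_eventuallyEq hG (h'.geodesic.mono le_rfl hT)
    (fun t ht hn => h.avoid t ht (hF _ hn)) (t₀ := r / 2)
    ⟨by linarith, by linarith [h.le]⟩ ?_
  filter_upwards [Ioo_mem_nhds (show 0 < r / 2 by linarith) (show r / 2 < r by linarith)] with s hs
  rw [h.initial hs, h'.initial hs]

/-- Two passages through one point agree up to direction. In equal directions, moving both back to
the start makes the ray meet `p`, a point of `F`, at the interior parameter `t - s`. In opposite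
directions the ray would turn back at `(s + t) / 2`, where it is isometric. -/
theorem IsRay.injOn {p : G} {m : ℕ} {r : ℝ} {l : Fin m → ℝ → G} (hl : ProngsAt p m r l)
    (hp : p ∈ F) {k : Fin m} {γ : ℝ → G} {T : ℝ} (h : IsRay F (l k) r γ T) :
    InjOn γ (Ioo 0 T) := by
  have key : ∀ s ∈ Ioo 0 T, ∀ t ∈ Ioo 0 T, s < t → γ s ≠ γ t := by
    intro s hs t ht hst he
    obtain ⟨ε, hε, hw⟩ := h.geodesic.meet hG h.geodesic
      (fun t ht hn => h.avoid t ht (hF _ hn)) hs ht he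
    rcases hε with rfl | rfl
    · have hI : t - s ∈ Ioo 0 T := ⟨by linarith, by linarith [hs.1, ht.2]⟩
      have h1 : Filter.Tendsto (fun c : ℝ => dist (γ (t - s + c)) p) (𝓝[>] 0)
          (𝓝 (dist (γ (t - s)) p)) := by
        have : ContinuousAt (fun c : ℝ => γ (t - s + c)) 0 := by
          refine ContinuousAt.comp (g := γ) ?_ (by fun_prop)
          simpa using h.geodesic.continuousAt hI
        have := this.tendsto.mono_left (nhdsWithin_le_nhds (s := Ioi 0))
        simp only [add_zero] at this
        exact this.dist tendsto_const_nhds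
      have h2 : Filter.Tendsto (fun c : ℝ => dist (γ (t - s + c)) p) (𝓝[>] 0) (𝓝 0) := by
        have h0 : Filter.Tendsto (fun c : ℝ => c) (𝓝[>] 0) (𝓝 0) := nhdsWithin_le_nhds
        refine h0.congr' ?_
        filter_upwards [Ioo_mem_nhdsGT (lt_min hs.1 hl.pos)] with c hc
        have hcs := hc.2.trans_le (min_le_left _ _)
        have hcr := hc.2.trans_le (min_le_right _ _)
        have := hw (c - s) ⟨by linarith [hc.1], by linarith [hs.2]⟩
          ⟨by linarith [hc.1], by linarith [ht.2]⟩
        rw [add_sub_cancel, h.initial ⟨hc.1, hcr⟩] at this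
        rw [show t - s + c = t + 1 * (c - s) by ring, ← this, hl.dist_center k ⟨hc.1.le, hcr⟩]
      have := dist_eq_zero.1 (tendsto_nhds_unique h1 h2)
      exact h.avoid _ hI (this ▸ hp)
    · have hI : (s + t) / 2 ∈ Ioo 0 T := ⟨by linarith [hs.1, ht.1], by linarith [hs.2, ht.2]⟩
      obtain ⟨δ, hδ, hd⟩ := h.geodesic _ hI
      have hm : 0 < min δ ((t - s) / 2) := lt_min hδ (by linarith)
      have h1 := min_le_left δ ((t - s) / 2)
      have h2 := min_le_right δ ((t - s) / 2)
      have h3 := hw ((t - s) / 2 - min δ ((t - s) / 2) / 2)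
        ⟨by linarith [hs.1], by linarith [ht.2]⟩ ⟨by linarith [hs.1], by linarith [ht.2]⟩
      have h4 := hd (s + ((t - s) / 2 - min δ ((t - s) / 2) / 2)) ⟨by linarith, by linarith⟩
        (t + -1 * ((t - s) / 2 - min δ ((t - s) / 2) / 2)) ⟨by linarith, by linarith⟩
      rw [h3, dist_self, eq_comm, abs_eq_zero] at h4
      linarith
  intro s hs t ht he
  rcases lt_trichotomy s t with h1 | h1 | h1
  · exact absurd he (key s hs t ht h1)
  · exact h1
  · exact absurd he.symm (key t ht s hs h1)

variable [CompactSpace G]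

/-- An infinite ray clusters at some `q` by compactness. If `q` is natural, the ray runs along a
prong of `q` and meets `q`, a point of `F`. Otherwise every late visit near `q` follows the line
through `q` and meets `q` itself, so there are two such times, against injectivity. -/
theorem IsRay.not_infinite {p : G} {m : ℕ} {r : ℝ} {l : Fin m → ℝ → G} (hl : ProngsAt p m r l)
    (hp : p ∈ F) {k : Fin m} {γ : ℝ → G} (h : ∀ T ≥ r, IsRay F (l k) r γ T) : False := by
  have hinj : ∀ s t : ℝ, 0 < s → 0 < t → γ s = γ t → s = t := by
    intro s t hs ht he
    have hT : r ≤ max r (max s t + 1) := le_max_left _ _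
    have h2 : max s t + 1 ≤ max r (max s t + 1) := le_max_right _ _
    exact (h _ hT).injOn hG hF hl hp ⟨hs, by linarith [le_max_left s t]⟩
      ⟨ht, by linarith [le_max_right s t]⟩ he
  obtain ⟨q, hq⟩ := exists_clusterPt_of_compactSpace (Filter.map γ Filter.atTop)
  have hq : MapClusterPt q Filter.atTop γ := hq
  by_cases hqF : IsNatural q
  · obtain ⟨m', hm', hv⟩ := hG q
    obtain ⟨r', l', hl'⟩ := hv.exists_prongs
    obtain ⟨t, ht1, ht2⟩ := ((hq.frequently (Metric.ball_mem_nhds q hl'.pos)).and_eventually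
      (Filter.eventually_gt_atTop r')).exists
    have hpos : 0 < t := hl'.pos.trans ht2
    set T := max r (t + r' + 1)
    have hT : t + r' + 1 ≤ T := le_max_right _ _
    have hR := h T (le_max_left _ _)
    have hpos' := hl'.pos
    have htT : t ∈ Ioo 0 T := ⟨hpos, by linarith⟩
    rcases hl'.ball (γ t) ht1 with h0 | ⟨k', u, hu, he⟩
    · exact hR.avoid t htT (h0 ▸ hF q hqF)
    · obtain ⟨ε, hε, -, hreach⟩ := hl'.reach hG hR.geodesic
        (fun t ht hn => hR.avoid t ht (hF _ hn)) htT hu he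
      have hI : t - ε * u ∈ Ioo 0 T := by
        rcases hε with rfl | rfl <;> constructor <;> linarith [hu.1, hu.2]
      exact hR.avoid _ hI (hreach hI ▸ hF q hqF)
  · obtain ⟨d, L, hL, hL0⟩ := exists_line hG hqF
    have hd := hL.pos
    have hvisit : ∀ᶠ t in Filter.atTop, γ t ∈ L '' Ioo (-d) d →
        ∃ t', t - d < t' ∧ t' < t + d ∧ γ t' = q := by
      filter_upwards [Filter.eventually_gt_atTop d] with t ht
      rintro ⟨u, hu, he⟩
      set T := max r (t + d + 1)
      have hT : t + d + 1 ≤ T := le_max_right _ _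
      have hR := h T (le_max_left _ _)
      obtain ⟨ε, hε, hw⟩ := hR.geodesic.meet hG hL.isLocalGeodesic
        (fun t ht hn => hR.avoid t ht (hF _ hn)) (t := t) ⟨by linarith, by linarith⟩ hu he.symm
      have hz : u + ε * (-(ε * u)) = 0 := by rcases hε with rfl | rfl <;> ring
      have hb : t - d < t + -(ε * u) ∧ t + -(ε * u) < t + d := by
        rcases hε with rfl | rfl <;> constructor <;> linarith [hu.1, hu.2]
      refine ⟨t + -(ε * u), hb.1, hb.2, ?_⟩
      rw [hw _ ⟨by linarith, by linarith⟩ (by rw [hz]; constructor <;> linarith), hz, hL0]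
    have hfr := hq.frequently (hL0 ▸ hL.nhds)
    have hfr2 : ∃ᶠ t in Filter.atTop, ∃ t', t - d < t' ∧ t' < t + d ∧ γ t' = q := by
      refine (hfr.and_eventually hvisit).mono fun t ht => ht.2 ht.1
    obtain ⟨t, ⟨t', h1, h2, h3⟩, h4⟩ :=
      (hfr2.and_eventually (Filter.eventually_gt_atTop d)).exists
    obtain ⟨s, ⟨s', h1', h2', h3'⟩, h4'⟩ :=
      (hfr2.and_eventually (Filter.eventually_gt_atTop (t + d + d))).exists
    have := hinj t' s' (by linarith) (by linarith) (h3.trans h3'.symm)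
    linarith

set_option maxHeartbeats 800000 in
/-- Every prong at a point of `F` extends to an edge arc. -/
theorem exists_edgeArc (hfin : F.Finite) {p : G} {m : ℕ} {r : ℝ} {l : Fin m → ℝ → G}
    (hl : ProngsAt p m r l) (hp : p ∈ F) (k : Fin m) :
    ∃ e ℓ, IsEdgeArc F e ℓ ∧ e 0 = p ∧ ∃ δ > 0, δ ≤ ℓ ∧ ∀ s ∈ Ioo 0 δ, e s = l k s := by
  classical
  -- shrink so that the prong avoids `F`
  obtain ⟨r', hr', hr'r, hball⟩ : ∃ r' > 0, r' ≤ r ∧ ∀ x, dist x p < r' → x ∈ F → x = p := by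
    have : (F \ {p})ᶜ ∈ 𝓝 p := (hfin.subset sdiff_subset).isClosed.isOpen_compl.mem_nhds (by simp)
    obtain ⟨d, hd, hsub⟩ := Metric.mem_nhds_iff.1 this
    refine ⟨min d r, lt_min hd hl.pos, min_le_right _ _, fun x hx hxF => ?_⟩
    by_contra hne
    exact hsub (Metric.mem_ball.2 (hx.trans_le (min_le_left _ _))) ⟨hxF, hne⟩
  replace hl := hl.shrink hr' hr'r
  clear hr'r
  have hray0 : IsRay F (l k) r' (l k) r' := by
    refine ⟨le_rfl, hl.isLocalGeodesic k, fun t ht hF' => ?_, fun _ _ => rfl⟩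
    have hd := hl.dist_center k ⟨ht.1.le, ht.2⟩
    have := hball _ (hd.trans_lt ht.2) hF'
    rw [this, dist_self] at hd
    exact ht.1.ne hd
  -- The lengths to which the prong extends. The edge is the extension of supremal length.
  set S : Set ℝ := {T | ∃ γ, IsRay F (l k) r' γ T} with hS
  have hrS : r' ∈ S := ⟨_, hray0⟩
  -- Rays of different lengths agree where both are defined, so the chosen values do not depend on
  -- the choices.
  let Γ : ℝ → G := fun t => if h : ∃ T, T ∈ S ∧ t < T then h.choose_spec.1.choose t else p
  have hΓ : ∀ T γ, IsRay F (l k) r' γ T → EqOn Γ γ (Ioo 0 T) := by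
    intro T γ hγ t ht
    have h : ∃ T, T ∈ S ∧ t < T := ⟨T, ⟨γ, hγ⟩, ht.2⟩
    simp only [Γ, dif_pos h]
    have h1 := h.choose_spec.1.choose_spec
    have h2 := h.choose_spec.2
    rcases le_total T h.choose with hle | hle
    · exact (hγ.eqOn hG hF hr' h1 hle ht).symm
    · exact h1.eqOn hG hF hr' hγ hle ⟨ht.1, h2⟩
  have hΓray : ∀ T, r' ≤ T → (∀ t < T, ∃ T' ∈ S, t < T') → IsRay F (l k) r' Γ T := by
    intro T hrT hT
    refine ⟨hrT, fun t ht => ?_, fun t ht => ?_, hΓ r' _ hray0⟩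
    · obtain ⟨T', ⟨γ, hγ⟩, htT'⟩ := hT t ht.2
      exact hγ.geodesic.congr (hΓ T' γ hγ).symm t ⟨ht.1, htT'⟩
    · obtain ⟨T', ⟨γ, hγ⟩, htT'⟩ := hT t ht.2
      rw [hΓ T' γ hγ ⟨ht.1, htT'⟩]
      exact hγ.avoid t ⟨ht.1, htT'⟩
  have hbdd : BddAbove S := by
    by_contra hb
    rw [not_bddAbove_iff] at hb
    exact IsRay.not_infinite hG hF hl hp (γ := Γ) fun T hT => hΓray T hT fun t _ => hb t
  set ℓ := sSup S with hℓ
  have hrℓ : r' ≤ ℓ := le_csSup hbdd hrS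
  have hℓ0 : 0 < ℓ := hr'.trans_le hrℓ
  have hR : IsRay F (l k) r' Γ ℓ := hΓray ℓ hrℓ fun t ht => exists_lt_of_lt_csSup ⟨r', hrS⟩ ht
  have hRn : ∀ t ∈ Ioo 0 ℓ, ¬ IsNatural (Γ t) := fun t ht hn => hR.avoid t ht (hF _ hn)
  set ρ : ℝ → G := fun s => Γ (ℓ - s) with hρ
  have hρI : ∀ s ∈ Ioo 0 ℓ, ℓ - s ∈ Ioo 0 ℓ := fun s hs => ⟨by linarith [hs.2], by linarith [hs.1]⟩
  have hρg : IsLocalGeodesic ρ 0 ℓ := by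
    have := hR.geodesic.comp_affine (a' := 0) (b' := ℓ) (ε := -1) (c := ℓ) (Or.inr rfl)
      fun w hw => ⟨by linarith [hw.2], by linarith [hw.1]⟩
    simpa [hρ, sub_eq_add_neg] using this
  obtain ⟨q, hq⟩ := exists_clusterPt_of_compactSpace (Filter.map ρ (𝓝[>] (0 : ℝ)))
  have hq : MapClusterPt q (𝓝[>] (0 : ℝ)) ρ := hq
  -- Otherwise the ray is close to a line through `q` free of `F`, and following this line prolongs
  -- the ray beyond the supremum.
  have hqF : q ∈ F := by
    by_contra hqF
    obtain ⟨d0, L, hL, hL0⟩ := exists_line hG (fun hn => hqF (hF q hn))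
    obtain ⟨d, hd, hdd0, hdF⟩ : ∃ d > 0, d ≤ d0 ∧ ∀ x, dist x q < d → x ∉ F := by
      obtain ⟨d, hd, hsub⟩ := Metric.mem_nhds_iff.1 (hfin.isClosed.isOpen_compl.mem_nhds hqF)
      exact ⟨min d d0, lt_min hd hL.pos, min_le_right _ _, fun x hx =>
        hsub (Metric.mem_ball.2 (hx.trans_le (min_le_left _ _)))⟩
    replace hL := hL.shrink hd hdd0
    have hm : 0 < min ℓ (d / 4) := lt_min hℓ0 (by linarith)
    have hL4 := (hL.shrink (r' := d / 4) (by linarith) (by linarith)).nhds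
    obtain ⟨s, ⟨u, hu, he⟩, hs⟩ :=
      ((hq.frequently (hL0 ▸ hL4)).and_eventually (Ioo_mem_nhdsGT hm)).exists
    have hsℓ : s ∈ Ioo 0 ℓ := ⟨hs.1, hs.2.trans_le (min_le_left _ _)⟩
    have hsd : s < d / 4 := hs.2.trans_le (min_le_right _ _)
    set t := ℓ - s with ht_def
    have ht : t ∈ Ioo 0 ℓ := hρI s hsℓ
    obtain ⟨ε, hε, hw⟩ := hR.geodesic.meet hG hL.isLocalGeodesic hRn ht
      (t' := u) ⟨by linarith [hu.1], by linarith [hu.2]⟩ he.symm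
    have hLI : ∀ w, |w| < d / 2 → u + ε * w ∈ Ioo (-d) d := by
      intro w hw
      have := abs_lt.1 hw
      rcases hε with rfl | rfl <;> constructor <;> linarith [hu.1, hu.2]
    -- Up to `t` this is the ray and from `t` on the line. Since `ℓ - t < d / 4`, its length `t + d
    -- / 2` exceeds `ℓ`.
    let γ : ℝ → G := fun x => if x ≤ t then Γ x else L (u + ε * (x - t))
    have hγ1 : EqOn Γ γ (Ioo 0 ℓ) := by
      intro x hx
      by_cases hxt : x ≤ t
      · simp [γ, hxt]
      · push Not at hxt
        have := hw (x - t) (by rwa [add_sub_cancel])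
          (hLI _ (by rw [abs_of_pos (by linarith)]; linarith [hx.2]))
        rw [add_sub_cancel] at this
        simp [γ, not_le.2 hxt, this]
    have hγ2 : EqOn (fun x => L (u - ε * t + ε * x)) γ
        (Ioo (max 0 (t - d / 2)) (t + d / 2)) := by
      intro x hx
      have hx1 := max_lt_iff.1 hx.1
      show L (u - ε * t + ε * x) = γ x
      rw [show u - ε * t + ε * x = u + ε * (x - t) by ring]
      by_cases hxt : x ≤ t
      · have := hw (x - t) (by rw [add_sub_cancel]; exact ⟨hx1.1, hxt.trans_lt ht.2⟩)
          (hLI _ (by rw [abs_lt]; constructor <;> linarith))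
        rw [add_sub_cancel] at this
        simp [γ, hxt, this]
      · simp [γ, hxt]
    have hγray : IsRay F (l k) r' γ (t + d / 2) := by
      refine ⟨by linarith, fun x hx => ?_, fun x hx => ?_, ?_⟩
      · by_cases hxℓ : x < ℓ
        · exact hR.geodesic.congr hγ1 x ⟨hx.1, hxℓ⟩
        · push Not at hxℓ
          have hg : IsLocalGeodesic (fun x => L (u - ε * t + ε * x))
              (max 0 (t - d / 2)) (t + d / 2) := by
            refine hL.isLocalGeodesic.comp_affine hε fun w hw => ?_
            have hw1 := max_lt_iff.1 hw.1
            rw [show u - ε * t + ε * w = u + ε * (w - t) by ring]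
            exact hLI _ (by rw [abs_lt]; constructor <;> linarith [hw.2])
          exact hg.congr hγ2 x ⟨max_lt hx.1 (by linarith), hx.2⟩
      · by_cases hxt : x ≤ t
        · simp only [γ, hxt, if_true]
          exact hR.avoid x ⟨hx.1, hxt.trans_lt ht.2⟩
        · simp only [γ, hxt, if_false]
          push Not at hxt
          have hI := hLI (x - t) (by rw [abs_of_pos (by linarith)]; linarith [hx.2])
          refine hdF _ ?_
          rw [← hL0, hL.dist _ hI 0 ⟨by linarith, by linarith⟩, sub_zero]
          exact abs_lt.2 hI
      · intro x hx
        rw [← hγ1 ⟨hx.1, hx.2.trans_le hrℓ⟩]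
        exact hR.initial hx
    have : t + d / 2 ≤ ℓ := le_csSup hbdd ⟨γ, hγray⟩
    linarith
  obtain ⟨m', hm', hv⟩ := hG q
  obtain ⟨r'', l', hl'⟩ := hv.exists_prongs
  -- Clustering at `q` improves to convergence: the reversed ray initially runs along a single prong
  -- of `q`.
  obtain ⟨k', δ, hδ, hδℓ, hδr, hend⟩ := hl'.exists_initial hG hℓ0 hρg
    (fun s hs => hRn _ (hρI s hs)) (fun s hs he => hR.avoid _ (hρI s hs) (show ρ s ∈ F from he ▸ hqF)) hq
  have hp0 : Filter.Tendsto Γ (𝓝[>] 0) (𝓝 p) := by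
    rw [tendsto_iff_dist_tendsto_zero]
    have h0 : Filter.Tendsto (fun c : ℝ => c) (𝓝[>] 0) (𝓝 0) := nhdsWithin_le_nhds
    refine h0.congr' ?_
    filter_upwards [Ioo_mem_nhdsGT hr'] with c hc
    rw [hR.initial hc, hl.dist_center k ⟨hc.1.le, hc.2⟩]
  have hqℓ : Filter.Tendsto Γ (𝓝[<] ℓ) (𝓝 q) := by
    rw [tendsto_iff_dist_tendsto_zero]
    have h0 : Filter.Tendsto (fun c : ℝ => ℓ - c) (𝓝[<] ℓ) (𝓝 0) := by
      have : Continuous fun c : ℝ => ℓ - c := by fun_prop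
      exact (this.tendsto' ℓ 0 (by simp)).mono_left nhdsWithin_le_nhds
    refine h0.congr' ?_
    filter_upwards [Ioo_mem_nhdsLT (show ℓ - δ < ℓ by linarith)] with c hc
    have := hend (ℓ - c) ⟨by linarith [hc.2], by linarith [hc.1]⟩
    simp only [hρ, sub_sub_cancel] at this
    rw [this, hl'.dist_center k' ⟨by linarith [hc.2], by linarith [hc.1]⟩]
  refine ⟨extendFrom (Ioo 0 ℓ) Γ, ℓ, ?_⟩
  have hext : EqOn Γ (extendFrom (Ioo 0 ℓ) Γ) (Ioo 0 ℓ) := fun t ht =>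
    (extendFrom_extends hR.geodesic.continuousOn t ht).symm
  have he0 : extendFrom (Ioo 0 ℓ) Γ 0 = p := eq_lim_at_left_extendFrom_Ioo hℓ0 hp0
  have heℓ : extendFrom (Ioo 0 ℓ) Γ ℓ = q := eq_lim_at_right_extendFrom_Ioo hℓ0 hqℓ
  refine ⟨⟨hℓ0, continuousOn_Icc_extendFrom_Ioo hR.geodesic.continuousOn hp0 hqℓ,
    hR.geodesic.congr hext, he0 ▸ hp, heℓ ▸ hqF, fun t ht => ?_, ?_⟩, he0, r', hr', hrℓ, ?_⟩
  · rw [← hext ht]; exact hR.avoid t ht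
  · exact (hR.injOn hG hF hl hp).congr hext
  · intro s hs
    rw [← hext ⟨hs.1, hs.2.trans_le hrℓ⟩]
    exact hR.initial hs

end Rays
end Edges

/-! ### Open stars of the vertices of a subdivision. -/

section EdgeStars

variable {G : Type*} [MetricSpace G]

/-- The open star of `p` in the subdivision of the graph with vertex set `F`. -/
def edgeStar (F : Set G) (p : G) : Set G :=
  {x | x = p ∨ ∃ e ℓ, IsEdgeArc F e ℓ ∧ e 0 = p ∧ ∃ s ∈ Ioo 0 ℓ, x = e s}

theorem mem_edgeStar_self (F : Set G) (p : G) : p ∈ edgeStar F p := Or.inl rfl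

theorem edgeStar_inter_subset {F : Set G} {p x : G} (hx : x ∈ edgeStar F p) (hxF : x ∈ F) :
    x = p := by
  rcases hx with h | ⟨e, ℓ, he, -, s, hs, rfl⟩
  · exact h
  · exact absurd hxF (he.avoid s hs)

variable (hG : ∀ p : G, ∃ m, 2 ≤ m ∧ HasValence p m) [CompactSpace G]
include hG

/-- Edges issuing from `p` correspond to prongs at `p`: each prong extends to an edge, and each edge
initially follows a prong and is determined by it. -/
theorem exists_edgeArcs {F : Set G} (hF : ∀ p : G, IsNatural p → p ∈ F) (hfin : F.Finite) {p : G}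
    (hp : p ∈ F) : ∃ (m : ℕ) (r : ℝ) (l : Fin m → ℝ → G) (e : Fin m → ℝ → G) (ℓ : Fin m → ℝ)
      (δ : ℝ), 2 ≤ m ∧ ProngsAt p m r l ∧ 0 < δ ∧ δ ≤ r ∧ (∀ k, δ ≤ ℓ k) ∧
      (∀ k, IsEdgeArc F (e k) (ℓ k) ∧ e k 0 = p ∧ ∀ s ∈ Ioo 0 δ, e k s = l k s) ∧
      ∀ e' ℓ', IsEdgeArc F e' ℓ' → e' 0 = p → ∃ k, ℓ' = ℓ k ∧ EqOn e' (e k) (Icc 0 ℓ') := by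
  obtain ⟨m, hm, hv⟩ := hG p
  obtain ⟨r, l, hl⟩ := hv.exists_prongs
  choose e ℓ he he0 δ hδ hδℓ hel using fun k => exists_edgeArc hG hF hfin hl hp k
  obtain ⟨d, hd0, hd⟩ : ∃ d > 0, ∀ j, d ≤ δ j := by
    have : Nonempty (Fin m) := ⟨⟨0, by omega⟩⟩
    obtain ⟨j, hj⟩ := Finite.exists_min δ
    exact ⟨δ j, hδ j, hj⟩
  refine ⟨m, r, l, e, ℓ, min d r, hm, hl, lt_min hd0 hl.pos, min_le_right _ _,
    fun k => (min_le_left _ _).trans ((hd k).trans (hδℓ k)), fun k => ⟨he k, he0 k, fun s hs =>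
      hel k s ⟨hs.1, hs.2.trans_le ((min_le_left _ _).trans (hd k))⟩⟩, ?_⟩
  intro e' ℓ' he' he'0
  obtain ⟨k, δ', hδ', -, -, hk⟩ := he'.exists_initial hG hF (he'0 ▸ hl)
  refine ⟨k, he'.unique hG hF (he k) (lt_min hδ' (hδ k)) fun s hs => ?_⟩
  rw [hk s ⟨hs.1, hs.2.trans_le (min_le_left _ _)⟩,
    hel k s ⟨hs.1, hs.2.trans_le (min_le_right _ _)⟩]

/-- Only finitely many natural edges issue from each of the finitely many natural vertices, because
their germs are prongs. -/
theorem finite_midpoints (hfin : {p : G | IsNatural p}.Finite) :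
    {q : G | ∃ (e : ℝ → G) (ℓ : ℝ), IsNaturalEdge e ℓ ∧ e 0 = e ℓ ∧ q = e (ℓ / 2)}.Finite := by
  have key : ∀ v : G, ∃ S : Set G, S.Finite ∧ (IsNatural v → ∀ e ℓ, IsNaturalEdge e ℓ →
      e 0 = v → e (ℓ / 2) ∈ S) := by
    intro v
    by_cases hv : IsNatural v
    · obtain ⟨m, r, l, e, ℓ, δ, -, -, -, -, -, -, h⟩ :=
        exists_edgeArcs hG (F := {p : G | IsNatural p}) (fun _ h => h) hfin hv
      refine ⟨range fun k => e k (ℓ k / 2), finite_range _, fun _ e' ℓ' he' he'0 => ?_⟩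
      obtain ⟨k, rfl, hk⟩ := h e' ℓ' he'.isEdgeArc he'0
      exact ⟨k, (hk ⟨by linarith [he'.pos], by linarith [he'.pos]⟩).symm⟩
    · exact ⟨∅, finite_empty, fun h => absurd h hv⟩
  choose S hS hSm using key
  refine (hfin.biUnion fun v _ => hS v).subset ?_
  rintro q ⟨e, ℓ, he, -, rfl⟩
  exact mem_biUnion (show e 0 ∈ {p : G | IsNatural p} from he.initial)
    (hSm _ he.initial e ℓ he rfl)

variable {F : Set G} (hF : ∀ p : G, IsNatural p → p ∈ F) (hfin : F.Finite)
include hF hfin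

theorem edgeStar_eq {p : G} {m : ℕ} {e : Fin m → ℝ → G} {ℓ : Fin m → ℝ}
    (he : ∀ k, IsEdgeArc F (e k) (ℓ k)) (he0 : ∀ k, e k 0 = p)
    (hall : ∀ e' ℓ', IsEdgeArc F e' ℓ' → e' 0 = p → ∃ k, ℓ' = ℓ k ∧ EqOn e' (e k) (Icc 0 ℓ'))
    (x : G) : x ∈ edgeStar F p ↔ x = p ∨ ∃ k, ∃ s ∈ Ioo 0 (ℓ k), x = e k s := by
  refine or_congr_right ⟨?_, ?_⟩
  · rintro ⟨e', ℓ', he', h0, s, hs, rfl⟩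
    obtain ⟨k, rfl, hk⟩ := hall e' ℓ' he' h0
    exact ⟨k, s, hs, hk (Ioo_subset_Icc_self hs)⟩
  · rintro ⟨k, s, hs, rfl⟩
    exact ⟨e k, ℓ k, he k, he0 k, s, hs, rfl⟩

theorem isOpen_edgeStar {p : G} (hp : p ∈ F) : IsOpen (edgeStar F p) := by
  obtain ⟨m, r, l, e, ℓ, δ, hm, hl, hδ, hδr, hδℓ, he, hall⟩ := exists_edgeArcs hG hF hfin hp
  have hW := edgeStar_eq hG hF hfin (fun k => (he k).1) (fun k => (he k).2.1) hall
  rw [isOpen_iff_mem_nhds]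
  intro x hx
  rcases (hW x).1 hx with rfl | ⟨k, s, hs, rfl⟩
  · refine Filter.mem_of_superset (Metric.ball_mem_nhds x hδ) fun y hy => ?_
    rcases (hl.shrink hδ hδr).ball y hy with rfl | ⟨k, s, hs, rfl⟩
    · exact mem_edgeStar_self _ _
    · exact (hW _).2 (Or.inr ⟨k, s, ⟨hs.1, hs.2.trans_le (hδℓ k)⟩, ((he k).2.2 s hs).symm⟩)
  · have := (he k).1.geodesic.image_mem_nhds hG hs (fun hn => (he k).1.avoid s hs (hF _ hn))
      (Ioo_mem_nhds hs.1 hs.2)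
    refine Filter.mem_of_superset this ?_
    rintro _ ⟨t, ht, rfl⟩
    exact (hW _).2 (Or.inr ⟨k, t, ht, rfl⟩)

/-- The star lies in the finite union of its closed edges, which is compact, and the endpoints of
these belong to `F`. -/
theorem closure_edgeStar_subset {p : G} (hp : p ∈ F) : closure (edgeStar F p) ⊆ edgeStar F p ∪ F := by
  obtain ⟨m, r, l, e, ℓ, δ, hm, hl, hδ, hδr, hδℓ, he, hall⟩ := exists_edgeArcs hG hF hfin hp
  have hW := edgeStar_eq hG hF hfin (fun k => (he k).1) (fun k => (he k).2.1) hall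
  have hcl : IsClosed (⋃ k, e k '' Icc 0 (ℓ k)) := isClosed_iUnion_of_finite fun k =>
    (isCompact_Icc.image_of_continuousOn (he k).1.continuousOn).isClosed
  have hsub : edgeStar F p ⊆ ⋃ k, e k '' Icc 0 (ℓ k) := by
    intro x hx
    rcases (hW x).1 hx with rfl | ⟨k, s, hs, rfl⟩
    · exact mem_iUnion.2 ⟨⟨0, by omega⟩, 0, ⟨le_rfl, (he _).1.pos.le⟩, (he _).2.1⟩
    · exact mem_iUnion.2 ⟨k, s, Ioo_subset_Icc_self hs, rfl⟩
  refine (closure_minimal hsub hcl).trans ?_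
  intro x hx
  obtain ⟨k, s, hs, rfl⟩ := mem_iUnion.1 hx
  rcases eq_or_lt_of_le hs.1 with h0 | h0
  · right; rw [← h0]; exact (he k).1.initial
  · rcases eq_or_lt_of_le hs.2 with h1 | h1
    · right; rw [h1]; exact (he k).1.terminal
    · left; exact (hW _).2 (Or.inr ⟨k, s, ⟨h0, h1⟩, rfl⟩)

/-- The open star of a vertex without loops is a star set. -/
theorem isStarSet_edgeStar {p : G} (hp : p ∈ F)
    (hloop : ∀ e ℓ, IsEdgeArc F e ℓ → e 0 ≠ e ℓ) : ∃ m, IsStarSet (edgeStar F p) m p := by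
  classical
  obtain ⟨m, r, l, e, ℓ, δ, hm, hl, hδ, hδr, hδℓ, he, hall⟩ := exists_edgeArcs hG hF hfin hp
  have hW := edgeStar_eq hG hF hfin (fun k => (he k).1) (fun k => (he k).2.1) hall
  have hℓ : ∀ k, 0 < ℓ k := fun k => (he k).1.pos
  -- Edges that meet in their interiors agree up to direction. In equal directions they start along
  -- the same prong; in opposite directions both endpoints of one edge would be `p`, a loop.
  have hmeet : ∀ j k, ∀ s ∈ Ioo 0 (ℓ j), ∀ t ∈ Ioo 0 (ℓ k), e j s = e k t → j = k ∧ s = t := by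
    intro j k s hs t ht hst
    have hjk : j = k := by
      obtain ⟨h1, h2⟩ := (he j).1.meet hG hF (he k).1 hs ht hst
      rcases h2 with ⟨-, h2⟩ | h2
      · have hI : δ / 2 ∈ Ioo 0 δ := ⟨by linarith, by linarith⟩
        have := h2 (x := δ / 2) ⟨hI.1.le, by linarith [hδℓ j]⟩
        rw [(he j).2.2 _ hI, (he k).2.2 _ hI] at this
        exact (hl.inj ⟨hI.1, by linarith⟩ ⟨hI.1.le, by linarith⟩ this).1
      · have := h2 (x := 0) ⟨le_rfl, (hℓ j).le⟩
        simp only [sub_zero] at this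
        rw [(he j).2.1, ← (he k).2.1] at this
        exact absurd this (hloop _ _ (he k).1)
    subst hjk
    exact ⟨rfl, (he j).1.injOn hs ht hst⟩
  let η : G → ℝ := fun y => if h : ∃ k, ∃ s ∈ Ioo 0 (ℓ k), y = e k s then
    h.choose_spec.choose / ℓ h.choose else 0
  have hη : ∀ k, ∀ s ∈ Ioo 0 (ℓ k), η (e k s) = s / ℓ k := by
    intro k s hs
    have h : ∃ k', ∃ s' ∈ Ioo 0 (ℓ k'), e k s = e k' s' := ⟨k, s, hs, rfl⟩
    simp only [η, dif_pos h]
    have h1 := h.choose_spec.choose_spec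
    obtain ⟨h2, h3⟩ := hmeet k h.choose s hs h.choose_spec.choose h1.1 h1.2
    rw [← h3, ← h2]
  have hηp : η p = 0 := by
    simp only [η]
    rw [dif_neg]
    rintro ⟨k, s, hs, h⟩
    exact (he k).1.avoid s hs (h ▸ hp)
  have hIoo : ∀ k, ∀ t ∈ Ioo (0 : ℝ) 1, ℓ k * t ∈ Ioo 0 (ℓ k) := fun k t ht =>
    ⟨mul_pos (hℓ k) ht.1, by nlinarith [hℓ k, ht.2]⟩
  have hchart : IsStarChart (edgeStar F p) p (fun k t => e k (ℓ k * t)) η := by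
    refine ⟨fun k => ?_, fun k => ?_, ?_, hηp, ?_, ?_, ?_⟩
    · refine (he k).1.continuousOn.comp (by fun_prop) fun t ht => ?_
      exact ⟨mul_nonneg (hℓ k).le ht.1, by nlinarith [hℓ k, ht.2]⟩
    · simp [(he k).2.1]
    -- At the center the height is bounded by the distance divided by `δ`. At an interior point the
    -- edge is an open map, so continuity can be tested along the edge.
    · intro y hy
      refine ContinuousAt.continuousWithinAt ?_
      rcases (hW y).1 hy with rfl | ⟨k, s, hs, rfl⟩
      · rw [ContinuousAt, hηp]
        have hb : Filter.Tendsto (fun x => dist x y / δ) (𝓝 y) (𝓝 0) := by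
          have : Continuous fun x => dist x y / δ := by fun_prop
          exact this.tendsto' y 0 (by simp)
        refine squeeze_zero' ?_ ?_ hb
        · filter_upwards [Metric.ball_mem_nhds y hδ] with x hx
          rcases (hl.shrink hδ hδr).ball x hx with rfl | ⟨k, s, hs, rfl⟩
          · rw [hηp]
          · rw [← (he k).2.2 s hs, hη k s ⟨hs.1, hs.2.trans_le (hδℓ k)⟩]
            exact div_nonneg hs.1.le (hℓ k).le
        · filter_upwards [Metric.ball_mem_nhds y hδ] with x hx
          rcases (hl.shrink hδ hδr).ball x hx with rfl | ⟨k, s, hs, rfl⟩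
          · rw [hηp]; simp
          · rw [hl.dist_center k ⟨hs.1.le, hs.2.trans_le hδr⟩, ← (he k).2.2 s hs,
              hη k s ⟨hs.1, hs.2.trans_le (hδℓ k)⟩]
            exact div_le_div_of_nonneg_left hs.1.le hδ (hδℓ k)
      · have hmap : 𝓝 (e k s) ≤ Filter.map (e k) (𝓝 s) := by
          intro U hU
          have := (he k).1.geodesic.image_mem_nhds hG hs
            (fun hn => (he k).1.avoid s hs (hF _ hn)) hU
          exact Filter.mem_of_superset this (image_preimage_subset _ _)
        refine Filter.Tendsto.mono_left ?_ hmap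
        rw [Filter.tendsto_map'_iff]
        have hc : Filter.Tendsto (fun t => t / ℓ k) (𝓝 s) (𝓝 (η (e k s))) := by
          rw [hη k s hs]
          have : Continuous fun t => t / ℓ k := by fun_prop
          exact this.tendsto s
        refine hc.congr' ?_
        filter_upwards [Ioo_mem_nhds hs.1 hs.2] with t ht
        exact (hη k t ht).symm
    · intro k t ht
      rcases eq_or_lt_of_le ht.1 with h0 | h0
      · rw [← h0, mul_zero, (he k).2.1, hηp]
      · have := hℓ k
        rw [hη k _ (hIoo k t ⟨h0, ht.2⟩)]
        field_simp
    · intro y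
      rw [hW]
      refine or_congr_right (exists_congr fun k => ⟨?_, ?_⟩)
      · rintro ⟨s, hs, rfl⟩
        refine ⟨s / ℓ k, ⟨div_pos hs.1 (hℓ k), (div_lt_one (hℓ k)).2 hs.2⟩, ?_⟩
        rw [mul_div_cancel₀ _ (hℓ k).ne']
      · rintro ⟨t, ht, rfl⟩
        exact ⟨_, hIoo k t ht, rfl⟩
    · intro j k t ht hjk
      exact (hmeet j k _ (hIoo j t ht) _ (hIoo k t ht) hjk).1
  exact ⟨m, hchart.isStarSet hm⟩

/-- The closure of the open star adds only points of `F`, so a connected set that meets `F` only in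
`p` cannot leave the star. This yields maximality of the star. -/
theorem subset_edgeStar {p : G} (hp : p ∈ F) {V : Set G} (hV : IsPreconnected V) (hpV : p ∈ V)
    (hVF : ∀ x ∈ V, x ∈ F → x = p) : V ⊆ edgeStar F p := by
  refine hV.subset_of_closure_inter_subset (isOpen_edgeStar hG hF hfin hp)
    ⟨p, hpV, mem_edgeStar_self _ _⟩ ?_
  rintro x ⟨hx, hxV⟩
  rcases closure_edgeStar_subset hG hF hfin hp hx with h | h
  · exact h
  · rw [hVF x hxV h]; exact mem_edgeStar_self _ _

/-- The union of all the stars is open, and it is closed because taking closures adds only vertices,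
which lie in their own stars. -/
theorem exists_mem_edgeStar [PreconnectedSpace G] (hne : F.Nonempty) (x : G) :
    ∃ p ∈ F, x ∈ edgeStar F p := by
  have hop : IsOpen (⋃ p ∈ F, edgeStar F p) :=
    isOpen_biUnion fun p hp => isOpen_edgeStar hG hF hfin hp
  have hcl : IsClosed (⋃ p ∈ F, edgeStar F p) := by
    refine isClosed_of_closure_subset ?_
    rw [hfin.closure_biUnion]
    refine iUnion₂_subset fun p hp => (closure_edgeStar_subset hG hF hfin hp).trans ?_
    refine union_subset (subset_biUnion_of_mem (u := fun p => edgeStar F p) hp) fun q hq => ?_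
    exact mem_biUnion hq (mem_edgeStar_self _ _)
  obtain ⟨p, hp⟩ := hne
  have := (IsClopen.eq_univ ⟨hcl, hop⟩ ⟨p, mem_biUnion hp (mem_edgeStar_self _ _)⟩)
  have hx : x ∈ ⋃ p ∈ F, edgeStar F p := this ▸ mem_univ x
  simpa using hx

/-- If `F` contains the midpoints of natural loops, then no edge of the subdivision is a loop. -/
theorem IsEdgeArc.initial_ne_terminal [PreconnectedSpace G] (hnat : ∃ v : G, IsNatural v)
    (hmid : ∀ e ℓ, IsNaturalEdge e ℓ → e 0 = e ℓ → e (ℓ / 2) ∈ F) {e : ℝ → G} {ℓ : ℝ}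
    (he : IsEdgeArc F e ℓ) : e 0 ≠ e ℓ := by
  intro heq
  have hℓ := he.pos
  by_cases hp : IsNatural (e 0)
  · have hne : IsNaturalEdge e ℓ := ⟨hℓ, he.continuousOn, hp, heq ▸ hp,
      fun t ht hn => he.avoid t ht (hF _ hn), he.injOn, he.geodesic⟩
    exact he.avoid (ℓ / 2) ⟨by linarith, by linarith⟩ (hmid e ℓ hne heq)
  -- If the base point has valence two, the two ends of the loop use up both of its prongs. The loop
  -- is then open and closed, hence the whole graph, which leaves no room for a natural vertex.
  · obtain ⟨m, hm, hv⟩ := hG (e 0)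
    have hm2 : m = 2 := by
      by_contra hne
      exact hp ⟨m, by omega, hv⟩
    subst hm2
    obtain ⟨r, l, hl⟩ := hv.exists_prongs
    obtain ⟨k, δ, hδ, hδℓ, hδr, hk⟩ := he.exists_initial hG hF hl
    obtain ⟨k', δ', hδ', hδℓ', hδr', hk'⟩ := he.reverse.exists_initial hG hF (l := l) (m := 2)
      (r := r) (by simpa [← heq] using hl)
    -- If both ends followed the same prong, injectivity would give `x = ℓ - x` for two different
    -- values of `x`.
    have hkk : k ≠ k' := by
      rintro rfl
      have hm : 0 < min δ δ' := lt_min hδ hδ'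
      have h1 := min_le_left δ δ'
      have h2 := min_le_right δ δ'
      have e1 := hk (min δ δ' / 2) ⟨by linarith, by linarith⟩
      have e2 := hk' (min δ δ' / 2) ⟨by linarith, by linarith⟩
      have e3 := he.injOn (x₁ := min δ δ' / 2) ⟨by linarith, by linarith⟩
        (x₂ := ℓ - min δ δ' / 2) ⟨by linarith, by linarith⟩ (e1.trans e2.symm)
      have hm3 : 0 < min δ δ' / 3 := by linarith
      have e4 := hk (min δ δ' / 3) ⟨by linarith, by linarith⟩
      have e5 := hk' (min δ δ' / 3) ⟨by linarith, by linarith⟩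
      have e6 := he.injOn (x₁ := min δ δ' / 3) ⟨by linarith, by linarith⟩
        (x₂ := ℓ - min δ δ' / 3) ⟨by linarith, by linarith⟩ (e4.trans e5.symm)
      linarith
    have hcl : IsClosed (e '' Icc 0 ℓ) :=
      (isCompact_Icc.image_of_continuousOn he.continuousOn).isClosed
    have hop : IsOpen (e '' Icc 0 ℓ) := by
      rw [isOpen_iff_mem_nhds]
      have hend : e '' Icc 0 ℓ ∈ 𝓝 (e 0) := by
        have hm : 0 < min δ δ' := lt_min hδ hδ'
        refine Filter.mem_of_superset (Metric.ball_mem_nhds _ hm) fun x hx => ?_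
        rcases (hl.shrink hm ((min_le_left _ _).trans hδr)).ball x hx with rfl | ⟨i, s, hs, rfl⟩
        · exact ⟨0, ⟨le_rfl, hℓ.le⟩, rfl⟩
        · have h1 := hs.2.trans_le (min_le_left δ δ')
          have h2 := hs.2.trans_le (min_le_right δ δ')
          have : i = k ∨ i = k' := by
            revert hkk; fin_cases i <;> fin_cases k <;> fin_cases k' <;> simp
          rcases this with rfl | rfl
          · exact ⟨s, ⟨hs.1.le, by linarith⟩, hk s ⟨hs.1, h1⟩⟩
          · exact ⟨ℓ - s, ⟨by linarith, by linarith [hs.1]⟩, hk' s ⟨hs.1, h2⟩⟩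
      rintro _ ⟨t, ht, rfl⟩
      rcases eq_or_lt_of_le ht.1 with h0 | h0
      · rw [← h0]; exact hend
      · rcases eq_or_lt_of_le ht.2 with h1 | h1
        · rw [h1, ← heq]; exact hend
        · refine Filter.mem_of_superset (he.geodesic.image_mem_nhds hG ⟨h0, h1⟩
            (fun hn => he.avoid t ⟨h0, h1⟩ (hF _ hn)) (Ioo_mem_nhds h0 h1)) ?_
          exact image_mono Ioo_subset_Icc_self
    have huniv := IsClopen.eq_univ ⟨hcl, hop⟩ ⟨e 0, 0, ⟨le_rfl, hℓ.le⟩, rfl⟩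
    obtain ⟨v, hv⟩ := hnat
    obtain ⟨t, ht, rfl⟩ : v ∈ e '' Icc 0 ℓ := huniv ▸ mem_univ v
    rcases eq_or_lt_of_le ht.1 with h0 | h0
    · exact hp (h0 ▸ hv)
    · rcases eq_or_lt_of_le ht.2 with h1 | h1
      · exact hp (by rw [heq, ← h1]; exact hv)
      · exact he.avoid t ⟨h0, h1⟩ (hF _ hv)

end EdgeStars

/-! ### Fibers of folds, and a natural vertex in the target. -/

section Folds

variable {G H : Type*} [MetricSpace G] [MetricSpace H]

theorem IsNaturalEdge.mem_Ioo {e : ℝ → G} {ℓ : ℝ} (h : IsNaturalEdge e ℓ) {t : ℝ}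
    (ht : t ∈ Icc 0 ℓ) (hn : ¬ IsNatural (e t)) : t ∈ Ioo 0 ℓ := by
  refine ⟨lt_of_le_of_ne ht.1 ?_, lt_of_le_of_ne ht.2 ?_⟩
  · rintro rfl; exact hn h.initial
  · rintro rfl; exact hn h.terminal

theorem IsNaturalEdge.ne_of_lt {e : ℝ → G} {ℓ : ℝ} (h : IsNaturalEdge e ℓ) {s t : ℝ}
    (hs : 0 < s) (hst : s < t) (ht : t ≤ ℓ) : e s ≠ e t := by
  intro he
  have hs' : s ∈ Ioo 0 ℓ := ⟨hs, hst.trans_le ht⟩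
  rcases eq_or_lt_of_le ht with h1 | h1
  · exact h.interior s hs' (by rw [he, h1]; exact h.terminal)
  · exact hst.ne (h.injOn hs' ⟨hs.trans hst, h1⟩ he)

theorem IsNaturalEdge.finite_preimage {e : ℝ → G} {ℓ : ℝ} (h : IsNaturalEdge e ℓ) (x : G) :
    {t ∈ Icc 0 ℓ | e t = x}.Finite := by
  have h1 : {t ∈ Ioo 0 ℓ | e t = x}.Subsingleton := fun s hs t ht =>
    h.injOn hs.1 ht.1 (hs.2.trans ht.2.symm)
  refine (h1.finite.union (toFinite {0, ℓ})).subset ?_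
  rintro t ⟨ht, he⟩
  rcases eq_or_lt_of_le ht.1 with h0 | h0
  · right; left; exact h0.symm
  · rcases eq_or_lt_of_le ht.2 with h2 | h2
    · right; right; exact h2
    · left; exact ⟨⟨h0, h2⟩, he⟩

/-- A point is identified only with points at the parameters at which one of the two edges passes
through it, and an edge takes each value finitely often. -/
theorem IsFold.finite_fiber {f : G → H} (hf : IsFold f) (y : H) : (f ⁻¹' {y}).Finite := by
  obtain ⟨e₁, e₂, ℓ₁, ℓ₂, L, h₁, h₂, -, -, hL₁, hL₂, -, -, hiff, -⟩ := hf
  rcases (f ⁻¹' {y}).eq_empty_or_nonempty with h0 | ⟨x, hx⟩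
  · rw [h0]; exact finite_empty
  · refine (((finite_singleton x).union ((h₁.finite_preimage x).image e₂)).union
      ((h₂.finite_preimage x).image e₁)).subset fun z hz => ?_
    rcases (hiff x z).1 (hx.trans (Eq.symm hz)) with h | ⟨t, ht, ⟨h, h'⟩ | ⟨h, h'⟩⟩
    · left; left; exact h.symm
    · left; right; exact ⟨t, ⟨⟨ht.1, ht.2.trans hL₁⟩, h.symm⟩, h'.symm⟩
    · right; exact ⟨t, ⟨⟨ht.1, ht.2.trans hL₂⟩, h.symm⟩, h'.symm⟩

theorem IsFold.continuous {f : G → H} (hf : IsFold f) : Continuous f := by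
  obtain ⟨e₁, e₂, ℓ₁, ℓ₂, L, -, -, -, -, -, -, -, hq, -⟩ := hf
  exact hq.continuous

theorem IsFold.surjective {f : G → H} (hf : IsFold f) : Function.Surjective f := by
  obtain ⟨e₁, e₂, ℓ₁, ℓ₂, L, -, -, -, -, -, -, -, hq, -⟩ := hf
  exact hq.surjective

/-- A fold is at most two-to-one off the natural vertices. -/
theorem IsFold.eq_of_three {f : G → H} (hf : IsFold f) {x y z : G}
    (hy : ¬ IsNatural y) (hxy : f x = f y) (hyz : f y = f z) :
    x = y ∨ y = z ∨ x = z := by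
  obtain ⟨e₁, e₂, ℓ₁, ℓ₂, L, h₁, h₂, -, -, hL₁, hL₂, hdisj, -, hiff, -⟩ := hf
  -- Since `y` is not natural, it has only one parameter on its folded segment, and by disjointness
  -- it lies on only one of the two; hence it has a single partner.
  have key : ∀ {e₁ e₂ : ℝ → G} {ℓ₁ ℓ₂ : ℝ}, IsNaturalEdge e₁ ℓ₁ → IsNaturalEdge e₂ ℓ₂ →
      L ≤ ℓ₁ → L ≤ ℓ₂ → Disjoint (e₁ '' Ioc 0 L) (e₂ '' Ioc 0 L) → ∀ t ∈ Icc 0 L, x = e₁ t →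
      y = e₂ t → ∀ s ∈ Icc 0 L, (y = e₁ s ∧ z = e₂ s) ∨ (y = e₂ s ∧ z = e₁ s) → x = z := by
    intro e₁ e₂ ℓ₁ ℓ₂ h₁ h₂ hL₁ hL₂ hdisj t ht hxt hyt s hs h
    have ht2 := h₂.mem_Ioo ⟨ht.1, ht.2.trans hL₂⟩ (hyt ▸ hy)
    rcases h with ⟨h, h'⟩ | ⟨h, h'⟩
    · have hs1 := h₁.mem_Ioo ⟨hs.1, hs.2.trans hL₁⟩ (h ▸ hy)
      exact absurd rfl (hdisj.ne_of_mem ⟨s, ⟨hs1.1, hs.2⟩, h.symm⟩ ⟨t, ⟨ht2.1, ht.2⟩, hyt.symm⟩)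
    · have hs2 := h₂.mem_Ioo ⟨hs.1, hs.2.trans hL₂⟩ (h ▸ hy)
      have : t = s := h₂.injOn ht2 hs2 (hyt.symm.trans h)
      rw [hxt, h', this]
  rcases (hiff x y).1 hxy with h | ⟨t, ht, h⟩
  · exact Or.inl h
  rcases (hiff y z).1 hyz with h' | ⟨s, hs, h'⟩
  · exact Or.inr (Or.inl h')
  right; right
  rcases h with ⟨h1, h2⟩ | ⟨h1, h2⟩
  · exact key h₁ h₂ hL₁ hL₂ hdisj t ht h1 h2 s hs h'
  · exact key h₂ h₁ hL₂ hL₁ hdisj.symm t ht h1 h2 s hs h'.symm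

/-- A continuous curve keeps a positive distance from a point it avoids on a compact interval. -/
theorem exists_dist_ge {e : ℝ → G} {a b : ℝ} (he : ContinuousOn e (Icc a b)) {x : G}
    (hx : ∀ t ∈ Icc a b, e t ≠ x) : ∃ ρ > 0, ∀ t ∈ Icc a b, ρ ≤ dist (e t) x := by
  have hcl : IsClosed (e '' Icc a b) := (isCompact_Icc.image_of_continuousOn he).isClosed
  have hx' : x ∈ (e '' Icc a b)ᶜ := by
    rintro ⟨t, ht, h⟩; exact hx t ht h
  obtain ⟨ρ, hρ, hsub⟩ := Metric.mem_nhds_iff.1 (hcl.isOpen_compl.mem_nhds hx')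
  refine ⟨ρ, hρ, fun t ht => ?_⟩
  by_contra hlt
  exact hsub (Metric.mem_ball.2 (not_le.1 hlt)) ⟨t, ht, rfl⟩

/-- The position of the two folded segments near the endpoint `e₁ L` of the first one. -/
theorem IsNaturalEdge.near_fold_end (hG : ∀ p : G, ∃ m, 2 ≤ m ∧ HasValence p m) {e₁ e₂ : ℝ → G}
    {ℓ₁ ℓ₂ L : ℝ} (h₁ : IsNaturalEdge e₁ ℓ₁) (h₂ : IsNaturalEdge e₂ ℓ₂) (hL : 0 < L)
    (hL₁ : L ≤ ℓ₁) (hL₂ : L ≤ ℓ₂) (hdisj : Disjoint (e₁ '' Ioc 0 L) (e₂ '' Ioc 0 L)) {δ₀ : ℝ}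
    (hδ₀ : 0 < δ₀) (hδL : δ₀ ≤ L / 2) :
    ∃ (m : ℕ) (r : ℝ) (l : Fin m → ℝ → G) (b₀ b : Fin m) (δ ρ : ℝ), ProngsAt (e₁ L) m r l ∧
      b ≠ b₀ ∧ 0 < δ ∧ δ ≤ r ∧ δ ≤ L / 2 ∧ 0 < ρ ∧ (∀ s ∈ Ioo 0 δ, e₁ (L - s) = l b₀ s) ∧
      (∀ τ ∈ Icc 0 L, dist (e₁ τ) (e₁ L) < ρ → τ < δ₀ ∨ L - τ < δ) ∧
      ∀ τ ∈ Icc 0 L, dist (e₂ τ) (e₁ L) < ρ → τ < δ₀ := by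
  obtain ⟨m, hm, hv⟩ := hG (e₁ L)
  obtain ⟨r, l, hl⟩ := hv.exists_prongs
  have hg : IsLocalGeodesic (fun s => e₁ (L - s)) 0 L := by
    have h1 : IsLocalGeodesic e₁ 0 ℓ₁ := h₁.unitSpeed
    have := h1.comp_affine (a' := 0) (b' := L) (ε := -1) (c := L) (Or.inr rfl)
      fun w hw => ⟨by linarith [hw.2], by linarith [hw.1]⟩
    simpa [sub_eq_add_neg] using this
  have hcl : MapClusterPt (e₁ L) (𝓝[>] (0 : ℝ)) (fun s => e₁ (L - s)) := by
    refine Filter.Tendsto.mapClusterPt ?_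
    have h1 := h₁.continuousOn L ⟨hL.le, hL₁⟩
    refine Filter.Tendsto.comp (g := e₁) h1 (tendsto_nhdsWithin_iff.2 ⟨?_, ?_⟩)
    · have : Continuous fun s : ℝ => L - s := by fun_prop
      exact (this.tendsto' 0 L (by simp)).mono_left nhdsWithin_le_nhds
    · filter_upwards [Ioo_mem_nhdsGT hL] with s hs
      exact ⟨by linarith [hs.2], by linarith [hs.1]⟩
  obtain ⟨b₀, δ, hδ, hδL', hδr, hb₀⟩ := hl.exists_initial hG hL hg
    (fun t ht => h₁.interior _ ⟨by linarith [ht.2], by linarith [ht.1]⟩)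
    (fun t ht => h₁.ne_of_lt (by linarith [ht.2]) (by linarith [ht.1]) hL₁) hcl
  obtain ⟨b, hb⟩ : ∃ b, b ≠ b₀ := by
    have : Nontrivial (Fin m) := Fin.nontrivial_iff_two_le.2 hm
    exact exists_ne b₀
  have hm : 0 < min δ (L / 2) := lt_min hδ (by linarith)
  obtain ⟨ρ₁, hρ₁, h1⟩ := exists_dist_ge (e := e₁) (a := δ₀) (b := L - min δ (L / 2)) (x := e₁ L)
    (h₁.continuousOn.mono fun t ht => ⟨by linarith [ht.1], by linarith [ht.2]⟩)
    fun t ht => h₁.ne_of_lt (by linarith [ht.1]) (by linarith [ht.2]) hL₁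
  obtain ⟨ρ₂, hρ₂, h2⟩ := exists_dist_ge (e := e₂) (a := δ₀) (b := L) (x := e₁ L)
    (h₂.continuousOn.mono fun t ht => ⟨by linarith [ht.1], by linarith [ht.2]⟩)
    fun t ht => (hdisj.ne_of_mem ⟨L, ⟨hL, le_rfl⟩, rfl⟩
      ⟨t, ⟨by linarith [ht.1], ht.2⟩, rfl⟩).symm
  refine ⟨m, r, l, b₀, b, min δ (L / 2), min ρ₁ ρ₂, hl, hb, hm, (min_le_left _ _).trans hδr,
    min_le_right _ _, lt_min hρ₁ hρ₂, fun s hs => hb₀ s ⟨hs.1, hs.2.trans_le (min_le_left _ _)⟩,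
    fun τ hτ hd => ?_, fun τ hτ hd => ?_⟩
  · by_contra hcon
    push Not at hcon
    have := h1 τ ⟨hcon.1, by linarith [hcon.2]⟩
    exact absurd (hd.trans_le (min_le_left _ _)) (not_lt.2 this)
  · by_contra hcon
    push Not at hcon
    have := h2 τ ⟨hcon, hτ.2⟩
    exact absurd (hd.trans_le (min_le_right _ _)) (not_lt.2 this)

/-- The target of a fold has a natural vertex. -/
theorem IsFold.exists_isNatural_target (hG : ∀ p : G, ∃ m, 2 ≤ m ∧ HasValence p m)
    (hH : ∀ p : H, ∃ m, 2 ≤ m ∧ HasValence p m) {f : G → H} (hf : IsFold f) :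
    ∃ v : H, IsNatural v := by
  by_contra hno
  push Not at hno
  have hfc := hf.continuous
  obtain ⟨e₁, e₂, ℓ₁, ℓ₂, L, h₁, h₂, h0, hL, hL₁, hL₂, hdisj, -, hiff, -⟩ := hf
  have hne : e₁ L ≠ e₂ L := hdisj.ne_of_mem ⟨L, ⟨hL, le_rfl⟩, rfl⟩ ⟨L, ⟨hL, le_rfl⟩, rfl⟩
  set d := dist (e₁ L) (e₂ L) with hd_def
  have hd : 0 < d := dist_pos.2 hne
  -- If the whole edge is folded, `e₁ L` may equal `e₁ 0`, and the starts of the segments also come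
  -- near the endpoint. They are handled by distance: both starts are close to `e₁ 0`, which cannot
  -- be close to both `e₁ L` and `e₂ L`.
  obtain ⟨δ₀, hδ₀, hδ₀L, hnear⟩ : ∃ δ₀ > 0, δ₀ ≤ L / 2 ∧ ∀ τ ∈ Icc 0 L, τ < δ₀ →
      dist (e₁ τ) (e₁ 0) < d / 8 ∧ dist (e₂ τ) (e₁ 0) < d / 8 := by
    have aux : ∀ {e : ℝ → G} {ℓ : ℝ}, IsNaturalEdge e ℓ → L ≤ ℓ → ∃ δ > 0, ∀ τ ∈ Icc 0 L, τ < δ →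
        dist (e τ) (e 0) < d / 8 := by
      intro e ℓ he hLℓ
      obtain ⟨δ, hδ, h⟩ := Metric.continuousOn_iff.1 he.continuousOn 0 ⟨le_rfl, he.pos.le⟩ (d / 8)
        (by linarith)
      refine ⟨δ, hδ, fun τ hτ hτδ => h τ ⟨hτ.1, hτ.2.trans hLℓ⟩ ?_⟩
      rw [Real.dist_eq, sub_zero, abs_of_nonneg hτ.1]; exact hτδ
    obtain ⟨δ, hδ, h⟩ := aux h₁ hL₁
    obtain ⟨δ', hδ', h'⟩ := aux h₂ hL₂
    refine ⟨min (min δ δ') (L / 2), lt_min (lt_min hδ hδ') (by linarith), min_le_right _ _,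
      fun τ hτ hlt => ?_⟩
    have h1 := hlt.trans_le (min_le_left _ _)
    exact ⟨h τ hτ (h1.trans_le (min_le_left _ _)),
      h0 ▸ h' τ hτ (h1.trans_le (min_le_right _ _))⟩
  obtain ⟨m, r, l, b₀, b, δ, ρ, hl, hb, hδ, hδr, hδL, hρ, hlb, hn₁, hn₂⟩ :=
    h₁.near_fold_end hG h₂ hL hL₁ hL₂ hdisj hδ₀ hδ₀L
  obtain ⟨m', r', l', c₀, c, δ', ρ', hl', hc, hδ', hδr', hδL', hρ', hlc, hn₁', hn₂'⟩ :=
    h₂.near_fold_end hG h₁ hL hL₂ hL₁ hdisj.symm hδ₀ hδ₀L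
  -- Three disjoint arcs leave `w`: the common image of the folded segments run backwards, one
  -- further prong at `e₁ L`, and one at `e₂ L`. A point of valence two admits only two such arcs.
  set w := f (e₁ L) with hw
  have hw2 : f (e₂ L) = w := ((hiff _ _).2 (Or.inr ⟨L, ⟨hL.le, le_rfl⟩, Or.inl ⟨rfl, rfl⟩⟩)).symm
  obtain ⟨k, hk, hkv⟩ := hH w
  have hk2 : k = 2 := by
    by_contra hk'
    exact hno w ⟨k, by omega, hkv⟩
  obtain ⟨rw, lw, hlw⟩ := hkv.exists_prongs
  obtain ⟨a₁, ha₁, hba₁⟩ := Metric.mem_nhds_iff.1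
    (hfc.continuousAt.preimage_mem_nhds (Metric.ball_mem_nhds w hlw.pos) : _ ∈ 𝓝 (e₁ L))
  obtain ⟨a₂, ha₂, hba₂⟩ := Metric.mem_nhds_iff.1
    (hfc.continuousAt.preimage_mem_nhds (hw2 ▸ Metric.ball_mem_nhds w hlw.pos) : _ ∈ 𝓝 (e₂ L))
  obtain ⟨ε, hε, hεδ, hεδ', hερ, hερ', hεa₁, hεa₂, hεd⟩ : ∃ ε > 0, ε ≤ δ ∧ ε ≤ δ' ∧ ε ≤ ρ ∧
      ε ≤ ρ' ∧ ε ≤ a₁ ∧ ε ≤ a₂ ∧ ε ≤ d / 8 := by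
    refine ⟨min δ (min δ' (min ρ (min ρ' (min a₁ (min a₂ (d / 8)))))), ?_, ?_⟩
    · simp only [gt_iff_lt, lt_min_iff]; refine ⟨hδ, hδ', hρ, hρ', ha₁, ha₂, by linarith⟩
    · simp
  have hI : ∀ t ∈ Ioo 0 ε, t ∈ Ioo 0 r ∧ t ∈ Ioo 0 r' := fun t ht =>
    ⟨⟨ht.1, by linarith [ht.2]⟩, ⟨ht.1, by linarith [ht.2]⟩⟩
  have hdl : ∀ i, ∀ t ∈ Ioo 0 ε, dist (l i t) (e₁ L) = t := fun i t ht =>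
    hl.dist_center i (Ioo_subset_Ico_self (hI t ht).1)
  have hdl' : ∀ i, ∀ t ∈ Ioo 0 ε, dist (l' i t) (e₂ L) = t := fun i t ht =>
    hl'.dist_center i (Ioo_subset_Ico_self (hI t ht).2)
  -- points near the two ends of the folded segments
  have hA : ∀ t ∈ Ioo 0 ε, ∀ y, f (l b₀ t) = f y → y = l b₀ t ∨ y = e₂ (L - t) := by
    intro t ht y hy
    have hlt := hlb t ⟨ht.1, by linarith [ht.2]⟩
    have htI : L - t ∈ Ioo 0 L := ⟨by linarith [ht.2], by linarith [ht.1]⟩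
    have hnat := h₁.interior (L - t) ⟨htI.1, htI.2.trans_le hL₁⟩
    rw [← hlt] at hy ⊢
    rcases (hiff _ _).1 hy with h | ⟨τ, hτ, ⟨h, h'⟩ | ⟨h, h'⟩⟩
    · exact Or.inl h.symm
    · right
      have hτ' := h₁.mem_Ioo ⟨hτ.1, hτ.2.trans hL₁⟩ (h ▸ hnat)
      rw [h₁.injOn ⟨htI.1, htI.2.trans_le hL₁⟩ hτ' h, h']
    · exfalso
      rcases eq_or_lt_of_le hτ.1 with h2 | h2
      · exact hnat (by rw [h, ← h2, ← h0]; exact h₁.initial)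
      · exact hdisj.ne_of_mem ⟨L - t, ⟨htI.1, htI.2.le⟩, rfl⟩ ⟨τ, ⟨h2, hτ.2⟩, rfl⟩ h
  -- Near their vertices the two further prongs are too far apart to coincide. An identification
  -- through the fold would put one of them on a folded segment, either close to its end, where the
  -- prong `b` is not the folded one, or close to its start, which the distances exclude.
  have hBC : ∀ s ∈ Ioo 0 ε, ∀ t ∈ Ioo 0 ε, f (l b s) ≠ f (l' c t) := by
    intro s hs t ht hf'
    have h5 := hdl b s hs
    have h6 := hdl' c t ht
    have hsmall : ∀ τ ∈ Icc 0 L, τ < δ₀ → ∀ x y, dist x (e₁ 0) < d / 8 → dist y (e₁ 0) < d / 8 →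
        l b s = x → l' c t = y → False := by
      rintro τ hτ hτδ x y hx hy rfl rfl
      have h1 := dist_triangle (e₁ L) (l b s) (e₂ L)
      have h2 := dist_triangle (l b s) (e₁ 0) (e₂ L)
      have h3 := dist_triangle (e₁ 0) (l' c t) (e₂ L)
      rw [dist_comm (e₁ L) (l b s), h5] at h1
      rw [dist_comm (e₁ 0) (l' c t), h6] at h3
      have h4 := hs.2; have h7 := ht.2
      linarith
    rcases (hiff _ _).1 hf' with h | ⟨τ, hτ, ⟨h, h'⟩ | ⟨h, h'⟩⟩
    · have h1 := dist_triangle (e₁ L) (l b s) (e₂ L)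
      rw [dist_comm (e₁ L) (l b s), h5, h, h6] at h1
      linarith [hs.2, ht.2]
    · rcases hn₁ τ hτ (by rw [← h, h5]; linarith [hs.2]) with h1 | h1
      · exact hsmall τ hτ h1 _ _ (hnear τ hτ h1).1 (hnear τ hτ h1).2 h h'
      · rcases eq_or_lt_of_le hτ.2 with h2 | h2
        · rw [h, h2, dist_self] at h5; exact hs.1.ne h5
        · have := hlb (L - τ) ⟨by linarith, h1⟩
          rw [sub_sub_cancel, ← h] at this
          exact hb (hl.inj (hI s hs).1 ⟨by linarith, by linarith⟩ this).1
    · have h1 := hn₂ τ hτ (by rw [← h, h5]; linarith [hs.2])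
      exact hsmall τ hτ h1 _ _ (hnear τ hτ h1).2 (hnear τ hτ h1).1 h h'
  -- The only points of the fiber of `w` within reach are the endpoints themselves, so the arcs do
  -- not return to `w`.
  have hz : ∀ x, dist x (e₁ L) < d → x ≠ e₁ L → f x ≠ w := by
    intro x hx hxne hfx
    rcases (hiff _ _).1 hfx with h | ⟨τ, hτ, ⟨h, h'⟩ | ⟨h, h'⟩⟩
    · exact hxne h
    · rcases eq_or_lt_of_le hτ.1 with h2 | h2
      · exact hxne (by rw [h, h', ← h2, h0])
      · exact hdisj.ne_of_mem ⟨L, ⟨hL, le_rfl⟩, rfl⟩ ⟨τ, ⟨h2, hτ.2⟩, rfl⟩ h'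
    · rcases eq_or_lt_of_le hτ.1 with h2 | h2
      · exact hxne (by rw [h, h', ← h2, h0])
      · rcases eq_or_lt_of_le hτ.2 with h3 | h3
        · rw [h, h3, dist_comm] at hx; exact lt_irrefl _ hx
        · exact h₁.ne_of_lt h2 h3 hL₁ h'.symm
  have hz' : ∀ x, dist x (e₂ L) < d → x ≠ e₂ L → f x ≠ w := by
    intro x hx hxne hfx
    rcases (hiff _ _).1 (hfx.trans hw2.symm) with h | ⟨τ, hτ, ⟨h, h'⟩ | ⟨h, h'⟩⟩
    · exact hxne h
    · rcases eq_or_lt_of_le hτ.1 with h2 | h2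
      · exact hxne (by rw [h, h', ← h2, h0])
      · rcases eq_or_lt_of_le hτ.2 with h3 | h3
        · rw [h, h3] at hx; exact lt_irrefl _ hx
        · exact h₂.ne_of_lt h2 h3 hL₂ h'.symm
    · rcases eq_or_lt_of_le hτ.1 with h2 | h2
      · exact hxne (by rw [h, h', ← h2, h0])
      · exact hdisj.ne_of_mem ⟨τ, ⟨h2, hτ.2⟩, rfl⟩ ⟨L, ⟨hL, le_rfl⟩, rfl⟩ h'.symm
  -- three disjoint arcs at `w`
  have lc : ∀ i, ContinuousOn (l i) (Ico 0 ε) := fun i => by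
    refine (LipschitzOnWith.of_dist_le_mul (K := 1) fun s hs t ht => ?_).continuousOn
    rw [hl.dist_same i s ⟨hs.1, by linarith [hs.2]⟩ t ⟨ht.1, by linarith [ht.2]⟩, Real.dist_eq]
    simp
  have lc' : ∀ i, ContinuousOn (l' i) (Ico 0 ε) := fun i => by
    refine (LipschitzOnWith.of_dist_le_mul (K := 1) fun s hs t ht => ?_).continuousOn
    rw [hl'.dist_same i s ⟨hs.1, by linarith [hs.2]⟩ t ⟨ht.1, by linarith [ht.2]⟩, Real.dist_eq]
    simp
  let g : Fin 3 → ℝ → H := ![fun t => f (l b₀ t), fun t => f (l b t), fun t => f (l' c t)]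
  have hAB : ∀ s ∈ Ioo 0 ε, ∀ t ∈ Ioo 0 ε, f (l b₀ s) ≠ f (l b t) := by
    intro s hs t ht he
    rcases hA s hs _ he with h | h
    · exact hb (hl.inj (hI t ht).1 (Ioo_subset_Ico_self (hI s hs).1) h).1
    · have h1 := hn₂ (L - s) ⟨by linarith [hs.2], by linarith [hs.1]⟩
        (by rw [← h, hdl b t ht]; linarith [ht.2])
      linarith [hs.2]
  have hAC : ∀ s ∈ Ioo 0 ε, ∀ t ∈ Ioo 0 ε, f (l b₀ s) ≠ f (l' c t) := by
    intro s hs t ht he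
    rcases hA s hs _ he with h | h
    · have h1 := dist_triangle (e₁ L) (l b₀ s) (e₂ L)
      rw [dist_comm (e₁ L) (l b₀ s), hdl b₀ s hs, ← h, hdl' c t ht] at h1
      linarith [hs.2, ht.2]
    · rw [hlc s ⟨hs.1, by linarith [hs.2]⟩] at h
      exact hc (hl'.inj (hI t ht).2 (Ioo_subset_Ico_self (hI s hs).2) h).1
  have := hlw.chart.card_arcs_le (g := g) hε ?_ ?_ ?_ ?_ ?_
  · simp only [Nat.card_eq_fintype_card, Fintype.card_fin] at this
    omega
  · intro j
    fin_cases j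
    · exact hfc.comp_continuousOn (lc b₀)
    · exact hfc.comp_continuousOn (lc b)
    · exact hfc.comp_continuousOn (lc' c)
  · intro j
    fin_cases j
    · show f (l b₀ 0) = w; rw [hl.zero]
    · show f (l b 0) = w; rw [hl.zero]
    · show f (l' c 0) = w; rw [hl'.zero, hw2]
  · intro j t ht
    fin_cases j
    · exact hba₁ (by rw [Metric.mem_ball, hdl b₀ t ht]; linarith [ht.2])
    · exact hba₁ (by rw [Metric.mem_ball, hdl b t ht]; linarith [ht.2])
    · have h := hba₂ (Metric.mem_ball.2 (show dist (l' c t) _ < a₂ by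
        rw [hdl' c t ht]; linarith [ht.2]))
      rwa [mem_preimage, hw2] at h
  · have hne1 : ∀ i, ∀ t ∈ Ioo 0 ε, l i t ≠ e₁ L := fun i t ht he => by
      have := hdl i t ht
      rw [he, dist_self] at this; exact ht.1.ne this
    have hne2 : ∀ i, ∀ t ∈ Ioo 0 ε, l' i t ≠ e₂ L := fun i t ht he => by
      have := hdl' i t ht
      rw [he, dist_self] at this; exact ht.1.ne this
    intro j t ht
    fin_cases j
    · exact hz _ (by rw [hdl b₀ t ht]; linarith [ht.2]) (hne1 b₀ t ht)
    · exact hz _ (by rw [hdl b t ht]; linarith [ht.2]) (hne1 b t ht)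
    · exact hz' _ (by rw [hdl' c t ht]; linarith [ht.2]) (hne2 c t ht)
  · intro j k hjk s hs t ht
    fin_cases j <;> fin_cases k
    · exact absurd rfl hjk
    · exact hAB s hs t ht
    · exact hAC s hs t ht
    · exact (hAB t ht s hs).symm
    · exact absurd rfl hjk
    · exact hBC s hs t ht
    · exact (hAC t ht s hs).symm
    · exact (hBC t ht s hs).symm
    · exact absurd rfl hjk

end Folds
-- The inverse limit, special points and standard neighborhoods.
namespace SplitSequence

variable {n : ℕ} (ζ : SplitSequence.{u} n)

instance (j : ℕ) : CompactSpace (ζ.G j) := (ζ.core j).compact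

instance (j : ℕ) : PathConnectedSpace (ζ.G j) := (ζ.core j).connected

theorem continuous_map {i j : ℕ} (hij : i ≤ j) : Continuous (ζ.map hij) := by
  induction j, hij using Nat.le_induction with
  | base => exact continuous_id.congr fun x => (ζ.map_self i x).symm
  | succ j hij ih =>
    exact (ih.comp (ζ.fold j).continuous).congr fun x => ζ.map_map hij (Nat.le_succ j) x

theorem map_surjective {i j : ℕ} (hij : i ≤ j) : Function.Surjective (ζ.map hij) := by
  induction j, hij using Nat.le_induction with
  | base => exact fun x => ⟨x, ζ.map_self i x⟩
  | succ j hij ih =>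
    intro x
    obtain ⟨y, rfl⟩ := ih x
    obtain ⟨w, rfl⟩ := (ζ.fold j).surjective y
    exact ⟨w, (ζ.map_map hij (Nat.le_succ j) w).symm⟩

theorem finite_fiber {i j : ℕ} (hij : i ≤ j) (y : ζ.G i) : (ζ.map hij ⁻¹' {y}).Finite := by
  induction j, hij using Nat.le_induction with
  | base =>
    refine (finite_singleton y).subset fun x hx => ?_
    rw [← ζ.map_self i x]; exact hx
  | succ j hij ih =>
    have : ζ.map (hij.trans (Nat.le_succ j)) ⁻¹' {y} =
        ⋃ w ∈ ζ.map hij ⁻¹' {y}, ζ.map (Nat.le_succ j) ⁻¹' {w} := by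
      ext x
      simp [← ζ.map_map hij (Nat.le_succ j) x]
    rw [this]
    exact ih.biUnion fun w _ => (ζ.fold j).finite_fiber w

variable {ζ}

theorem continuous_proj (j : ℕ) : Continuous (ζ.proj j) :=
  (continuous_apply j).comp continuous_subtype_val

theorem map_proj {i j : ℕ} (hij : i ≤ j) (x : ζ.X) : ζ.map hij (ζ.proj j x) = ζ.proj i x := by
  induction j, hij using Nat.le_induction with
  | base => exact ζ.map_self _ _
  | succ j hij ih => rw [← ih, ← ζ.map_map hij (Nat.le_succ j)]; congr 1; exact x.2 j

theorem X.ext {x y : ζ.X} (N : ℕ) (h : ∀ j, N ≤ j → ζ.proj j x = ζ.proj j y) : x = y := by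
  refine Subtype.ext (funext fun j => ?_)
  have := congrArg (ζ.map (le_max_left j N)) (h _ (le_max_right j N))
  rwa [map_proj, map_proj] at this

instance : CompactSpace ζ.X := by
  have h : IsClosed {x : ∀ j, ζ.G j | ∀ j, ζ.map (Nat.le_succ j) (x (j + 1)) = x j} := by
    have : {x : ∀ j, ζ.G j | ∀ j, ζ.map (Nat.le_succ j) (x (j + 1)) = x j} =
        ⋂ j, {x | ζ.map (Nat.le_succ j) (x (j + 1)) = x j} := by
      ext; simp
    rw [this]
    exact isClosed_iInter fun j => isClosed_eq
      ((ζ.continuous_map _).comp (continuous_apply _)) (continuous_apply _)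
  exact isCompact_iff_compactSpace.1 h.isCompact

instance : SecondCountableTopology ζ.X :=
  IsEmbedding.subtypeVal.secondCountableTopology

/-- Sequences that are compatible up to level `N` and take the value `p` at level `j` form nested
nonempty closed sets in a compact product. -/
theorem proj_surjective (j : ℕ) : Function.Surjective (ζ.proj j) := by
  intro p
  let T : ℕ → Set (∀ j, ζ.G j) := fun N =>
    {x | x j = p ∧ ∀ i, i + 1 ≤ N → ζ.map (Nat.le_succ i) (x (i + 1)) = x i}
  have hcl : ∀ N, IsClosed (T N) := fun N => by
    have : T N = {x | x j = p} ∩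
        ⋂ (i : ℕ) (_ : i + 1 ≤ N), {x | ζ.map (Nat.le_succ i) (x (i + 1)) = x i} := by
      ext; simp [T]
    rw [this]
    exact (isClosed_eq (continuous_apply _) continuous_const).inter <| isClosed_iInter fun i =>
      isClosed_iInter fun _ => isClosed_eq ((ζ.continuous_map _).comp (continuous_apply _))
        (continuous_apply _)
  have hne : ∀ N, (T N).Nonempty := fun N => by
    classical
    obtain ⟨y, hy⟩ := ζ.map_surjective (le_max_left j N) p
    have : ∀ i, Nonempty (ζ.G i) := fun i => inferInstance
    refine ⟨fun i => if h : i ≤ max j N then ζ.map h y else Classical.arbitrary _, ?_, ?_⟩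
    · simp [hy]
    · intro i hi
      have h1 : i + 1 ≤ max j N := hi.trans (le_max_right _ _)
      have h2 : i ≤ max j N := (Nat.le_succ i).trans h1
      simp only [h1, h2, dif_pos]
      exact ζ.map_map _ _ y
  obtain ⟨x, hx⟩ := IsCompact.nonempty_iInter_of_sequence_nonempty_isCompact_isClosed T
    (fun N x hx => ⟨hx.1, fun i hi => hx.2 i (hi.trans (Nat.le_succ N))⟩) hne
    (hcl 0).isCompact hcl
  rw [mem_iInter] at hx
  exact ⟨⟨x, fun i => (hx (i + 1)).2 i le_rfl⟩, (hx 0).1⟩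

theorem IsSpecial.of_isNatural {K : ℕ} {p : ζ.G K} (h : IsNatural p) : ζ.IsSpecial p :=
  Or.inl ⟨K, le_rfl, by rwa [ζ.map_self]⟩

theorem IsSpecial.map {i j : ℕ} (hij : i ≤ j) {p : ζ.G j} (h : ζ.IsSpecial p) :
    ζ.IsSpecial (ζ.map hij p) := by
  rcases h with ⟨k, hk, hn⟩ | ⟨k, hk, v, hv, rfl⟩
  · rcases le_total k i with hki | hik
    · exact Or.inl ⟨k, hki, by rwa [ζ.map_map]⟩
    · exact Or.inr ⟨k, hik, _, hn, ζ.map_map _ _ _⟩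
  · exact Or.inr ⟨k, hij.trans hk, v, hv, (ζ.map_map _ _ _).symm⟩

/-- Special points map to special points of level `0`, which are images of natural vertices and
hence finite in number by properness; the fibers of the maps are finite. -/
theorem finite_special (hζ : ζ.IsProper) (K : ℕ) : {p : ζ.G K | ζ.IsSpecial p}.Finite := by
  have h0 : {p : ζ.G 0 | ζ.IsSpecial p}.Finite := by
    refine Set.Finite.subset hζ ?_
    rintro p (⟨i, hi, h⟩ | ⟨j, hj, v, hv, rfl⟩)
    · obtain rfl : i = 0 := by omega
      exact ⟨0, _, h, by rw [ζ.map_map, ζ.map_self]⟩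
    · exact ⟨j, v, hv, rfl⟩
  refine (h0.biUnion fun p _ => ζ.finite_fiber (Nat.zero_le K) p).subset fun p hp => ?_
  exact mem_biUnion (hp.map (Nat.zero_le K)) rfl

theorem exists_isStandardStarNhd (hζ : ζ.IsProper) {K : ℕ} (p : ζ.G K) {W : Set (ζ.G K)}
    (hW : W ∈ 𝓝 p) : ∃ V ⊆ W, ζ.IsStandardStarNhd V p := by
  obtain ⟨m, hm, hv⟩ := (ζ.core K).valence p
  obtain ⟨r, l, hl⟩ := hv.exists_prongs
  have h1 : W ∩ {q | ζ.IsSpecial q ∧ q ≠ p}ᶜ ∈ 𝓝 p := by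
    refine Filter.inter_mem hW (IsOpen.mem_nhds ?_ fun h => h.2 rfl)
    exact ((finite_special hζ K).subset fun q hq => hq.1).isClosed.isOpen_compl
  obtain ⟨ε, hε, hεW⟩ := Metric.mem_nhds_iff.1 h1
  have hl' := hl.shrink (lt_min hε hl.pos) (min_le_right _ _)
  refine ⟨_, ?_, Metric.isOpen_ball, ⟨m, hl'.chart.isStarSet hm⟩, fun q hq hqp hs => ?_⟩
  · exact fun q hq => (hεW (Metric.ball_subset_ball (min_le_left _ _) hq)).1
  · exact (hεW (Metric.ball_subset_ball (min_le_left _ _) hq)).2 ⟨hs, hqp⟩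

theorem IsStandardStarNhd.mem {K : ℕ} {V : Set (ζ.G K)} {p : ζ.G K}
    (h : ζ.IsStandardStarNhd V p) : p ∈ V := by
  obtain ⟨m, -, e, he⟩ := h.2.1
  rw [← he]; exact Subtype.coe_prop _

/-- A basic open set of the product constrains finitely many coordinates, and each of these is a
function of one sufficiently deep coordinate. The level can be as deep as desired and the center can
be the projection of `x`. -/
theorem exists_standardNhd (hζ : ζ.IsProper) (x : ζ.X) {W : Set ζ.X} (hW : W ∈ 𝓝 x) (N : ℕ) :
    ∃ K ≥ N, ∃ V, ζ.IsStandardStarNhd V (ζ.proj K x) ∧ ζ.proj K ⁻¹' V ⊆ W := by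
  obtain ⟨W', hW', hsub⟩ := mem_nhds_subtype _ _ _ |>.1 hW
  rw [nhds_pi, Filter.mem_pi] at hW'
  obtain ⟨I, hI, t, ht, hsub'⟩ := hW'
  obtain ⟨M, hM⟩ := hI.bddAbove
  let K := max M N
  have : (⋂ i ∈ I, {q : ζ.G K | ∀ h : i ≤ K, ζ.map h q ∈ t i}) ∈ 𝓝 (ζ.proj K x) := by
    refine (Filter.biInter_mem hI).2 fun i hi => ?_
    have hiK : i ≤ K := (hM hi).trans (le_max_left _ _)
    have := (ζ.continuous_map hiK).continuousAt (x := ζ.proj K x) (by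
      rw [map_proj]; exact ht i)
    filter_upwards [this] with q hq _ using hq
  obtain ⟨V, hVW, hV⟩ := exists_isStandardStarNhd hζ _ this
  refine ⟨K, le_max_right _ _, V, hV, fun y hy => hsub (hsub' fun i hi => ?_)⟩
  have hiK : i ≤ K := (hM hi).trans (le_max_left _ _)
  have := mem_iInter₂.1 (hVW hy) i hi hiK
  rwa [map_proj] at this

theorem eventually_not_isNatural {j : ℕ} (z : ζ.G j) : ∀ᶠ y in 𝓝[≠] z, ¬ IsNatural y := by
  obtain ⟨m, hm, hv⟩ := (ζ.core j).valence z
  obtain ⟨r, l, hl⟩ := hv.exists_prongs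
  filter_upwards [mem_nhdsWithin_of_mem_nhds (Metric.ball_mem_nhds z hl.pos),
    self_mem_nhdsWithin] with y hy hne
  rcases hl.ball y hy with h | ⟨k, s, hs, rfl⟩
  · exact absurd h hne
  · exact hl.not_isNatural k hs

/-- Points near `z` are not natural either, so the absence of backtracking gives injectivity of the
composition down to level `0`, which factors through this map. -/
theorem exists_injOn_map {i j : ℕ} (hij : i ≤ j) {z : ζ.G j} (hz : ¬ IsNatural z) :
    ∃ U ∈ 𝓝 z, InjOn (ζ.map hij) U := by
  obtain ⟨U, hUo, hzU, hU⟩ := ζ.noBacktracking j ⟨z, hz⟩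
  obtain ⟨U', hU', rfl⟩ := isOpen_induced_iff.1 hUo
  have h1 : ∀ᶠ y in 𝓝 z, ¬ IsNatural y := by
    have := eventually_nhdsWithin_iff.1 (eventually_not_isNatural z)
    filter_upwards [this] with y hy
    by_cases h : y = z
    · rwa [h]
    · exact hy h
  refine ⟨_, Filter.inter_mem (hU'.mem_nhds hzU) h1, fun y hy y' hy' he => ?_⟩
  have := hU (x₁ := ⟨y, hy.2⟩) hy.1 (x₂ := ⟨y', hy'.2⟩) hy'.1 (by
    show ζ.map _ y = ζ.map _ y'
    rw [← ζ.map_map (Nat.zero_le i) hij, he, ζ.map_map])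
  exact congrArg Subtype.val this

end SplitSequence

/-! ### Unique lifting of the prongs of a star, and the resulting retraction. -/

section Sections

variable {Y B : Type*} [TopologicalSpace Y] [TopologicalSpace B] {ι : Type*}

/-- `σ` is a lift of `γ : [0, 1) → B` along `g`. -/
structure IsSection (g : Y → B) (γ : ℝ → B) (σ : ℝ → Y) : Prop where
  cont : ContinuousOn σ (Ico 0 1)
  map : ∀ s ∈ Ico (0 : ℝ) 1, g (σ s) = γ s

/-- The prongs of the star `V` lift uniquely along `g`. -/
structure StarLift (V : Set B) (p : B) (c : ι → ℝ → B) (η : B → ℝ) (g : Y → B) : Prop where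
  chart : IsStarChart V p c η
  cont : Continuous g
  exists_section : ∀ a, ∀ t ∈ Ioo (0 : ℝ) 1, ∀ y, g y = c a t → ∃ σ, IsSection g (c a) σ ∧ σ t = y
  unique : ∀ a σ σ', IsSection g (c a) σ → IsSection g (c a) σ' → ∀ t ∈ Ioo (0 : ℝ) 1,
    σ t = σ' t → EqOn σ σ' (Ico 0 1)

open Classical in
/-- The retraction of `g ⁻¹ V` to the fiber over the center that slides each point to the start of
the lifted prong through it. -/
noncomputable def starRetr (g : Y → B) (c : ι → ℝ → B) (y : Y) : Y :=
  if h : ∃ σ : ℝ → Y, (∃ a, IsSection g (c a) σ) ∧ ∃ t ∈ Ioo (0 : ℝ) 1, σ t = y then h.choose 0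
  else y

namespace StarLift

variable {V : Set B} {p : B} {c : ι → ℝ → B} {η : B → ℝ} {g : Y → B}

theorem half_mem : (1 / 2 : ℝ) ∈ Ioo (0 : ℝ) 1 := by norm_num

theorem zero_mem : (0 : ℝ) ∈ Ico (0 : ℝ) 1 := by norm_num

theorem retr_fiber (h : StarLift V p c η g) {y : Y} (hy : g y = p) : starRetr g c y = y := by
  rw [starRetr, dif_neg]
  rintro ⟨σ, ⟨a, hσ⟩, t, ht, rfl⟩
  rw [hσ.map t (Ioo_subset_Ico_self ht)] at hy
  exact h.chart.σ_ne ht hy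

theorem section_mem (h : StarLift V p c η g) {a : ι} {σ : ℝ → Y} (hσ : IsSection g (c a) σ) {t : ℝ}
    (ht : t ∈ Ico (0 : ℝ) 1) : g (σ t) ∈ V := by
  rw [hσ.map t ht]; exact h.chart.mem a ht

theorem section_zero (h : StarLift V p c η g) {a : ι} {σ : ℝ → Y} (hσ : IsSection g (c a) σ) :
    g (σ 0) = p := by
  rw [hσ.map 0 zero_mem, h.chart.zero]

/-- The lift chosen in `starRetr` is immaterial: two lifts through one point off the central fiber
lie over the same prong at the same height, so they agree by uniqueness. -/
theorem retr_section (h : StarLift V p c η g) {a : ι} {σ : ℝ → Y} (hσ : IsSection g (c a) σ) {t : ℝ}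
    (ht : t ∈ Ico (0 : ℝ) 1) : starRetr g c (σ t) = σ 0 := by
  rcases eq_or_lt_of_le ht.1 with h0 | h0
  · rw [← h0]; exact h.retr_fiber (h.section_zero hσ)
  have hex : ∃ σ' : ℝ → Y, (∃ a, IsSection g (c a) σ') ∧ ∃ s ∈ Ioo (0 : ℝ) 1, σ' s = σ t :=
    ⟨σ, ⟨a, hσ⟩, t, ⟨h0, ht.2⟩, rfl⟩
  rw [starRetr, dif_pos hex]
  obtain ⟨⟨a', h1⟩, s, hs, h2⟩ := hex.choose_spec
  have h3 := congrArg g h2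
  rw [h1.map s (Ioo_subset_Ico_self hs), hσ.map t ht] at h3
  obtain ⟨rfl, rfl⟩ := h.chart.σ_inj hs ht h3
  exact h.unique _ _ _ h1 hσ s hs h2 zero_mem

theorem exists_of_ne (h : StarLift V p c η g) {y : Y} (hy : g y ∈ V) (hp : g y ≠ p) :
    η (g y) ∈ Ioo (0 : ℝ) 1 ∧ ∃ a σ, IsSection g (c a) σ ∧ σ (η (g y)) = y := by
  obtain ⟨h1, a, h2⟩ := h.chart.eq_σ hy hp
  obtain ⟨σ, h3⟩ := h.exists_section a _ h1 y h2
  exact ⟨h1, a, σ, h3⟩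

theorem map_retr (h : StarLift V p c η g) {y : Y} (hy : g y ∈ V) : g (starRetr g c y) = p := by
  by_cases hp : g y = p
  · rw [h.retr_fiber hp, hp]
  · obtain ⟨h1, a, σ, hσ, h2⟩ := h.exists_of_ne hy hp
    rw [← h2, h.retr_section hσ (Ioo_subset_Ico_self h1), h.section_zero hσ]

/-- Distinct lifted prongs starting at `z` form a star. -/
theorem isStarChart (h : StarLift V p c η g) {κ : Type*} {z : Y} (hz : g z = p) {a : κ → ι}
    {σ : κ → ℝ → Y} (hσ : ∀ k, IsSection g (c (a k)) (σ k)) (h0 : ∀ k, σ k 0 = z)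
    (hinj : ∀ k k', σ k (1 / 2) = σ k' (1 / 2) → k = k') :
    IsStarChart {y | y = z ∨ ∃ k, ∃ t ∈ Ioo (0 : ℝ) 1, y = σ k t} z σ (fun y => η (g y)) where
  cont k := (hσ k).cont
  zero := h0
  contη := by
    refine h.chart.contη.comp h.cont.continuousOn ?_
    rintro y (rfl | ⟨k, t, ht, rfl⟩)
    · show g y ∈ V; rw [hz]; exact h.chart.center_mem
    · exact h.section_mem (hσ k) (Ioo_subset_Ico_self ht)
  ηz := by rw [hz, h.chart.ηz]
  ησ k t ht := by rw [(hσ k).map t ht, h.chart.ησ _ t ht]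
  mem_iff y := Iff.rfl
  disj k k' t ht he := by
    have h1 := congrArg g he
    have ht' := Ioo_subset_Ico_self ht
    rw [(hσ k).map t ht', (hσ k').map t ht'] at h1
    have h2 := h.chart.disj _ _ t ht h1
    have hk' := hσ k'
    rw [← h2] at hk'
    exact hinj k k' (h.unique _ _ _ (hσ k) hk' t ht he (Ioo_subset_Ico_self half_mem))

/-- The lifted prongs that start at `z`, recorded by their midpoints. -/
def prongs (c : ι → ℝ → B) (g : Y → B) (z : Y) : Set Y :=
  {y | (∃ a, g y = c a (1 / 2)) ∧ starRetr g c y = z}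

/-- The union of the lifted prongs that start at `z`. -/
def fiber (V : Set B) (c : ι → ℝ → B) (g : Y → B) (z : Y) : Set Y :=
  {y | g y ∈ V ∧ starRetr g c y = z}

theorem exists_section_prong (h : StarLift V p c η g) {z y : Y} (hy : y ∈ prongs c g z) :
    ∃ a σ, IsSection g (c a) σ ∧ σ 0 = z ∧ σ (1 / 2) = y := by
  obtain ⟨⟨a, ha⟩, hz⟩ := hy
  obtain ⟨σ, hσ, h1⟩ := h.exists_section a _ half_mem y ha
  refine ⟨a, σ, hσ, ?_, h1⟩
  rw [← hz, ← h1, h.retr_section hσ (Ioo_subset_Ico_self half_mem)]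

theorem section_mem_prongs (h : StarLift V p c η g) {a : ι} {σ : ℝ → Y}
    (hσ : IsSection g (c a) σ) : σ (1 / 2) ∈ prongs c g (σ 0) :=
  ⟨⟨a, hσ.map _ (Ioo_subset_Ico_self half_mem)⟩,
    h.retr_section hσ (Ioo_subset_Ico_self half_mem)⟩

theorem mem_fiber_self (h : StarLift V p c η g) {z : Y} (hz : g z = p) : z ∈ fiber V c g z :=
  ⟨by rw [hz]; exact h.chart.center_mem, h.retr_fiber hz⟩

theorem section_mem_fiber (h : StarLift V p c η g) {a : ι} {σ : ℝ → Y}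
    (hσ : IsSection g (c a) σ) {t : ℝ} (ht : t ∈ Ico (0 : ℝ) 1) : σ t ∈ fiber V c g (σ 0) :=
  ⟨h.section_mem hσ ht, h.retr_section hσ ht⟩

/-- A lifted prong is determined by its midpoint, so midpoints index the prongs of a sheet. No
finiteness is required, so this applies in `X` before the prongs are known to be finite in number.
-/
theorem exists_fiber_chart (h : StarLift V p c η g) {z : Y} (hz : g z = p) :
    ∃ (a : prongs c g z → ι) (σ : prongs c g z → ℝ → Y), (∀ k, IsSection g (c (a k)) (σ k)) ∧
      (∀ k, σ k (1 / 2) = k) ∧ IsStarChart (fiber V c g z) z σ (fun y => η (g y)) := by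
  choose a σ hσ h0 h2 using fun k : prongs c g z => h.exists_section_prong k.2
  refine ⟨a, σ, hσ, h2, ?_⟩
  have hc := h.isStarChart hz hσ h0 (fun k k' he => Subtype.ext (by rw [← h2, he, h2]))
  convert hc using 1
  ext y
  constructor
  · rintro ⟨hy, hr⟩
    by_cases hp : g y = p
    · left; rw [← hr, h.retr_fiber hp]
    · obtain ⟨h1, b, τ, hτ, he⟩ := h.exists_of_ne hy hp
      have hτ0 : τ 0 = z := by
        rw [← hr, ← he, h.retr_section hτ (Ioo_subset_Ico_self h1)]
      let k : prongs c g z := ⟨τ (1 / 2), hτ0 ▸ h.section_mem_prongs hτ⟩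
      refine Or.inr ⟨k, _, h1, ?_⟩
      have hk := h2 k
      have hab : a k = b := by
        have h3 := congrArg g hk
        rw [(hσ k).map _ (Ioo_subset_Ico_self half_mem)] at h3
        have h4 : g k.1 = c b (1 / 2) := hτ.map _ (Ioo_subset_Ico_self half_mem)
        exact h.chart.disj _ _ _ half_mem (h3.trans h4)
      have hk' := hσ k
      rw [hab] at hk'
      have := h.unique b _ _ hk' hτ _ half_mem hk (Ioo_subset_Ico_self h1)
      rw [this, he]
  · rintro (rfl | ⟨k, t, ht, rfl⟩)
    · exact h.mem_fiber_self hz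
    · have := h.section_mem_fiber (hσ k) (Ioo_subset_Ico_self ht)
      rwa [h0 k] at this

theorem isClosed_fiber [T2Space Y] (h : StarLift V p c η g) {z : Y} (hz : g z = p)
    (hfin : (prongs c g z).Finite) : IsClosed {y : g ⁻¹' V | starRetr g c y.1 = z} := by
  obtain ⟨a, σ, hσ, h2, hc⟩ := h.exists_fiber_chart hz
  have := hfin.to_subtype
  have hη : Continuous fun y : g ⁻¹' V => η (g y.1) :=
    continuousOn_iff_continuous_domRestrict.1
      (h.chart.contη.comp h.cont.continuousOn (fun y hy => hy))
  have hηI : ∀ y : g ⁻¹' V, η (g y.1) ∈ Ico (0 : ℝ) 1 := fun y => h.chart.η_mem y.2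
  have h1 : {y : g ⁻¹' V | starRetr g c y.1 = z} =
      {y : g ⁻¹' V | y.1 = z} ∪ ⋃ k, {y : g ⁻¹' V | y.1 = σ k (η (g y.1))} := by
    ext y
    have h3 := hc.mem_iff y.1
    have h4 : y.1 ∈ fiber V c g z ↔ starRetr g c y.1 = z := ⟨fun h => h.2, fun h => ⟨y.2, h⟩⟩
    rw [h4] at h3
    simp only [mem_ofPred_eq, mem_union, mem_iUnion]
    refine ⟨fun h => (h3.1 h).imp id ?_, fun h => ?_⟩
    · rintro ⟨k, t, ht, he⟩
      refine ⟨k, ?_⟩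
      have := hc.ησ k t (Ioo_subset_Ico_self ht)
      rw [← he] at this
      rw [this]; exact he
    · rcases h with h | ⟨k, hk⟩
      · exact h3.2 (Or.inl h)
      · rw [← h4, hk]; exact hc.mem k (hηI y)
  rw [h1]
  refine (isClosed_eq continuous_subtype_val continuous_const).union
    (isClosed_iUnion_of_finite fun k => isClosed_eq continuous_subtype_val ?_)
  exact (hσ k).cont.comp_continuous hη hηI

/-- The sheets over the finitely many points of the central fiber partition the preimage of `V` into
finitely many relatively closed sets, so each of them is also relatively open. -/
theorem isOpen_fiber [T2Space Y] [Finite ι] (h : StarLift V p c η g) (hV : IsOpen V)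
    (hfin : ∀ q, (g ⁻¹' {q}).Finite) (z : Y) :
    IsOpen (fiber V c g z) := by
  have hpr : ∀ z, (prongs c g z).Finite := fun z =>
    (finite_iUnion fun a => hfin (c a (1 / 2))).subset fun y hy => mem_iUnion.2 hy.1
  have h1 : IsOpen {y : g ⁻¹' V | starRetr g c y.1 = z} := by
    have : {y : g ⁻¹' V | starRetr g c y.1 = z} =
        (⋃ w ∈ g ⁻¹' {p} \ {z}, {y : g ⁻¹' V | starRetr g c y.1 = w})ᶜ := by
      ext y
      simp only [mem_ofPred_eq, mem_compl_iff, mem_iUnion, not_exists]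
      refine ⟨fun he w hw h' => hw.2 (by rw [← h', he]; rfl), fun hn => ?_⟩
      by_contra hne
      exact hn _ ⟨h.map_retr y.2, hne⟩ rfl
    rw [this, isOpen_compl_iff]
    exact ((hfin p).subset sdiff_subset).isClosed_biUnion fun w hw => h.isClosed_fiber hw.1 (hpr w)
  convert (hV.preimage h.cont).isOpenMap_subtype_val _ h1 using 1
  ext y
  exact ⟨fun hy => ⟨⟨y, hy.1⟩, hy.2, rfl⟩, by rintro ⟨y, hy, rfl⟩; exact ⟨y.2, hy⟩⟩

end StarLift

end Sections

/-- A lift of a path converges at the start of the path, if the fiber there is finite. -/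
theorem exists_tendsto_lift {Y B : Type*} [MetricSpace Y] [CompactSpace Y] [TopologicalSpace B]
    [T2Space B] {g : Y → B} (hg : Continuous g) {γ : ℝ → B} (hγ : ContinuousOn γ (Ico 0 1))
    (hfin : (g ⁻¹' {γ 0}).Finite) {σ : ℝ → Y} (hσ : ContinuousOn σ (Ioo 0 1))
    (hmap : ∀ s ∈ Ioo (0 : ℝ) 1, g (σ s) = γ s) :
    ∃ z, g z = γ 0 ∧ Filter.Tendsto σ (𝓝[>] 0) (𝓝 z) := by
  have hγ0 : Filter.Tendsto γ (𝓝[>] 0) (𝓝 (γ 0)) := by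
    have := (hγ 0 StarLift.zero_mem).mono (Ioo_subset_Ico_self (a := (0 : ℝ)))
    rwa [ContinuousWithinAt, nhdsWithin_Ioo_eq_nhdsGT one_pos] at this
  obtain ⟨z, hz⟩ := exists_clusterPt_of_compactSpace (Filter.map σ (𝓝[>] (0 : ℝ)))
  have hev : ∀ᶠ s in 𝓝[>] (0 : ℝ), s ∈ Ioo (0 : ℝ) 1 := Ioo_mem_nhdsGT one_pos
  have hgz : g z = γ 0 := by
    have h1 : MapClusterPt (g z) (𝓝[>] (0 : ℝ)) (g ∘ σ) :=
      MapClusterPt.continuousAt_comp hg.continuousAt hz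
    have h2 : Filter.Tendsto (g ∘ σ) (𝓝[>] 0) (𝓝 (γ 0)) :=
      hγ0.congr' (hev.mono fun s hs => (hmap s hs).symm)
    have h3 : (𝓝 (g z) ⊓ 𝓝 (γ 0)).NeBot := Filter.NeBot.mono h1 (inf_le_inf_left _ h2)
    exact eq_of_nhds_neBot h3
  refine ⟨z, hgz, ?_⟩
  obtain ⟨ε₀, hε₀, hiso⟩ : ∃ ε₀ > 0, ∀ y ∈ g ⁻¹' {γ 0}, y ≠ z → ε₀ ≤ dist y z := by
    have h1 : ∀ᶠ y in 𝓝 z, y ∉ (g ⁻¹' {γ 0} \ {z}) :=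
      (hfin.subset sdiff_subset).isClosed.isOpen_compl.mem_nhds fun h => h.2 rfl
    obtain ⟨ε, hε, h2⟩ := Metric.eventually_nhds_iff.1 h1
    exact ⟨ε, hε, fun y hy hne => not_lt.1 fun hlt => h2 hlt ⟨hy, hne⟩⟩
  refine Metric.tendsto_nhds.2 fun ε hε => ?_
  let r := min (ε₀ / 2) ε
  have hr : 0 < r := lt_min (by linarith) hε
  -- The sphere around `z` misses the fiber over `γ 0`, so near the start the path avoids the
  -- compact image of the sphere. The lift cannot cross the sphere there, and it enters the ball
  -- because it clusters at `z`.
  have hS : γ 0 ∉ g '' Metric.sphere z r := by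
    rintro ⟨y, hy, he⟩
    rw [Metric.mem_sphere] at hy
    have h1 : y ≠ z := fun h => by rw [h, dist_self] at hy; exact hr.ne hy
    have h2 := hiso y he h1
    have : r ≤ ε₀ / 2 := min_le_left _ _
    linarith
  have hS' : IsClosed (g '' Metric.sphere z r) :=
    ((isCompact_sphere z r).image hg).isClosed
  have h1 : ∀ᶠ s in 𝓝[>] (0 : ℝ), γ s ∉ g '' Metric.sphere z r :=
    hγ0 (hS'.isOpen_compl.mem_nhds hS)
  obtain ⟨δ, hδ, h2⟩ := mem_nhdsGT_iff_exists_Ioo_subset.1 (Filter.inter_mem h1 hev)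
  have hδ' : (0 : ℝ) < δ := hδ
  have hne : ∀ s ∈ Ioo 0 δ, dist (σ s) z ≠ r := fun s hs he =>
    (h2 hs).1 ⟨σ s, he, hmap s (h2 hs).2⟩
  obtain ⟨s₀, hs₀, hlt⟩ : ∃ s₀ ∈ Ioo 0 δ, dist (σ s₀) z < r := by
    have h3 : ∃ᶠ s in 𝓝[>] (0 : ℝ), σ s ∈ Metric.ball z r :=
      (mapClusterPt_iff_frequently.1 hz) _ (Metric.ball_mem_nhds z hr)
    obtain ⟨s, h4, h5⟩ := (h3.and_eventually (Ioo_mem_nhdsGT hδ')).exists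
    exact ⟨s, h5, h4⟩
  filter_upwards [Ioo_mem_nhdsGT hδ'] with s hs
  refine lt_of_lt_of_le ?_ (min_le_right (ε₀ / 2) ε)
  by_contra hge
  have hc : ContinuousOn (fun s => dist (σ s) z) (Ioo 0 δ) :=
    (continuous_id.dist continuous_const).comp_continuousOn (hσ.mono fun s hs => (h2 hs).2)
  obtain ⟨s', hs', he⟩ := isPreconnected_Ioo.intermediate_value hs₀ hs hc ⟨hlt.le, not_lt.1 hge⟩
  exact hne s' hs' he

/-! ### Lifting prongs of standard star neighborhoods to deeper graphs and to `X`. -/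

namespace SplitSequence

variable {n : ℕ} {ζ : SplitSequence.{u} n}

theorem hasValence_two {j : ℕ} {z : ζ.G j} (hz : ¬ IsNatural z) : HasValence z 2 := by
  obtain ⟨m, hm, hv⟩ := (ζ.core j).valence z
  have : m = 2 := by
    by_contra hne
    exact hz ⟨m, by omega, hv⟩
  rwa [← this]

/-- Local injectivity sends the two prongs at `z` to two disjoint arcs at a point of valence two,
and as many arcs as prongs cover a neighborhood. -/
theorem image_mem_nhds {i j : ℕ} (hij : i ≤ j) {z : ζ.G j} (hz : ¬ IsNatural z)
    (hz' : ¬ IsNatural (ζ.map hij z)) {N : Set (ζ.G j)} (hN : N ∈ 𝓝 z) :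
    ζ.map hij '' N ∈ 𝓝 (ζ.map hij z) := by
  obtain ⟨U, hU, hinj⟩ := exists_injOn_map hij hz
  obtain ⟨r, l, hl⟩ := (hasValence_two hz).exists_prongs
  obtain ⟨r', l', hl'⟩ := (hasValence_two hz').exists_prongs
  have h1 := (ζ.continuous_map hij).continuousAt (x := z) (Metric.ball_mem_nhds _ hl'.pos)
  obtain ⟨ε₀, hε₀, hsub⟩ := Metric.mem_nhds_iff.1 (Filter.inter_mem (Filter.inter_mem hU hN) h1)
  have hs := hl.shrink (lt_min hε₀ hl.pos) (min_le_right _ _)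
  set ε := min ε₀ r
  have hm : ∀ k, ∀ t ∈ Ico 0 ε, l k t ∈ (U ∩ N) ∩ ζ.map hij ⁻¹' Metric.ball _ r' := fun k t ht =>
    hsub (by rw [Metric.mem_ball, hs.dist_center k ht]; exact ht.2.trans_le (min_le_left _ _))
  have hzU : z ∈ U := mem_of_mem_nhds hU
  obtain ⟨δ, hδ, hδ1, hcov⟩ := hl'.chart.arcs_cover (g := fun k t => ζ.map hij (l k t)) hs.pos
    (fun k => (ζ.continuous_map hij).comp_continuousOn <| by
      refine (LipschitzOnWith.of_dist_le_mul (K := 1) fun s h t h' => ?_).continuousOn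
      rw [hs.dist_same k s h t h', Real.dist_eq]; simp)
    (fun k => by rw [hl.zero]) (fun k t ht => (hm k t (Ioo_subset_Ico_self ht)).2)
    (fun k t ht he => by
      have := hinj (hm k t (Ioo_subset_Ico_self ht)).1.1 hzU he
      have h2 := hs.dist_center k (Ioo_subset_Ico_self ht)
      rw [this, dist_self] at h2; exact ht.1.ne h2)
    (fun k k' hk s hs' t ht he => hk (hs.inj hs' (Ioo_subset_Ico_self ht)
      (hinj (hm k s (Ioo_subset_Ico_self hs')).1.1 (hm k' t (Ioo_subset_Ico_self ht)).1.1 he)).1)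
    le_rfl
  filter_upwards [Metric.ball_mem_nhds _ (lt_min hl'.pos (mul_pos hl'.pos hδ))] with y hy
  by_cases hyz : y = ζ.map hij z
  · exact ⟨z, mem_of_mem_nhds hN, hyz.symm⟩
  · have h3 : dist y (ζ.map hij z) < r' * δ := (Metric.mem_ball.1 hy).trans_le (min_le_right _ _)
    obtain ⟨k, t, ht, he⟩ := hcov y ((Metric.mem_ball.1 hy).trans_le (min_le_left _ _)) hyz
      ((div_lt_iff₀ hl'.pos).2 (by rwa [mul_comm] at h3))
    exact ⟨_, (hm k t (Ioo_subset_Ico_self ht)).1.2, he⟩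

/-- Over a point that is not special, neither the point nor any of its preimages is natural, so the
map is locally injective and open. -/
theorem isLocalHomeomorphOn_map {i j : ℕ} (hij : i ≤ j) {O : Set (ζ.G i)} (hO : IsOpen O)
    (hs : ∀ q ∈ O, ¬ ζ.IsSpecial q) : IsLocalHomeomorphOn (ζ.map hij) (ζ.map hij ⁻¹' O) := by
  have hns : ∀ y, ζ.map hij y ∈ O → ¬ IsNatural y := fun y hy h =>
    hs _ hy ((IsSpecial.of_isNatural h).map hij)
  refine (isLocalHomeomorphOn_iff_isOpenEmbedding_restrict _).2 fun y hy => ?_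
  obtain ⟨U, hU, hinj⟩ := exists_injOn_map hij (hns y hy)
  obtain ⟨U', hsub, hU'o, hyU'⟩ := mem_nhds_iff.1
    (Filter.inter_mem hU ((hO.preimage (ζ.continuous_map hij)).mem_nhds hy))
  refine ⟨U', hU'o.mem_nhds hyU', .of_continuous_injective_isOpenMap
    ((ζ.continuous_map hij).comp continuous_subtype_val) ?_ ?_⟩
  · exact injOn_iff_injective.1 (hinj.mono fun x hx => (hsub hx).1)
  · intro A hA
    have hA' := hU'o.isOpenMap_subtype_val A hA
    have : U'.domRestrict (ζ.map hij) '' A = ζ.map hij '' (Subtype.val '' A) := by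
      rw [image_image]; rfl
    rw [this, isOpen_iff_mem_nhds]
    rintro _ ⟨x, hx, rfl⟩
    have hxU : x ∈ U' := by obtain ⟨w, -, rfl⟩ := hx; exact w.2
    have hxO := (hsub hxU).2
    exact image_mem_nhds hij (hns x hxO) (fun h => hs _ hxO (.of_isNatural h)) (hA'.mem_nhds hx)

variable {K m : ℕ} {V : Set (ζ.G K)} {p : ζ.G K} {c : Fin m → ℝ → ζ.G K} {η : ζ.G K → ℝ}

/-- Over an open prong the map is a local homeomorphism from a compact graph, thus a covering. The
open prong is parametrized by an interval, which is simply connected, so it lifts uniquely through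
each point. -/
theorem IsStandardStarNhd.starLift_map (hV : ζ.IsStandardStarNhd V p) (hc : IsStarChart V p c η)
    {j : ℕ} (hj : K ≤ j) : StarLift V p c η (ζ.map hj) := by
  have hO : ∀ a, IsOpen (c a '' Ioo 0 1) := fun a => by
    have := hc.isOpen_prong_image hV.1 a 0 1
    rwa [inter_self] at this
  have hns : ∀ a, ∀ q ∈ c a '' Ioo 0 1, ¬ ζ.IsSpecial q := by
    rintro a _ ⟨t, ht, rfl⟩
    exact hV.2.2 _ (hc.mem a (Ioo_subset_Ico_self ht)) (hc.σ_ne ht)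
  have hcov : ∀ a, IsCoveringMap ((c a '' Ioo 0 1).restrictPreimage (ζ.map hj)) := fun a =>
    (IsCoveringMapOn.of_isLocalHomeomorphOn (ζ.continuous_map hj)
      (isLocalHomeomorphOn_map hj (hO a) (hns a))).isCoveringMap_restrictPreimage
  have : SimplyConnectedSpace (Ioo (0 : ℝ) 1) := by
    have := (convex_Ioo (0 : ℝ) 1).contractibleSpace ⟨_, StarLift.half_mem⟩
    infer_instance
  have : LocallyPathConnectedSpace (Ioo (0 : ℝ) 1) := isOpen_Ioo.locallyPathConnectedSpace
  let γ : ∀ a, C(Ioo (0 : ℝ) 1, c a '' Ioo 0 1) := fun a =>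
    ⟨fun t => ⟨c a t, t, t.2, rfl⟩, Continuous.subtype_mk
      ((hc.cont a).comp_continuous continuous_subtype_val fun t => Ioo_subset_Ico_self t.2) _⟩
  refine ⟨hc, ζ.continuous_map hj, fun a t ht y hy => ?_, fun a σ σ' hσ hσ' t ht he => ?_⟩
  · have hyO : y ∈ ζ.map hj ⁻¹' (c a '' Ioo 0 1) := ⟨t, ht, hy.symm⟩
    obtain ⟨F, ⟨hF1, hF2⟩, -⟩ := (hcov a).existsUnique_continuousMap_lifts (γ a) ⟨t, ht⟩ ⟨y, hyO⟩
      (Subtype.ext hy)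
    classical
    let τ : ℝ → ζ.G j := fun s => if hs : s ∈ Ioo (0 : ℝ) 1 then (F ⟨s, hs⟩).1 else y
    have hτ : ∀ s (hs : s ∈ Ioo (0 : ℝ) 1), τ s = (F ⟨s, hs⟩).1 := fun s hs => dif_pos hs
    have hτc : ContinuousOn τ (Ioo 0 1) := by
      rw [continuousOn_iff_continuous_domRestrict]
      exact (continuous_subtype_val.comp F.continuous).congr fun s => (hτ s.1 s.2).symm
    have hτm : ∀ s ∈ Ioo (0 : ℝ) 1, ζ.map hj (τ s) = c a s := fun s hs => by
      rw [hτ s hs]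
      exact congrArg Subtype.val (congrFun hF2 ⟨s, hs⟩)
    -- Covering theory gives the lift only on the open interval. Its value at the start is the
    -- limit, which exists since the fiber over `p` is finite.
    obtain ⟨z, hz, hlim⟩ := exists_tendsto_lift (ζ.continuous_map hj) (hc.cont a)
      (ζ.finite_fiber hj _) hτc hτm
    have he : ∀ s, s ≠ 0 → Function.update τ 0 z s = τ s := fun s hs =>
      Function.update_of_ne hs _ _
    refine ⟨Function.update τ 0 z, ⟨fun s hs => ?_, fun s hs => ?_⟩, ?_⟩
    · rcases eq_or_lt_of_le hs.1 with h0 | h0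
      · subst h0
        have : Filter.Tendsto (Function.update τ 0 z) (𝓝[>] 0) (𝓝 z) :=
          hlim.congr' (Filter.Eventually.mono self_mem_nhdsWithin fun s hs =>
            (he s (ne_of_gt hs)).symm)
        have h2 : ContinuousWithinAt (Function.update τ 0 z) (Ioi 0) 0 := by
          rw [ContinuousWithinAt, Function.update_self]; exact this
        refine (continuousWithinAt_insert_self.2 h2).mono ?_
        rw [Ioi_insert]; exact Ico_subset_Ici_self
      · have h1 := (hτc s ⟨h0, hs.2⟩).continuousAt (Ioo_mem_nhds h0 hs.2)
        refine (h1.congr ?_).continuousWithinAt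
        filter_upwards [lt_mem_nhds h0] with s' hs'
        exact (he s' (ne_of_gt hs')).symm
    · rcases eq_or_lt_of_le hs.1 with h0 | h0
      · subst h0; rw [Function.update_self, hz]
      · rw [he s h0.ne', hτm s ⟨h0, hs.2⟩]
    · rw [he t ht.1.ne', hτ t ht, hF1]
  · have hl : ∀ {σ : ℝ → ζ.G j}, IsSection (ζ.map hj) (c a) σ → ∃ F : C(Ioo (0 : ℝ) 1,
        ζ.map hj ⁻¹' (c a '' Ioo 0 1)), ∀ s, (F s).1 = σ s := fun {σ} hσ =>
      ⟨⟨fun s => ⟨σ s, s, s.2, (hσ.map s (Ioo_subset_Ico_self s.2)).symm⟩, Continuous.subtype_mk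
        (hσ.cont.comp_continuous continuous_subtype_val fun t => Ioo_subset_Ico_self t.2) _⟩,
        fun s => rfl⟩
    obtain ⟨F, hF⟩ := hl hσ
    obtain ⟨F', hF'⟩ := hl hσ'
    have hlift : ∀ {σ : ℝ → ζ.G j} (hσ : IsSection (ζ.map hj) (c a) σ) {F : C(Ioo (0 : ℝ) 1,
        ζ.map hj ⁻¹' (c a '' Ioo 0 1))}, (∀ s, (F s).1 = σ s) →
        (c a '' Ioo 0 1).restrictPreimage (ζ.map hj) ∘ F = γ a := by
      intro σ hσ F hF
      funext s
      refine Subtype.ext ?_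
      show ζ.map hj (F s).1 = c a s
      rw [hF, hσ.map _ (Ioo_subset_Ico_self s.2)]
    have hu := ((hcov a).existsUnique_continuousMap_lifts (γ a) ⟨t, ht⟩ (F ⟨t, ht⟩)
      (congrFun (hlift hσ hF) ⟨t, ht⟩)).unique ⟨rfl, hlift hσ hF⟩
      ⟨Subtype.ext (by rw [hF, hF']; exact he.symm), hlift hσ' hF'⟩
    have h1 : EqOn σ σ' (Ioo 0 1) := fun s hs => by
      rw [← hF ⟨s, hs⟩, hu, hF']
    refine h1.of_subset_closure hσ.cont hσ'.cont Ioo_subset_Ico_self ?_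
    rw [closure_Ioo (by norm_num)]; exact Ico_subset_Icc_self

/-- Through the projections of a point of `X` there are unique lifts at all levels, and uniqueness
makes them compatible. Lifts exist only at levels at least `K`, whence the indices `max j K`. -/
theorem IsStandardStarNhd.starLift_proj (hV : ζ.IsStandardStarNhd V p)
    (hc : IsStarChart V p c η) : StarLift V p c η (ζ.proj K) := by
  have hL := fun j => hV.starLift_map hc (le_max_right j K)
  have down : ∀ {a : Fin m} {σ : ℝ → ζ.X} (_ : IsSection (ζ.proj K) (c a) σ) (j : ℕ),
      IsSection (ζ.map (le_max_right j K)) (c a) (fun s => ζ.proj (max j K) (σ s)) :=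
    fun hσ j => ⟨(continuous_proj _).comp_continuousOn hσ.cont, fun s hs => by
      rw [map_proj, hσ.map s hs]⟩
  refine ⟨hc, continuous_proj K, fun a t ht y hy => ?_, fun a σ σ' hσ hσ' t ht he s hs => ?_⟩
  · choose σ hσ hσt using fun j => (hL j).exists_section a t ht (ζ.proj (max j K) y)
      (by rw [map_proj, hy])
    have hcompat : ∀ i j (hij : max i K ≤ max j K), ∀ s ∈ Ico (0 : ℝ) 1,
        ζ.map hij (σ j s) = σ i s := by
      intro i j hij s hs
      refine (hL i).unique a (fun s => ζ.map hij (σ j s)) (σ i)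
        ⟨(ζ.continuous_map hij).comp_continuousOn (hσ j).cont, fun s hs => ?_⟩ (hσ i) t ht ?_ hs
      · rw [ζ.map_map, (hσ j).map s hs]
      · show ζ.map hij (σ j t) = _
        rw [hσt, hσt, map_proj]
    classical
    -- A lift is a function on all of `ℝ` with values in `X`, but the levels are compatible only on
    -- `[0, 1)`; outside it the parameter is sent to `0`.
    let cl : ℝ → ℝ := fun s => if s ∈ Ico (0 : ℝ) 1 then s else 0
    have hcl : ∀ s, cl s ∈ Ico (0 : ℝ) 1 := fun s => by
      by_cases h : s ∈ Ico (0 : ℝ) 1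
      · simp only [cl, if_pos h]; exact h
      · simp only [cl, if_neg h]; exact StarLift.zero_mem
    have hcl' : ∀ s ∈ Ico (0 : ℝ) 1, cl s = s := fun s hs => if_pos hs
    let τ : ℝ → ζ.X := fun s => ⟨fun i => ζ.map (le_max_left i K) (σ i (cl s)), fun i => by
      have h := hcompat i (i + 1) (max_le_max_right K (Nat.le_succ i)) _ (hcl s)
      show ζ.map _ (ζ.map _ (σ (i + 1) (cl s))) = ζ.map _ (σ i (cl s))
      rw [← h, ζ.map_map, ζ.map_map]⟩
    have hτ : ∀ s ∈ Ico (0 : ℝ) 1, ∀ i, ζ.proj i (τ s) = ζ.map (le_max_left i K) (σ i s) :=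
      fun s hs i => by
        show ζ.map (le_max_left i K) (σ i (cl s)) = _
        rw [hcl' s hs]
    refine ⟨τ, ⟨?_, fun s hs => ?_⟩, ?_⟩
    · rw [continuousOn_iff_continuous_domRestrict]
      refine Continuous.subtype_mk (continuous_pi fun i => ?_) _
      exact (continuousOn_iff_continuous_domRestrict.1
        ((ζ.continuous_map (le_max_left i K)).comp_continuousOn (hσ i).cont)).congr
        fun s => (hτ s s.2 i).symm
    · rw [hτ s hs K, ← (hσ K).map s hs]
    · refine X.ext 0 fun i _ => ?_
      rw [hτ t (Ioo_subset_Ico_self ht) i, hσt, map_proj]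
  · refine X.ext 0 fun j _ => ?_
    have := (hL j).unique a _ _ (down hσ j) (down hσ' j) t ht (by simp only [he]) hs
    have h2 := congrArg (ζ.map (le_max_left j K)) this
    simpa only [map_proj] using h2

end SplitSequence

/-! ### Turns of stars, and naturality of the retraction. -/

/-- The union of the center and two open prongs of a star chart. -/
def turnSet {Y ι : Type*} (z : Y) (σ : ι → ℝ → Y) (a b : ι) : Set Y :=
  {y | y = z ∨ ∃ t ∈ Ioo (0 : ℝ) 1, y = σ a t ∨ y = σ b t}

theorem turnSet_of_homeo {Y : Type*} [TopologicalSpace Y] {S : Set Y} {z : Y} {n : ℕ}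
    (e : ModelStar n ≃ₜ S) (hz : (e (ModelStar.center n) : Y) = z) (a b : Fin n) :
    turnSet z (fun j t => (e (ModelStar.ray j t) : Y)) a b =
      {y | ∃ v : ModelStar n, (∀ k, k ≠ a → k ≠ b → v.1 k = 0) ∧ (e v : Y) = y} := by
  ext y
  constructor
  · rintro (rfl | ⟨t, ht, rfl | rfl⟩)
    · exact ⟨_, fun _ _ _ => rfl, hz⟩
    · refine ⟨_, fun k hk _ => ?_, rfl⟩
      rw [ModelStar.ray_apply a (Ioo_subset_Ico_self ht), Pi.single_eq_of_ne hk]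
    · refine ⟨_, fun k _ hk => ?_, rfl⟩
      rw [ModelStar.ray_apply b (Ioo_subset_Ico_self ht), Pi.single_eq_of_ne hk]
  · rintro ⟨v, hv, rfl⟩
    rcases v.eq_center_or with rfl | ⟨j, hj⟩
    · exact Or.inl hz
    · refine Or.inr ⟨v.1 j, ⟨hj, (v.2.1 j).2⟩, ?_⟩
      have hr := (v.eq_ray j hj.ne').1
      by_cases hja : j = a
      · left; rw [← hja]; exact congrArg (fun v => (e v : Y)) hr
      · by_cases hjb : j = b
        · right; rw [← hjb]; exact congrArg (fun v => (e v : Y)) hr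
        · exact absurd (hv j hja hjb) hj.ne'

theorem IsStarChart.isTurnOf {Y ι : Type*} [TopologicalSpace Y] [T2Space Y] [Finite ι] {S : Set Y}
    {z : Y} {σ : ι → ℝ → Y} {η : Y → ℝ} (h : IsStarChart S z σ η) {a b : ι} (hab : a ≠ b) :
    IsTurnOf S z (turnSet z σ a b) := by
  let e := Finite.equivFin ι
  have hr := h.reindex e.symm
  obtain ⟨φ, h0, hφ⟩ := hr.exists_homeo
  have hab' : e a ≠ e b := fun he => hab (e.injective he)
  refine ⟨_, ?_, φ, h0, e a, e b, hab', ?_⟩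
  · have : Nontrivial ι := ⟨a, b, hab⟩
    exact Finite.one_lt_card
  · rw [← turnSet_of_homeo φ h0]
    ext y
    refine or_congr_right (exists_congr fun t => and_congr_right fun ht => ?_)
    have hI := Ioo_subset_Ico_self ht
    simp only [hφ _ _ hI, Function.comp_apply, Equiv.symm_apply_apply]

theorem IsTurnOf.exists_chart {Y : Type*} [TopologicalSpace Y] {S I : Set Y} {z : Y}
    (h : IsTurnOf S z I) : ∃ (n : ℕ) (σ : Fin n → ℝ → Y) (η : Y → ℝ), IsStarChart S z σ η ∧
      ∃ a b, a ≠ b ∧ I = turnSet z σ a b := by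
  obtain ⟨n, -, e, he, a, b, hab, rfl⟩ := h
  obtain ⟨η, h1, -⟩ := IsStarChart.of_homeo e he
  exact ⟨n, _, η, h1, a, b, hab, (turnSet_of_homeo e he a b).symm⟩

namespace StarLift

variable {Y Y' B : Type*} [TopologicalSpace Y] [TopologicalSpace Y'] [TopologicalSpace B]
  {ι : Type*} {V : Set B} {p : B} {c : ι → ℝ → B} {η : B → ℝ} {g : Y → B} {g' : Y' → B} {π : Y → Y'}

theorem comp_section (hπ : Continuous π) (hg : ∀ y, g' (π y) = g y) {γ : ℝ → B} {σ : ℝ → Y}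
    (hσ : IsSection g γ σ) : IsSection g' γ (fun s => π (σ s)) :=
  ⟨hπ.comp_continuousOn hσ.cont, fun s hs => by rw [hg, hσ.map s hs]⟩

/-- A map over `B` carries lifted prongs to lifted prongs, hence commutes with sliding to their
starts. -/
theorem retr_comp (h : StarLift V p c η g) (h' : StarLift V p c η g') (hπ : Continuous π)
    (hg : ∀ y, g' (π y) = g y) {y : Y} (hy : g y ∈ V) :
    π (starRetr g c y) = starRetr g' c (π y) := by
  by_cases hp : g y = p
  · rw [h.retr_fiber hp, h'.retr_fiber (by rw [hg, hp])]
  · obtain ⟨h1, a, σ, hσ, h2⟩ := h.exists_of_ne hy hp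
    have h3 := Ioo_subset_Ico_self h1
    have h4 := h'.retr_section (comp_section hπ hg hσ) h3
    rw [h2] at h4
    rw [h4, ← h2, h.retr_section hσ h3]

theorem mem_of_half (h : StarLift V p c η g) {a : ι} {y : Y} (hy : g y = c a (1 / 2)) :
    g y ∈ V := by
  rw [hy]; exact h.chart.mem a (Ioo_subset_Ico_self half_mem)

theorem map_mem_prongs (h : StarLift V p c η g) (h' : StarLift V p c η g') (hπ : Continuous π)
    (hg : ∀ y, g' (π y) = g y) {y z : Y} (hy : y ∈ prongs c g z) : π y ∈ prongs c g' (π z) := by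
  obtain ⟨⟨a, ha⟩, rfl⟩ := hy
  exact ⟨⟨a, by rw [hg, ha]⟩, (h.retr_comp h' hπ hg (h.mem_of_half ha)).symm⟩

/-- The prongs of the star `V` over which there is a lifted prong starting at `z`. -/
def ends (c : ι → ℝ → B) (g : Y → B) (z : Y) : Set ι :=
  {a | ∃ y, g y = c a (1 / 2) ∧ starRetr g c y = z}

theorem ends_subset (h : StarLift V p c η g) (h' : StarLift V p c η g') (hπ : Continuous π)
    (hg : ∀ y, g' (π y) = g y) (z : Y) : ends c g z ⊆ ends c g' (π z) := by
  rintro a ⟨y, ha, rfl⟩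
  exact ⟨π y, by rw [hg, ha], (h.retr_comp h' hπ hg (h.mem_of_half ha)).symm⟩

theorem finite_prongs [Finite ι] (hfin : ∀ q, (g ⁻¹' {q}).Finite) (z : Y) :
    (prongs c g z).Finite :=
  (finite_iUnion fun a => hfin (c a (1 / 2))).subset fun _ hy => mem_iUnion.2 hy.1

end StarLift

/-! ### Prongs of sheets: counting them and keeping them apart. -/

namespace SplitSequence

open StarLift

variable {n : ℕ} {ζ : SplitSequence.{u} n}
variable {K m : ℕ} {V : Set (ζ.G K)} {p : ζ.G K} {c : Fin m → ℝ → ζ.G K} {η : ζ.G K → ℝ}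

section Level

variable {j : ℕ} {hj : K ≤ j}

/-- The sheet of `w` and a star ball at `w` are both open stars centered at `w`, so each has at most
as many prongs as the other. -/
theorem IsStandardStarNhd.card_prongs (hV : ζ.IsStandardStarNhd V p) (hc : IsStarChart V p c η)
    {w : ζ.G j} (hw : ζ.map hj w = p) {k : ℕ} (hk : HasValence w k) :
    Nat.card (prongs c (ζ.map hj) w) = k := by
  have hL := hV.starLift_map hc hj
  have hfin := finite_prongs (c := c) (ζ.finite_fiber hj) w
  have := hfin.to_subtype
  obtain ⟨a, σ, hσ, -, hF⟩ := hL.exists_fiber_chart hw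
  obtain ⟨r, l, hl⟩ := hk.exists_prongs
  have hopen := hL.isOpen_fiber hV.1 (ζ.finite_fiber hj) w
  have h1 := (hF.card_le hl.chart (mem_nhdsWithin_of_mem_nhds (Metric.ball_mem_nhds w hl.pos))).1
  have h2 := (hl.chart.card_le hF
    (mem_nhdsWithin_of_mem_nhds (hopen.mem_nhds (hL.mem_fiber_self hw)))).1
  rw [Nat.card_fin] at h1 h2
  exact le_antisymm h1 h2

theorem IsStandardStarNhd.two_le_card_prongs (hV : ζ.IsStandardStarNhd V p)
    (hc : IsStarChart V p c η) {w : ζ.G j} (hw : ζ.map hj w = p) :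
    2 ≤ Nat.card (prongs c (ζ.map hj) w) := by
  obtain ⟨k, hk, hv⟩ := (ζ.core j).valence w
  rwa [hV.card_prongs hc hw hv]

theorem IsStandardStarNhd.isNatural_iff (hV : ζ.IsStandardStarNhd V p)
    (hc : IsStarChart V p c η) {w : ζ.G j} (hw : ζ.map hj w = p) :
    IsNatural w ↔ 2 < Nat.card (prongs c (ζ.map hj) w) := by
  constructor
  · rintro ⟨k, hk, hv⟩
    rwa [hV.card_prongs hc hw hv]
  · intro h
    obtain ⟨k, -, hv⟩ := (ζ.core j).valence w
    rw [hV.card_prongs hc hw hv] at h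
    exact ⟨k, h, hv⟩

/-- The map is injective near `w`, so two lifts of one prong starting at `w` coincide near the start
and hence everywhere. -/
theorem IsStandardStarNhd.injOn_prongs (hV : ζ.IsStandardStarNhd V p)
    (hc : IsStarChart V p c η) {w : ζ.G j} (hw : ¬ IsNatural w) :
    InjOn (ζ.map hj) (prongs c (ζ.map hj) w) := by
  have hL := hV.starLift_map hc hj
  intro y hy y' hy' he
  obtain ⟨a, σ, hσ, h0, rfl⟩ := hL.exists_section_prong hy
  obtain ⟨a', σ', hσ', h0', rfl⟩ := hL.exists_section_prong hy'
  have hI := Ioo_subset_Ico_self half_mem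
  have he' := he
  rw [hσ.map _ hI, hσ'.map _ hI] at he'
  obtain rfl := hc.disj _ _ _ half_mem he'
  obtain ⟨U, hU, hinj⟩ := exists_injOn_map hj hw
  have hlim : ∀ {τ : ℝ → ζ.G j}, IsSection (ζ.map hj) (c a) τ → τ 0 = w →
      ∀ᶠ s in 𝓝[>] (0 : ℝ), τ s ∈ U := by
    intro τ hτ hτ0
    have := (hτ.cont 0 zero_mem).mono (Ioo_subset_Ico_self (a := (0 : ℝ)))
    rw [ContinuousWithinAt, nhdsWithin_Ioo_eq_nhdsGT one_pos, hτ0] at this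
    exact this hU
  obtain ⟨s, ⟨h1, h2⟩, hs⟩ := (((hlim hσ h0).and (hlim hσ' h0')).and
    (Ioo_mem_nhdsGT (one_pos (α := ℝ)))).exists
  have hs' := Ioo_subset_Ico_self hs
  exact hL.unique a σ σ' hσ hσ' s hs
    (hinj h1 h2 (by rw [hσ.map s hs', hσ'.map s hs'])) hI

/-- At least two prongs start at `w`, and by local injectivity they lie over different prongs of
`V`. -/
theorem IsStandardStarNhd.nontrivial_ends_of_not_isNatural (hV : ζ.IsStandardStarNhd V p)
    (hc : IsStarChart V p c η) {w : ζ.G j} (hp : ζ.map hj w = p) (hw : ¬ IsNatural w) :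
    (ends c (ζ.map hj) w).Nontrivial := by
  have h2 := hV.two_le_card_prongs hc hp
  have := (finite_prongs (c := c) (ζ.finite_fiber hj) w).to_subtype
  obtain ⟨⟨y, hy⟩, ⟨y', hy'⟩, hne⟩ := (Finite.one_lt_card_iff_nontrivial.1 h2)
  obtain ⟨a, ha⟩ := hy.1
  obtain ⟨b, hb⟩ := hy'.1
  refine ⟨a, ⟨y, ha, hy.2⟩, b, ⟨y', hb, hy'.2⟩, ?_⟩
  rintro rfl
  exact hne (Subtype.ext (hV.injOn_prongs hc hw hy hy' (ha.trans hb.symm)))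

theorem IsStandardStarNhd.not_isNatural (hV : ζ.IsStandardStarNhd V p) {y : ζ.G j}
    (hy : ζ.map hj y ∈ V) (hne : ζ.map hj y ≠ p) : ¬ IsNatural y := fun h =>
  hV.2.2 _ hy hne ((IsSpecial.of_isNatural h).map hj)

/-- The sheet of `V` over a point of the fiber of its center is a standard star neighborhood. -/
theorem IsStandardStarNhd.fiber (hV : ζ.IsStandardStarNhd V p) (hc : IsStarChart V p c η)
    {w : ζ.G j} (hw : ζ.map hj w = p) : ζ.IsStandardStarNhd (fiber V c (ζ.map hj) w) w := by
  have hL := hV.starLift_map hc hj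
  have := (finite_prongs (c := c) (ζ.finite_fiber hj) w).to_subtype
  obtain ⟨a, σ, hσ, -, hF⟩ := hL.exists_fiber_chart hw
  refine ⟨hL.isOpen_fiber hV.1 (ζ.finite_fiber hj) w,
    ⟨Nat.card (prongs c (ζ.map hj) w), ?_⟩, fun q hq hqw hs => ?_⟩
  · exact (hF.reindex (Finite.equivFin _).symm).isStarSet (hV.two_le_card_prongs hc hw)
  · refine hV.2.2 _ hq.1 (fun he => hqw ?_) (hs.map hj)
    rw [← hq.2, hL.retr_fiber he]

end Level

theorem IsStandardStarNhd.proj_retr (hV : ζ.IsStandardStarNhd V p) (hc : IsStarChart V p c η)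
    {j : ℕ} (hj : K ≤ j) {x : ζ.X} (hx : ζ.proj K x ∈ V) :
    ζ.proj j (starRetr (ζ.proj K) c x) = starRetr (ζ.map hj) c (ζ.proj j x) :=
  (hV.starLift_proj hc).retr_comp (hV.starLift_map hc hj) (continuous_proj j) (map_proj hj) hx

theorem IsStandardStarNhd.proj_mem_prongs (hV : ζ.IsStandardStarNhd V p)
    (hc : IsStarChart V p c η) {j : ℕ} (hj : K ≤ j) {x z : ζ.X} (hx : x ∈ prongs c (ζ.proj K) z) :
    ζ.proj j x ∈ prongs c (ζ.map hj) (ζ.proj j z) :=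
  (hV.starLift_proj hc).map_mem_prongs (hV.starLift_map hc hj) (continuous_proj j) (map_proj hj) hx

theorem IsStandardStarNhd.ends_subset_ends (hV : ζ.IsStandardStarNhd V p)
    (hc : IsStarChart V p c η) {i j : ℕ} (hi : K ≤ i) (hij : i ≤ j) (w : ζ.G j) :
    ends c (ζ.map (hi.trans hij)) w ⊆ ends c (ζ.map hi) (ζ.map hij w) :=
  (hV.starLift_map hc _).ends_subset (hV.starLift_map hc hi) (ζ.continuous_map hij)
    (fun _ => ζ.map_map _ _ _) w

theorem IsStandardStarNhd.ends_subset_proj (hV : ζ.IsStandardStarNhd V p)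
    (hc : IsStarChart V p c η) {j : ℕ} (hj : K ≤ j) (z : ζ.X) :
    ends c (ζ.proj K) z ⊆ ends c (ζ.map hj) (ζ.proj j z) :=
  (hV.starLift_proj hc).ends_subset (hV.starLift_map hc hj) (continuous_proj j) (map_proj hj) z

/-- Two lifted prongs with the same image at some level cannot be joined by a third. -/
theorem IsStandardStarNhd.prongs_separate (hst : ζ.IsStabilized) (hV : ζ.IsStandardStarNhd V p)
    (hc : IsStarChart V p c η) {k : ℕ} (hk : K ≤ k) {z α β γ : ζ.X}
    (hz : ζ.proj K z = p) (hα : α ∈ prongs c (ζ.proj K) z) (hβ : β ∈ prongs c (ζ.proj K) z)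
    (hγ : γ ∈ prongs c (ζ.proj K) z) (hαβ : ζ.proj k α = ζ.proj k β)
    (hαγ : ζ.proj k α ≠ ζ.proj k γ) : α = β := by
  by_contra hne
  have hL := hV.starLift_proj hc
  have hLk := hV.starLift_map hc hk
  have hzk : ζ.map hk (ζ.proj k z) = p := by rw [map_proj, hz]
  obtain ⟨a₁, σ₁, hσ₁, h01, h1⟩ := hL.exists_section_prong hα
  obtain ⟨a₂, σ₂, hσ₂, h02, h2⟩ := hL.exists_section_prong hβ
  obtain ⟨a₃, σ₃, hσ₃, h03, h3⟩ := hL.exists_section_prong hγ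
  have hne' : α ≠ γ := fun h => hαγ (by rw [h])
  have hne'' : β ≠ γ := fun h => hαγ (by rw [hαβ, h])
  -- The three lifts form a `3`-pronged star of `X` centered at `z`.
  have hU := (hL.isStarChart hz (κ := Fin 3) (a := ![a₁, a₂, a₃]) (σ := ![σ₁, σ₂, σ₃])
    (by intro i; fin_cases i; exacts [hσ₁, hσ₂, hσ₃])
    (by intro i; fin_cases i; exacts [h01, h02, h03])
    (by
      have h : ∀ i, (![σ₁, σ₂, σ₃] : Fin 3 → ℝ → ζ.X) i (1 / 2) = ![α, β, γ] i := by
        intro i; fin_cases i; exacts [h1, h2, h3]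
      intro i i' he
      rw [h, h] at he
      fin_cases i <;> fin_cases i' <;> simp_all))
  have := (finite_prongs (c := c) (ζ.finite_fiber hk) (ζ.proj k z)).to_subtype
  obtain ⟨a, τ, hτ, hτh, hF⟩ := hLk.exists_fiber_chart hzk
  let A : prongs c (ζ.map hk) (ζ.proj k z) := ⟨_, hV.proj_mem_prongs hc hk hα⟩
  let C : prongs c (ζ.map hk) (ζ.proj k z) := ⟨_, hV.proj_mem_prongs hc hk hγ⟩
  have hAC : A ≠ C := fun h => hαγ (congrArg Subtype.val h)
  have key : ∀ {b : Fin m} {σ : ℝ → ζ.X} (_ : IsSection (ζ.proj K) (c b) σ)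
      (D : prongs c (ζ.map hk) (ζ.proj k z)), ζ.proj k (σ (1 / 2)) = D →
      ∀ t ∈ Ioo (0 : ℝ) 1, ζ.proj k (σ t) = τ D t := by
    intro b σ hσ D hD t ht
    have h4 := comp_section (continuous_proj k) (map_proj hk) hσ
    have hI := Ioo_subset_Ico_self half_mem
    have h5 : c b (1 / 2) = c (a D) (1 / 2) := by
      rw [← h4.map _ hI, ← (hτ D).map _ hI, hτh, hD]
    rw [hc.disj _ _ _ half_mem h5] at h4
    exact hLk.unique _ _ _ h4 (hτ D) _ half_mem (by rw [hτh]; exact hD) (Ioo_subset_Ico_self ht)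
  -- At level `k` the first two prongs merge and the third stays apart, so the star projects onto a
  -- turn of the sheet of `z` at level `k`, which is itself a standard star neighborhood.
  refine hst.no_three_star k _ ⟨_, _, hV.fiber hc hzk, hF.isTurnOf hAC⟩
    ⟨_, z, hU.isStarSet (by norm_num), ?_⟩
  ext y
  constructor
  · rintro ⟨x, hx | ⟨i, t, ht, hx⟩, rfl⟩
    · left; rw [hx]
    · refine Or.inr ⟨t, ht, ?_⟩
      rw [hx]
      fin_cases i
      · exact Or.inl (key hσ₁ A (by rw [h1]) t ht)
      · exact Or.inl (key hσ₂ A (by rw [h2, ← hαβ]) t ht)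
      · exact Or.inr (key hσ₃ C (by rw [h3]) t ht)
  · rintro (rfl | ⟨t, ht, rfl | rfl⟩)
    · exact ⟨z, Or.inl rfl, rfl⟩
    · exact ⟨σ₁ t, Or.inr ⟨0, t, ht, rfl⟩, key hσ₁ A (by rw [h1]) t ht⟩
    · exact ⟨σ₃ t, Or.inr ⟨2, t, ht, rfl⟩, key hσ₃ C (by rw [h3]) t ht⟩

theorem eventually_proj_ne {x y : ζ.X} (h : x ≠ y) : ∃ N, ∀ j, N ≤ j → ζ.proj j x ≠ ζ.proj j y := by
  by_contra! hcon
  refine h (X.ext 0 fun i _ => ?_)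
  obtain ⟨j, hj, he⟩ := hcon i
  rw [← map_proj hj, he, map_proj]

/-- Three distinct lifted prongs with the same start lie over distinct prongs. -/
theorem IsStandardStarNhd.three_prongs (hst : ζ.IsStabilized) (hV : ζ.IsStandardStarNhd V p)
    (hc : IsStarChart V p c η) {z α β γ : ζ.X} (hz : ζ.proj K z = p)
    (hα : α ∈ prongs c (ζ.proj K) z) (hβ : β ∈ prongs c (ζ.proj K) z)
    (hγ : γ ∈ prongs c (ζ.proj K) z) (hαβ : α ≠ β) (hαγ : α ≠ γ) (hβγ : β ≠ γ) :
    ζ.proj K α ≠ ζ.proj K β := by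
  obtain ⟨N₁, h1⟩ := eventually_proj_ne hαβ
  obtain ⟨N₂, h2⟩ := eventually_proj_ne hαγ
  obtain ⟨N₃, h3⟩ := eventually_proj_ne hβγ
  have nn : ∀ k, ¬ IsNatural (ζ.proj (K + k) β) := fun k => by
    obtain ⟨⟨a, ha⟩, -⟩ := hβ
    refine hV.not_isNatural (hj := Nat.le_add_right K k) ?_ ?_
    · rw [map_proj, ha]; exact hc.mem a (Ioo_subset_Ico_self half_mem)
    · rw [map_proj, ha]; exact hc.σ_ne half_mem
  -- Distinctness is pulled from one level to the preceding one. A merger of exactly two is excluded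
  -- by `prongs_separate`, and a merger of all three because a fold is at most two-to-one off the
  -- natural vertices. It starts at a level deep enough to distinguish the three points.
  have step : ∀ k, (ζ.proj (K + (k + 1)) α ≠ ζ.proj (K + (k + 1)) β ∧
      ζ.proj (K + (k + 1)) α ≠ ζ.proj (K + (k + 1)) γ ∧
      ζ.proj (K + (k + 1)) β ≠ ζ.proj (K + (k + 1)) γ) → (ζ.proj (K + k) α ≠ ζ.proj (K + k) β ∧
      ζ.proj (K + k) α ≠ ζ.proj (K + k) γ ∧ ζ.proj (K + k) β ≠ ζ.proj (K + k) γ) := by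
    rintro k ⟨d1, d2, d3⟩
    have hk : K ≤ K + k := Nat.le_add_right K k
    have hno : ¬ (ζ.proj (K + k) α = ζ.proj (K + k) β ∧ ζ.proj (K + k) β = ζ.proj (K + k) γ) := by
      rintro ⟨e1, e2⟩
      rw [← map_proj (Nat.le_succ (K + k)) α, ← map_proj (Nat.le_succ (K + k)) β] at e1
      rw [← map_proj (Nat.le_succ (K + k)) β, ← map_proj (Nat.le_succ (K + k)) γ] at e2
      rcases (ζ.fold (K + k)).eq_of_three (nn (k + 1)) e1 e2 with h | h | h
      exacts [d1 h, d3 h, d2 h]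
    refine ⟨fun e => ?_, fun e => ?_, fun e => ?_⟩
    · exact hαβ (hV.prongs_separate hst hc hk hz hα hβ hγ e fun e' => hno ⟨e, e ▸ e'⟩)
    · exact hαγ (hV.prongs_separate hst hc hk hz hα hγ hβ e fun e' => hno ⟨e', e' ▸ e⟩)
    · exact hβγ (hV.prongs_separate hst hc hk hz hβ hγ hα e fun e' => hno ⟨e'.symm, e⟩)
  have hN : ∀ N, (ζ.proj (K + N) α ≠ ζ.proj (K + N) β ∧ ζ.proj (K + N) α ≠ ζ.proj (K + N) γ ∧
      ζ.proj (K + N) β ≠ ζ.proj (K + N) γ) → ζ.proj K α ≠ ζ.proj K β := by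
    intro N
    induction N with
    | zero => exact fun h => h.1
    | succ N ih => exact fun h => ih (step N h)
  exact hN (N₁ + N₂ + N₃) ⟨h1 _ (by omega), h2 _ (by omega), h3 _ (by omega)⟩

end SplitSequence

namespace IsStarChart

variable {Y : Type*} [TopologicalSpace Y] [T2Space Y] {ι κ : Type*} [Finite ι] [Finite κ]
  {S S' : Set Y} {z z' : Y} {σ : ι → ℝ → Y} {σ' : κ → ℝ → Y} {η η' : Y → ℝ}

theorem prong_mem_nhdsWithin (h : IsStarChart S z σ η) (j : ι) {t a b : ℝ}
    (ht : t ∈ Ioo (0 : ℝ) 1) (hab : t ∈ Ioo a b) :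
    σ j '' (Ioo 0 1 ∩ Ioo a b) ∈ 𝓝[S] (σ j t) := by
  have htS := h.mem j (Ioo_subset_Ico_self ht)
  have h1 : {y : S | y.1 ≠ z ∧ y.1 = σ j (η y.1)} ∈ 𝓝 (⟨σ j t, htS⟩ : S) :=
    (h.isOpen_prong j).mem_nhds ⟨h.σ_ne ht, by rw [h.ησ j t (Ioo_subset_Ico_self ht)]⟩
  rw [mem_nhds_subtype_iff_nhdsWithin] at h1
  have h2 := h.contη _ htS
  rw [ContinuousWithinAt, h.ησ j t (Ioo_subset_Ico_self ht)] at h2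
  filter_upwards [h1, h2 (Ioo_mem_nhds hab.1 hab.2), self_mem_nhdsWithin] with y hy hy' hyS
  obtain ⟨y, ⟨h3, h4⟩, rfl⟩ := hy
  exact ⟨_, ⟨(h.eq_σ hyS h3).1, hy'⟩, h4.symm⟩

/-- A star centered off the center of another star has at most two prongs. -/
theorem card_le_two (h : IsStarChart S z σ η) (h' : IsStarChart S' z' σ' η') (hz : z' ∈ S)
    (hne : z' ≠ z) (hS : S ∈ 𝓝[S'] z') : Nat.card κ ≤ 2 := by
  obtain ⟨ht, j, hj⟩ := h.eq_σ hz hne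
  set t := η z'
  have hδ : 0 < min t (1 - t) := lt_min ht.1 (by linarith [ht.2])
  have hc := h.interior j ht hδ (min_le_left _ _) (min_le_right _ _)
  have hn := h.prong_mem_nhdsWithin j ht (a := t - min t (1 - t)) (b := t + min t (1 - t))
    ⟨by linarith, by linarith⟩
  rw [← hj] at hc hn
  have h1 : σ j '' Ioo (t - min t (1 - t)) (t + min t (1 - t)) ∈ 𝓝[S'] z' := by
    have h2 : 𝓝[S'] z' ≤ 𝓝[S] z' := by
      rw [← nhdsWithin_inter_of_mem hS]; exact nhdsWithin_mono _ inter_subset_left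
    exact Filter.mem_of_superset (h2 hn) (image_mono inter_subset_right)
  have := (h'.card_le hc h1).1
  rwa [Nat.card_fin] at this

/-- Small substars are path connected. This places any star set, near its center, inside the plaque
of the center and so allows prong counts to be compared. -/
theorem pathComponentIn_mem_nhdsWithin (h : IsStarChart S z σ η) {N : Set Y} (hN : N ∈ 𝓝[S] z) :
    pathComponentIn N z ∈ 𝓝[S] z := by
  obtain ⟨ε, hε, hε1, hsm⟩ := h.exists_small hN
  have hc := h.shrink hε hε1
  have hsub : {y ∈ S | η y < ε} ⊆ N := by
    rintro y ⟨hy, hlt⟩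
    rcases (h.mem_iff y).1 hy with rfl | ⟨j, t, ht, rfl⟩
    · exact mem_of_mem_nhdsWithin h.center_mem hN
    · rw [h.ησ j t (Ioo_subset_Ico_self ht)] at hlt
      exact hsm j t ⟨ht.1.le, hlt⟩
  have hη := h.contη z h.center_mem
  rw [ContinuousWithinAt, h.ηz] at hη
  filter_upwards [hη (gt_mem_nhds hε), self_mem_nhdsWithin] with y hy hyS
  exact hc.isPathConnected.subset_pathComponentIn hc.center_mem hsub ⟨hyS, hy⟩

end IsStarChart

/-! ### Plaques of standard neighborhoods are stars. -/

namespace SplitSequence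

open StarLift

variable {n : ℕ} {ζ : SplitSequence.{u} n}
variable {K m : ℕ} {V : Set (ζ.G K)} {p : ζ.G K} {c : Fin m → ℝ → ζ.G K} {η : ζ.G K → ℝ}

/-- At each level the midpoints of lifts of prong `a` starting at the projection of `z` form a
finite set. Their preimages are nested, closed and nonempty in the compact space `X`. -/
theorem IsStandardStarNhd.mem_ends_iff (hV : ζ.IsStandardStarNhd V p) (hc : IsStarChart V p c η)
    (z : ζ.X) (a : Fin m) :
    a ∈ ends c (ζ.proj K) z ↔ ∀ (j : ℕ) (hj : K ≤ j), a ∈ ends c (ζ.map hj) (ζ.proj j z) := by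
  refine ⟨fun h j hj => hV.ends_subset_proj hc hj z h, fun h => ?_⟩
  have hhalf : ∀ {x : ζ.X}, ζ.proj K x = c a (1 / 2) → ζ.proj K x ∈ V := fun hx => by
    rw [hx]; exact hc.mem a (Ioo_subset_Ico_self half_mem)
  let F : ∀ i, Set (ζ.G (K + i)) := fun i => {y | ζ.map (Nat.le_add_right K i) y = c a (1 / 2) ∧
    starRetr (ζ.map (Nat.le_add_right K i)) c y = ζ.proj (K + i) z}
  have hcl : ∀ i, IsClosed (ζ.proj (K + i) ⁻¹' F i) := fun i =>
    ((ζ.finite_fiber (Nat.le_add_right K i) (c a (1 / 2))).subset fun y hy => hy.1).isClosed.preimage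
      (continuous_proj _)
  have hdec : ∀ i, ζ.proj (K + (i + 1)) ⁻¹' F (i + 1) ⊆ ζ.proj (K + i) ⁻¹' F i := by
    rintro i x ⟨h1, h2⟩
    rw [map_proj] at h1
    refine ⟨by rw [map_proj, h1], ?_⟩
    rw [← hV.proj_retr hc _ (hhalf h1)] at h2 ⊢
    have := congrArg (ζ.map (Nat.le_succ (K + i))) h2
    exact (map_proj _ _).symm.trans (this.trans (map_proj _ _))
  have hne : ∀ i, (ζ.proj (K + i) ⁻¹' F i).Nonempty := fun i => by
    obtain ⟨y, hy⟩ := h _ (Nat.le_add_right K i)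
    obtain ⟨x, rfl⟩ := proj_surjective _ y
    exact ⟨x, hy⟩
  obtain ⟨x, hx⟩ := IsCompact.nonempty_iInter_of_sequence_nonempty_isCompact_isClosed
    (fun i => ζ.proj (K + i) ⁻¹' F i) hdec hne (hcl 0).isCompact hcl
  rw [mem_iInter] at hx
  have hxK : ζ.proj K x = c a (1 / 2) := (map_proj _ x).symm.trans (hx 0).1
  refine ⟨x, hxK, X.ext K fun j hj => ?_⟩
  obtain ⟨i, rfl⟩ := Nat.exists_eq_add_of_le hj
  rw [hV.proj_retr hc hj (hhalf hxK)]
  exact (hx i).2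

/-- There are finitely many prongs, and one that is not an end is lost for good at some finite
level. -/
theorem IsStandardStarNhd.exists_ends_eq (hV : ζ.IsStandardStarNhd V p) (hc : IsStarChart V p c η)
    (z : ζ.X) : ∃ J, K ≤ J ∧ ∀ (j : ℕ) (hj : K ≤ j), J ≤ j →
      ends c (ζ.map hj) (ζ.proj j z) = ends c (ζ.proj K) z := by
  have : ∀ a : Fin m, ∃ J, K ≤ J ∧ (a ∉ ends c (ζ.proj K) z →
      ∀ (j : ℕ) (hj : K ≤ j), J ≤ j → a ∉ ends c (ζ.map hj) (ζ.proj j z)) := by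
    intro a
    by_cases ha : a ∈ ends c (ζ.proj K) z
    · exact ⟨K, le_rfl, fun h => absurd ha h⟩
    · rw [hV.mem_ends_iff hc] at ha
      push Not at ha
      obtain ⟨i, hi, hai⟩ := ha
      refine ⟨i, hi, fun _ j hj hij h => hai ?_⟩
      have := hV.ends_subset_ends hc hi hij _ h
      rwa [map_proj] at this
  choose J hJ hJ' using this
  obtain ⟨M, hM⟩ := (finite_range J).bddAbove
  refine ⟨max M K, le_max_right _ _, fun j hj hMj => Subset.antisymm (fun a ha => ?_)
    (hV.ends_subset_proj hc hj z)⟩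
  by_contra hna
  exact hJ' a hna j hj (((hM ⟨a, rfl⟩).trans (le_max_left _ _)).trans hMj) ha

/-- Let `J` be a level from which the ends are constant. If some deeper projection of `z` is not
natural, it already has two ends. Otherwise `z` is a pre-singularity, and if it had at most one end,
it would be the only point of its fiber at level `J`. All the prongs at the natural vertex of level
`J`, at least three, then lift to prongs of `X` starting at `z`, and `three_prongs` puts them over
distinct prongs of `V`. -/
theorem IsStandardStarNhd.nontrivial_ends (hst : ζ.IsStabilized) (hV : ζ.IsStandardStarNhd V p)
    (hc : IsStarChart V p c η) {z : ζ.X} (hz : ζ.proj K z = p) :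
    (ends c (ζ.proj K) z).Nontrivial := by
  have hL := hV.starLift_proj hc
  obtain ⟨J, hKJ, hJ⟩ := hV.exists_ends_eq hc z
  by_cases hnat : ∃ j, J ≤ j ∧ ¬ IsNatural (ζ.proj j z)
  · obtain ⟨j, hj, hn⟩ := hnat
    rw [← hJ j (hKJ.trans hj) hj]
    exact hV.nontrivial_ends_of_not_isNatural hc (by rw [map_proj, hz]) hn
  push Not at hnat
  by_contra hnt
  rw [not_nontrivial_iff] at hnt
  -- A projection of `x` beyond level `J` that is not natural would have two ends, and these would
  -- be ends of `z`. So `x` is a pre-singularity too, and a fiber contains at most one.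
  have huniq : ∀ x, ζ.proj J x = ζ.proj J z → x = z := by
    intro x hx
    have hxp : ζ.proj K x = p := by rw [← map_proj hKJ, hx, map_proj, hz]
    refine hst.natural_fiber J (ζ.proj J z) (hnat J le_rfl) ⟨⟨J, fun j hj => ?_⟩, hx⟩
      ⟨⟨J, hnat⟩, rfl⟩
    by_contra hn
    have h1 := hV.nontrivial_ends_of_not_isNatural (hj := hKJ.trans hj) hc (by rw [map_proj, hxp]) hn
    have h2 := h1.mono (hV.ends_subset_ends hc hKJ hj _)
    rw [map_proj, hx, hJ J hKJ le_rfl] at h2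
    exact (not_nontrivial_iff.2 hnt) h2
  have h3 := (hV.isNatural_iff (hj := hKJ) hc (w := ζ.proj J z) (by rw [map_proj, hz])).1
    (hnat J le_rfl)
  rw [Nat.card_coe_set_eq,
    two_lt_ncard_iff (finite_prongs (c := c) (ζ.finite_fiber hKJ) (ζ.proj J z))] at h3
  obtain ⟨y₁, y₂, y₃, h1, h2, h3, h12, h13, h23⟩ := h3
  have lift : ∀ y ∈ prongs c (ζ.map hKJ) (ζ.proj J z), ∃ x ∈ prongs c (ζ.proj K) z,
      ζ.proj J x = y := by
    rintro y ⟨⟨a, ha⟩, hy⟩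
    obtain ⟨x, rfl⟩ := proj_surjective J y
    rw [map_proj] at ha
    refine ⟨x, ⟨⟨a, ha⟩, huniq _ ?_⟩, rfl⟩
    rw [hV.proj_retr hc hKJ (hL.mem_of_half ha), hy]
  obtain ⟨x₁, hx₁, rfl⟩ := lift _ h1
  obtain ⟨x₂, hx₂, rfl⟩ := lift _ h2
  obtain ⟨x₃, hx₃, rfl⟩ := lift _ h3
  have hne := hV.three_prongs hst hc hz hx₁ hx₂ hx₃ (fun h => h12 (by rw [h]))
    (fun h => h13 (by rw [h])) (fun h => h23 (by rw [h]))
  obtain ⟨⟨a, ha⟩, hx₁⟩ := hx₁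
  obtain ⟨⟨b, hb⟩, hx₂⟩ := hx₂
  have : a = b := hnt ⟨_, ha, hx₁⟩ ⟨_, hb, hx₂⟩
  exact hne (by rw [ha, hb, this])

/-- For two lifts over the same prong, a lift over a second end serves as the third prong needed for
`three_prongs`. -/
theorem IsStandardStarNhd.injOn_proj_prongs (hst : ζ.IsStabilized) (hV : ζ.IsStandardStarNhd V p)
    (hc : IsStarChart V p c η) {z : ζ.X} (hz : ζ.proj K z = p) :
    InjOn (ζ.proj K) (prongs c (ζ.proj K) z) := by
  intro α hα β hβ he
  by_contra hne
  obtain ⟨a, ha⟩ := hα.1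
  obtain ⟨b, ⟨γ, hb, hγ⟩, hba⟩ := (hV.nontrivial_ends hst hc hz).exists_ne a
  have hγα : ζ.proj K γ ≠ ζ.proj K α := fun h => hba (hc.disj _ _ _ half_mem (by rw [← hb, h, ha]))
  exact hV.three_prongs hst hc hz hα hβ ⟨⟨b, hb⟩, hγ⟩ hne (fun h => hγα (by rw [h]))
    (fun h => hγα (by rw [he, h])) he

/-- Three ends of `z` project to three different prongs at every level from `K` on. -/
theorem IsStandardStarNhd.isNatural_of_ends (hV : ζ.IsStandardStarNhd V p)
    (hc : IsStarChart V p c η) {z : ζ.X} (hz : ζ.proj K z = p)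
    (h : 2 < (ends c (ζ.proj K) z).ncard) {j : ℕ} (hj : K ≤ j) : IsNatural (ζ.proj j z) := by
  rw [hV.isNatural_iff (hj := hj) hc (by rw [map_proj, hz]), Nat.card_coe_set_eq,
    two_lt_ncard_iff (finite_prongs (c := c) (ζ.finite_fiber hj) (ζ.proj j z))]
  rw [two_lt_ncard_iff (toFinite _)] at h
  obtain ⟨a, b, d, ⟨x, hx, hxz⟩, ⟨y, hy, hyz⟩, ⟨w, hw, hwz⟩, hab, had, hbd⟩ := h
  have key : ∀ {a b : Fin m} {x y : ζ.X}, ζ.proj K x = c a (1 / 2) → ζ.proj K y = c b (1 / 2) →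
      a ≠ b → ζ.proj j x ≠ ζ.proj j y := fun {a b x y} hx hy hab he => hab
    (hc.disj _ _ _ half_mem (by rw [← hx, ← hy, ← map_proj hj x, ← map_proj hj y, he]))
  exact ⟨_, _, _, hV.proj_mem_prongs hc hj ⟨⟨a, hx⟩, hxz⟩, hV.proj_mem_prongs hc hj ⟨⟨b, hy⟩, hyz⟩,
    hV.proj_mem_prongs hc hj ⟨⟨d, hw⟩, hwz⟩, key hx hy hab, key hx hw had, key hy hw hbd⟩

/-- The sheet over a point of the central fiber is a star that embeds into `V`. -/
theorem IsStandardStarNhd.exists_plaque_chart (hst : ζ.IsStabilized)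
    (hV : ζ.IsStandardStarNhd V p) (hc : IsStarChart V p c η) {z : ζ.X} (hz : ζ.proj K z = p) :
    ∃ σ : ends c (ζ.proj K) z → ℝ → ζ.X,
      (∀ a : ends c (ζ.proj K) z, IsSection (ζ.proj K) (c a) (σ a)) ∧
      IsStarChart (StarLift.fiber V c (ζ.proj K) z) z σ (fun y => η (ζ.proj K y)) := by
  have hL := hV.starLift_proj hc
  have hI := Ioo_subset_Ico_self half_mem
  have hex : ∀ a : ends c (ζ.proj K) z, ∃ σ, IsSection (ζ.proj K) (c a) σ ∧ σ 0 = z := by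
    rintro ⟨a, y, ha, hy⟩
    obtain ⟨σ, hσ, rfl⟩ := hL.exists_section a _ half_mem y ha
    exact ⟨σ, hσ, by rw [← hy, hL.retr_section hσ hI]⟩
  choose σ hσ h0 using hex
  refine ⟨σ, hσ, ?_⟩
  have hch := hL.isStarChart hz hσ h0 (fun a b he => Subtype.ext (hc.disj _ _ _ half_mem
    (((hσ a).map _ hI).symm.trans ((congrArg _ he).trans ((hσ b).map _ hI)))))
  convert hch using 1
  ext y
  constructor
  · rintro ⟨hy, hr⟩
    by_cases hp : ζ.proj K y = p
    · left; rw [← hr, hL.retr_fiber hp]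
    · right
      obtain ⟨h1, b, τ, hτ, he⟩ := hL.exists_of_ne hy hp
      have hτ0 : τ 0 = z := by rw [← hr, ← he, hL.retr_section hτ (Ioo_subset_Ico_self h1)]
      have hτp := hL.section_mem_prongs hτ
      rw [hτ0] at hτp
      let B : ends c (ζ.proj K) z := ⟨b, _, hτ.map _ hI, hτp.2⟩
      have hσp := hL.section_mem_prongs (hσ B)
      rw [h0 B] at hσp
      have := hV.injOn_proj_prongs hst hc hz hσp hτp (by rw [(hσ B).map _ hI, hτ.map _ hI])
      exact ⟨B, _, h1, by
        rw [hL.unique b (σ B) τ (hσ B) hτ _ half_mem this (Ioo_subset_Ico_self h1), he]⟩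
  · rintro (rfl | ⟨k, t, ht, rfl⟩)
    · exact hL.mem_fiber_self hz
    · have := hL.section_mem_fiber (hσ k) (Ioo_subset_Ico_self ht)
      rwa [h0 k] at this

/-- The plaques of a standard neighborhood are the sheets over the points of the central fiber. -/
theorem IsStandardStarNhd.pathComponentIn_eq (hV : ζ.IsStandardStarNhd V p)
    (hc : IsStarChart V p c η) {x : ζ.X} (hx : ζ.proj K x ∈ V) :
    pathComponentIn (ζ.proj K ⁻¹' V) x =
      StarLift.fiber V c (ζ.proj K) (starRetr (ζ.proj K) c x) := by
  have hL := hV.starLift_proj hc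
  have hxO : x ∈ ζ.proj K ⁻¹' V := hx
  refine Subset.antisymm (fun y hy => ?_) ?_
  · have hyO := pathComponentIn_subset hy
    have hyV : ζ.proj K y ∈ V := hyO
    refine ⟨hyV, X.ext K fun j hj => ?_⟩
    have hLj := hV.starLift_map hc hj
    rw [hV.proj_retr hc hj hyV, hV.proj_retr hc hj hx]
    -- The image of the plaque at level `j` is connected and the sheets there are open and disjoint,
    -- so it stays in one sheet. As this holds at every level, the retraction is constant on the
    -- plaque.
    have hpre : IsPreconnected (ζ.proj j '' pathComponentIn (ζ.proj K ⁻¹' V) x) :=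
      ((isPathConnected_pathComponentIn hxO).isConnected.isPreconnected).image _
        (continuous_proj j).continuousOn
    have hop := fun w => hLj.isOpen_fiber hV.1 (ζ.finite_fiber hj) w
    have hxj : ζ.map hj (ζ.proj j x) ∈ V := by rwa [map_proj]
    have hne : ((ζ.proj j '' pathComponentIn (ζ.proj K ⁻¹' V) x) ∩ StarLift.fiber V c (ζ.map hj)
        (starRetr (ζ.map hj) c (ζ.proj j x))).Nonempty :=
      ⟨_, mem_image_of_mem _ (mem_pathComponentIn_self hxO), hxj, rfl⟩
    have := hpre.subset_left_of_subset_union (hop (starRetr (ζ.map hj) c (ζ.proj j x)))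
      (isOpen_iUnion fun w : {w // w ≠ starRetr (ζ.map hj) c (ζ.proj j x)} => hop w.1)
      (by
        rw [disjoint_iUnion_right]
        exact fun w => disjoint_left.2 fun y hy hy' => w.2 (by rw [← hy'.2, hy.2]))
      (by
        rintro _ ⟨y, hy, rfl⟩
        have hyO := pathComponentIn_subset hy
        have hyV : ζ.map hj (ζ.proj j y) ∈ V := by rw [map_proj]; exact hyO
        by_cases h : starRetr (ζ.map hj) c (ζ.proj j y) = starRetr (ζ.map hj) c (ζ.proj j x)
        · exact Or.inl ⟨hyV, h⟩
        · exact Or.inr (mem_iUnion.2 ⟨⟨_, h⟩, hyV, rfl⟩))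
      hne
    exact (this ⟨y, hy, rfl⟩).2
  · obtain ⟨a, σ, -, -, hF⟩ := hL.exists_fiber_chart (hL.map_retr hx)
    have hm : x ∈ StarLift.fiber V c (ζ.proj K) (starRetr (ζ.proj K) c x) := ⟨hx, rfl⟩
    exact hF.isPathConnected.subset_pathComponentIn hm fun y hy => hy.1

end SplitSequence

/-- A map that matches the prongs of two star charts restricts to a homeomorphism. -/
theorem IsStarChart.exists_homeo_of_map {Y Y' ι : Type*} [TopologicalSpace Y] [TopologicalSpace Y']
    [T2Space Y] [T2Space Y'] [Finite ι] {S : Set Y} {z : Y} {σ : ι → ℝ → Y} {η : Y → ℝ}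
    {S' : Set Y'} {z' : Y'} {σ' : ι → ℝ → Y'} {η' : Y' → ℝ} (h : IsStarChart S z σ η)
    (h' : IsStarChart S' z' σ' η') {π : Y → Y'} (hz : π z = z')
    (hπ : ∀ j, ∀ t ∈ Ioo (0 : ℝ) 1, π (σ j t) = σ' j t) :
    ∃ l : S' ≃ₜ S, ∀ t : S', π (l t) = t := by
  obtain ⟨e, e0, he⟩ := (h.reindex (Finite.equivFin ι).symm).exists_homeo
  obtain ⟨e', e0', he'⟩ := (h'.reindex (Finite.equivFin ι).symm).exists_homeo
  refine ⟨e'.symm.trans e, fun t => ?_⟩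
  obtain ⟨v, rfl⟩ := e'.surjective t
  simp only [Homeomorph.trans_apply, Homeomorph.symm_apply_apply]
  rcases v.eq_center_or with rfl | ⟨j, hj⟩
  · rw [e0, e0', hz]
  · have hr := (v.eq_ray j hj.ne').1
    have hI : v.1 j ∈ Ioo (0 : ℝ) 1 := ⟨hj, (v.2.1 j).2⟩
    rw [hr, he _ _ (Ioo_subset_Ico_self hI), he' _ _ (Ioo_subset_Ico_self hI)]
    exact hπ _ _ hI

/-! ### Singularities and leaf segments. -/

namespace SplitSequence

open StarLift

variable {n : ℕ} {ζ : SplitSequence.{u} n}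
variable {K m : ℕ} {V : Set (ζ.G K)} {p : ζ.G K} {c : Fin m → ℝ → ζ.G K} {η : ζ.G K → ℝ}

theorem IsStandardStarNhd.exists_chart (hV : ζ.IsStandardStarNhd V p) :
    ∃ (m : ℕ) (c : Fin m → ℝ → ζ.G K) (η : ζ.G K → ℝ), IsStarChart V p c η := by
  obtain ⟨m, h⟩ := hV.2.1
  exact ⟨m, h.exists_chart⟩

theorem IsStandardStarNhd.isStandardNhd (hV : ζ.IsStandardStarNhd V p) :
    ζ.IsStandardNhd (ζ.proj K ⁻¹' V) := ⟨K, V, p, hV, rfl⟩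

theorem IsStandardNhd.isOpen {O : Set ζ.X} (h : ζ.IsStandardNhd O) : IsOpen O := by
  obtain ⟨K, V, p, hV, rfl⟩ := h
  exact hV.1.preimage (continuous_proj K)

theorem IsStandardStarNhd.pathComponentIn_center (hV : ζ.IsStandardStarNhd V p)
    (hc : IsStarChart V p c η) {z : ζ.X} (hz : ζ.proj K z = p) :
    pathComponentIn (ζ.proj K ⁻¹' V) z = StarLift.fiber V c (ζ.proj K) z := by
  rw [hV.pathComponentIn_eq hc (by rw [hz]; exact hV.mem), (hV.starLift_proj hc).retr_fiber hz]

/-- The plaque of `z` over `V` is a star whose prongs are the ends, so a singularity has more than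
two. Conversely, more than two ends make `z` a pre-singularity, hence natural at every level by
`other_fiber`. Then `z` lies over the center of every standard neighborhood containing it, and
comparing stars at `z` gives its plaque there at least as many prongs. -/
theorem IsStandardStarNhd.mem_Sing_iff (hst : ζ.IsStabilized)
    (hV : ζ.IsStandardStarNhd V p) (hc : IsStarChart V p c η) {z : ζ.X} (hz : ζ.proj K z = p) :
    z ∈ ζ.Sing ↔ 2 < (ends c (ζ.proj K) z).ncard := by
  have hzV : z ∈ ζ.proj K ⁻¹' V := by show ζ.proj K z ∈ V; rw [hz]; exact hV.mem
  obtain ⟨σ, -, hF⟩ := hV.exists_plaque_chart hst hc hz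
  constructor
  · intro hs
    obtain ⟨k, w, hk, hw⟩ := hs _ hV.isStandardNhd hzV
    rw [hV.pathComponentIn_center hc hz] at hw
    obtain ⟨τ, ηw, hτ⟩ := hw.exists_chart
    rw [← Nat.card_coe_set_eq]
    by_cases hwz : w = z
    · subst hwz
      have := (hτ.card_le hF self_mem_nhdsWithin).1
      rw [Nat.card_fin] at this
      omega
    · have := hF.card_le_two hτ hτ.center_mem hwz self_mem_nhdsWithin
      rw [Nat.card_fin] at this
      omega
  · rintro hs O ⟨K', V', p', hV', rfl⟩ hzV'
    have hpre : ζ.IsPreSingularity z := ⟨K, fun j hj => hV.isNatural_of_ends hc hz hs hj⟩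
    have hnat : IsNatural (ζ.proj K' z) := by
      by_contra hn
      exact hst.other_fiber K' _ hn z rfl hpre
    have hz' : ζ.proj K' z = p' := by
      by_contra hne
      exact hV'.2.2 _ hzV' hne (.of_isNatural hnat)
    obtain ⟨m', c', η', hc'⟩ := hV'.exists_chart
    obtain ⟨σ', -, hF'⟩ := hV'.exists_plaque_chart hst hc' hz'
    have h1 := hF.pathComponentIn_mem_nhdsWithin
      (mem_nhdsWithin_of_mem_nhds (hV'.isStandardNhd.isOpen.mem_nhds hzV'))
    rw [hV'.pathComponentIn_center hc' hz'] at h1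
    have h2 := (hF.card_le hF' h1).1
    rw [Nat.card_coe_set_eq] at h2
    rw [hV'.pathComponentIn_center hc' hz']
    have h3 := hs.trans_le h2
    exact ⟨_, z, h3, (hF'.reindex (Finite.equivFin _).symm).isStarSet h3.le⟩

theorem isNatural_of_mem_Sing (hst : ζ.IsStabilized) (hζ : ζ.IsProper) {x : ζ.X}
    (hx : x ∈ ζ.Sing) (j : ℕ) : IsNatural (ζ.proj j x) := by
  obtain ⟨V, -, hV⟩ := exists_isStandardStarNhd hζ (ζ.proj 0 x) Filter.univ_mem
  obtain ⟨m, c, η, hc⟩ := hV.exists_chart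
  exact hV.isNatural_of_ends hc rfl ((hV.mem_Sing_iff hst hc rfl).1 hx) (Nat.zero_le j)

/-- Singularities project to natural vertices of level `0`, finitely many by properness, and
injectively since a fiber contains at most one pre-singularity. -/
theorem finite_Sing (hst : ζ.IsStabilized) (hζ : ζ.IsProper) : ζ.Sing.Finite := by
  refine Set.Finite.of_finite_image (f := ζ.proj 0) (hζ.subset ?_) ?_
  · rintro _ ⟨x, hx, rfl⟩
    exact ⟨0, _, isNatural_of_mem_Sing hst hζ hx 0, ζ.map_self _ _⟩
  · intro x hx y hy he
    exact hst.natural_fiber 0 (ζ.proj 0 y) (isNatural_of_mem_Sing hst hζ hy 0)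
      ⟨⟨0, fun j _ => isNatural_of_mem_Sing hst hζ hx j⟩, he⟩
      ⟨⟨0, fun j _ => isNatural_of_mem_Sing hst hζ hy j⟩, rfl⟩

theorem IsStandardStarNhd.notMem_Sing (hst : ζ.IsStabilized) (hζ : ζ.IsProper)
    (hV : ζ.IsStandardStarNhd V p) {y : ζ.X} (hy : ζ.proj K y ∈ V) (hne : ζ.proj K y ≠ p) :
    y ∉ ζ.Sing := fun hs =>
  hV.2.2 _ hy hne (.of_isNatural (isNatural_of_mem_Sing hst hζ hs K))

/-- The plaques of the standard neighborhoods are stars. -/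
theorem IsStandardNhd.exists_chart (hst : ζ.IsStabilized) (hζ : ζ.IsProper) {O : Set ζ.X}
    (hO : ζ.IsStandardNhd O) {x : ζ.X} (hx : x ∈ O) :
    ∃ (k : ℕ) (z : ζ.X) (σ : Fin k → ℝ → ζ.X) (η : ζ.X → ℝ), 2 ≤ k ∧
      IsStarChart (pathComponentIn O x) z σ η ∧ (2 < k ↔ z ∈ ζ.Sing) ∧
      ∀ y ∈ pathComponentIn O x, y ≠ z → y ∉ ζ.Sing := by
  obtain ⟨K, V, p, hV, rfl⟩ := hO
  obtain ⟨m, c, η, hc⟩ := hV.exists_chart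
  have hL := hV.starLift_proj hc
  rw [hV.pathComponentIn_eq hc hx]
  have hz := hL.map_retr hx
  set z := starRetr (ζ.proj K) c x
  obtain ⟨σ, -, hF⟩ := hV.exists_plaque_chart hst hc hz
  refine ⟨_, z, _, _, ?_, hF.reindex (Finite.equivFin _).symm, ?_, fun y hy hne => ?_⟩
  · rw [Nat.card_coe_set_eq]
    exact (one_lt_ncard_iff_nontrivial).2 (hV.nontrivial_ends hst hc hz)
  · rw [Nat.card_coe_set_eq, hV.mem_Sing_iff hst hc hz]
  · refine hV.notMem_Sing hst hζ hy.1 fun he => hne ?_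
    rw [← hy.2, hL.retr_fiber he]

/-- Only the center of a plaque can be a singularity. If it is not, the plaque has exactly two
prongs and is a turn of itself. -/
theorem isLeafSegment_iff (hst : ζ.IsStabilized) (hζ : ζ.IsProper) {L : Set ζ.X} :
    ζ.IsLeafSegment L ↔ ζ.IsStandardPlaque L ∧ Disjoint L ζ.Sing := by
  constructor
  · rintro ⟨-, hL, hns⟩
    refine ⟨hL, ?_⟩
    have hL' := hL
    obtain ⟨O, hO, x, hx, rfl⟩ := hL
    obtain ⟨k, z, σ, η, hk, hch, hzs, hne⟩ := hO.exists_chart hst hζ hx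
    refine disjoint_left.2 fun y hy hys => hns ⟨z, hL', ?_, k, hch.isStarSet hk⟩
    by_contra hz
    by_cases h : y = z
    · exact hz (h ▸ hys)
    · exact hne y hy h hys
  · rintro ⟨hL, hd⟩
    have hL' := hL
    obtain ⟨O, hO, x, hx, rfl⟩ := hL
    obtain ⟨k, z, σ, η, hk, hch, hzs, hne⟩ := hO.exists_chart hst hζ hx
    have hz : z ∉ ζ.Sing := fun h => disjoint_left.1 hd hch.center_mem h
    obtain rfl : k = 2 := by
      have := mt hzs.1 hz
      omega
    refine ⟨⟨_, z, hL', ?_⟩, hL', ?_⟩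
    · convert hch.isTurnOf (a := 0) (b := 1) (by decide) using 1
      ext y
      rw [hch.mem_iff]
      refine or_congr_right ⟨?_, ?_⟩
      · rintro ⟨j, t, ht, rfl⟩
        refine ⟨t, ht, ?_⟩
        fin_cases j
        · exact Or.inl rfl
        · exact Or.inr rfl
      · rintro ⟨t, ht, h | h⟩
        · exact ⟨0, t, ht, h⟩
        · exact ⟨1, t, ht, h⟩
    · rintro ⟨s, -, hs, k, -, e, he⟩
      exact disjoint_left.1 hd (he ▸ (e _).2) hs

end SplitSequence
-- Turn tunnels and transversals.
namespace SplitSequence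

open StarLift

variable {n : ℕ} {ζ : SplitSequence.{u} n}
variable {K m : ℕ} {V : Set (ζ.G K)} {p : ζ.G K} {c : Fin m → ℝ → ζ.G K} {η : ζ.G K → ℝ}
  {a b : Fin m}

theorem IsStandardStarNhd.injOn_proj_fiber (hst : ζ.IsStabilized)
    (hV : ζ.IsStandardStarNhd V p) (hc : IsStarChart V p c η) {z : ζ.X} (hz : ζ.proj K z = p) :
    InjOn (ζ.proj K) (StarLift.fiber V c (ζ.proj K) z) := by
  obtain ⟨σ, hσ, hF⟩ := hV.exists_plaque_chart hst hc hz
  intro x hx y hy he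
  rcases (hF.mem_iff x).1 hx with rfl | ⟨i, s, hs, rfl⟩ <;>
    rcases (hF.mem_iff y).1 hy with rfl | ⟨j, t, ht, rfl⟩
  · rfl
  · rw [(hσ j).map t (Ioo_subset_Ico_self ht), hz] at he
    exact absurd he.symm (hc.σ_ne ht)
  · rw [(hσ i).map s (Ioo_subset_Ico_self hs), hz] at he
    exact absurd he (hc.σ_ne hs)
  · rw [(hσ i).map s (Ioo_subset_Ico_self hs), (hσ j).map t (Ioo_subset_Ico_self ht)] at he
    obtain ⟨h1, rfl⟩ := hc.σ_inj hs (Ioo_subset_Ico_self ht) he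
    rw [Subtype.ext h1]

theorem IsStandardStarNhd.takes_fiber (hst : ζ.IsStabilized) (hζ : ζ.IsProper)
    (hV : ζ.IsStandardStarNhd V p) (hc : IsStarChart V p c η) {z : ζ.X}
    (hz : ζ.proj K z = p) (hends : ends c (ζ.proj K) z = {a, b}) :
    ζ.Takes (turnSet p c a b) (StarLift.fiber V c (ζ.proj K) z) := by
  have hL := hV.starLift_proj hc
  have hzV : z ∈ ζ.proj K ⁻¹' V := by show ζ.proj K z ∈ V; rw [hz]; exact hV.mem
  obtain ⟨σ, hσ, hF⟩ := hV.exists_plaque_chart hst hc hz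
  refine ⟨(isLeafSegment_iff hst hζ).2 ⟨⟨_, hV.isStandardNhd, z, hzV,
    (hV.pathComponentIn_center hc hz).symm⟩, disjoint_left.2 fun y hy hs => ?_⟩, ?_⟩
  · by_cases hyp : ζ.proj K y = p
    · rw [← hL.retr_fiber hyp, hy.2, hV.mem_Sing_iff hst hc hz, hends] at hs
      exact absurd hs (not_lt.2 ((ncard_insert_le a {b}).trans (by rw [ncard_singleton])))
    · exact hV.notMem_Sing hst hζ hy.1 hyp hs
  · have hsub := hc.sub (Subtype.val : ends c (ζ.proj K) z → Fin m) Subtype.val_injective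
    obtain ⟨l, hl⟩ := hF.exists_homeo_of_map hsub (π := ζ.proj K) hz
      fun j t ht => (hσ j).map t (Ioo_subset_Ico_self ht)
    have he : turnSet p c a b = {y | y = p ∨ ∃ j : ends c (ζ.proj K) z, ∃ t ∈ Ioo (0 : ℝ) 1,
        y = c j.1 t} := by
      ext y
      refine or_congr_right ⟨?_, ?_⟩
      · rintro ⟨t, ht, h | h⟩
        · exact ⟨⟨a, by rw [hends]; exact Or.inl rfl⟩, t, ht, h⟩
        · exact ⟨⟨b, by rw [hends]; exact Or.inr rfl⟩, t, ht, h⟩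
      · rintro ⟨⟨j, hj⟩, t, ht, h⟩
        rw [hends] at hj
        rcases hj with rfl | rfl
        · exact ⟨t, ht, Or.inl h⟩
        · exact ⟨t, ht, Or.inr h⟩
    rw [Sustains, he]
    exact ⟨l, hl⟩

theorem turnSet_subset (hc : IsStarChart V p c η) : turnSet p c a b ⊆ V := by
  rintro y (rfl | ⟨t, ht, rfl | rfl⟩)
  exacts [hc.center_mem, hc.mem a (Ioo_subset_Ico_self ht), hc.mem b (Ioo_subset_Ico_self ht)]

theorem isPathConnected_turnSet (hc : IsStarChart V p c η) :
    IsPathConnected (turnSet p c a b) := by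
  by_cases hab : a = b
  · subst hab
    convert (hc.sub (fun _ : Unit => a) (fun _ _ _ => rfl)).isPathConnected using 1
    ext y
    simp [turnSet]
  · convert (hc.sub (Subtype.val : ({a, b} : Set (Fin m)) → Fin m)
      Subtype.val_injective).isPathConnected using 1
    ext y
    simp only [turnSet, mem_ofPred_eq, Subtype.exists, mem_insert_iff, mem_singleton_iff]
    refine or_congr_right ⟨?_, ?_⟩
    · rintro ⟨t, ht, h | h⟩
      · exact ⟨a, Or.inl rfl, t, ht, h⟩
      · exact ⟨b, Or.inr rfl, t, ht, h⟩
    · rintro ⟨j, rfl | rfl, t, ht, h⟩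
      · exact ⟨t, ht, Or.inl h⟩
      · exact ⟨t, ht, Or.inr h⟩

/-- The leaf segments that take a turn are sheets of the standard neighborhood. -/
theorem IsStandardStarNhd.takes_iff (hst : ζ.IsStabilized) (hζ : ζ.IsProper)
    (hV : ζ.IsStandardStarNhd V p) (hc : IsStarChart V p c η) (hab : a ≠ b) {L : Set ζ.X} :
    ζ.Takes (turnSet p c a b) L ↔ ∃ z, ζ.proj K z = p ∧ ends c (ζ.proj K) z = {a, b} ∧
      L = StarLift.fiber V c (ζ.proj K) z := by
  constructor
  · rintro ⟨hleaf, l, hl⟩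
    have hd := ((isLeafSegment_iff hst hζ).1 hleaf).2
    have hI : (1 / 2 : ℝ) ∈ Ioo (0 : ℝ) 1 := half_mem
    have hpI : p ∈ turnSet p c a b := Or.inl rfl
    obtain ⟨z, hzL, hz⟩ : ∃ z ∈ L, ζ.proj K z = p := ⟨_, (l ⟨p, hpI⟩).2, hl _⟩
    have hpath : IsPathConnected L := by
      have := isPathConnected_iff_pathConnectedSpace.1 (isPathConnected_turnSet (a := a) (b := b) hc)
      rw [isPathConnected_iff_pathConnectedSpace]
      exact l.surjective.pathConnectedSpace l.continuous
    have hsub : L ⊆ StarLift.fiber V c (ζ.proj K) z := by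
      rw [← hV.pathComponentIn_center hc hz]
      refine hpath.subset_pathComponentIn hzL fun y hy => ?_
      obtain ⟨t, ht⟩ := l.surjective ⟨y, hy⟩
      have := hl t
      rw [ht] at this
      show ζ.proj K y ∈ V
      rw [show ζ.proj K y = t from this]
      exact turnSet_subset hc t.2
    have hmem : ∀ {d : Fin m}, c d (1 / 2) ∈ turnSet p c a b → d ∈ ends c (ζ.proj K) z :=
      fun {d} hdI => ⟨l ⟨_, hdI⟩, hl _, (hsub (l ⟨_, hdI⟩).2).2⟩
    have ha := hmem (Or.inr ⟨_, hI, Or.inl rfl⟩ : c a (1 / 2) ∈ turnSet p c a b)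
    have hb := hmem (Or.inr ⟨_, hI, Or.inr rfl⟩ : c b (1 / 2) ∈ turnSet p c a b)
    -- The segment covers both prongs of the turn, so both are ends. A third end would make its
    -- point `z` singular, while leaf segments contain no singularity.
    have hends : ends c (ζ.proj K) z = {a, b} := by
      have h1 : ({a, b} : Set (Fin m)) ⊆ ends c (ζ.proj K) z := by
        rintro d (rfl | rfl)
        exacts [ha, hb]
      refine (eq_of_subset_of_ncard_le h1 ?_ (toFinite _)).symm
      rw [ncard_pair hab]
      by_contra hlt
      exact disjoint_left.1 hd hzL ((hV.mem_Sing_iff hst hc hz).2 (not_le.1 hlt))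
    refine ⟨z, hz, hends, Subset.antisymm hsub fun y hy => ?_⟩
    have hyI : ζ.proj K y ∈ turnSet p c a b := by
      obtain ⟨σ, hσ, hF⟩ := hV.exists_plaque_chart hst hc hz
      rcases (hF.mem_iff y).1 hy with h | ⟨⟨d, hd⟩, t, ht, rfl⟩
      · rw [h, hz]; exact hpI
      · rw [(hσ _).map t (Ioo_subset_Ico_self ht)]
        rw [hends] at hd
        rcases hd with rfl | rfl
        exacts [Or.inr ⟨t, ht, Or.inl rfl⟩, Or.inr ⟨t, ht, Or.inr rfl⟩]
    -- The segment has a point over each point of the turn, and on the sheet the projection is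
    -- injective; so the segment fills the sheet.
    have hyL := (l ⟨_, hyI⟩).2
    rwa [hV.injOn_proj_fiber hst hc hz (hsub hyL) hy (hl _)] at hyL
  · rintro ⟨z, hz, hends, rfl⟩
    exact hV.takes_fiber hst hζ hc hz hends

theorem IsStandardStarNhd.mem_turnTunnel (hst : ζ.IsStabilized) (hζ : ζ.IsProper)
    (hV : ζ.IsStandardStarNhd V p) (hc : IsStarChart V p c η) (hab : a ≠ b) {x : ζ.X} :
    x ∈ ζ.turnTunnel (turnSet p c a b) ↔ ζ.proj K x ∈ V ∧
      ends c (ζ.proj K) (starRetr (ζ.proj K) c x) = {a, b} := by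
  have hL := hV.starLift_proj hc
  constructor
  · rintro ⟨L, hT, hx⟩
    obtain ⟨z, hz, hends, rfl⟩ := (hV.takes_iff hst hζ hc hab).1 hT
    exact ⟨hx.1, by rw [hx.2, hends]⟩
  · rintro ⟨hx, hends⟩
    exact ⟨_, (hV.takes_iff hst hζ hc hab).2 ⟨_, hL.map_retr hx, hends, rfl⟩, hx, rfl⟩

/-- The ends of the center are determined at some finite level. Every point of the same sheet at
that level has its ends in `{a, b}`, and it has at least two. -/
theorem IsStandardStarNhd.isOpen_turnTunnel (hst : ζ.IsStabilized) (hζ : ζ.IsProper)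
    (hV : ζ.IsStandardStarNhd V p) (hc : IsStarChart V p c η) (hab : a ≠ b) :
    IsOpen (ζ.turnTunnel (turnSet p c a b)) := by
  have hL := hV.starLift_proj hc
  rw [isOpen_iff_mem_nhds]
  intro x hx
  obtain ⟨hxV, hends⟩ := (hV.mem_turnTunnel hst hζ hc hab).1 hx
  obtain ⟨J, hJ, hJe⟩ := hV.exists_ends_eq hc (starRetr (ζ.proj K) c x)
  have hLJ := hV.starLift_map hc hJ
  have hop := (hLJ.isOpen_fiber hV.1 (ζ.finite_fiber hJ)
    (starRetr (ζ.map hJ) c (ζ.proj J x))).preimage (continuous_proj J)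
  filter_upwards [hop.mem_nhds (by
    show ζ.proj J x ∈ StarLift.fiber _ _ _ _
    exact ⟨by rwa [map_proj], rfl⟩)] with y hy
  obtain ⟨hyV, hyr⟩ := hy
  rw [map_proj] at hyV
  rw [hV.mem_turnTunnel hst hζ hc hab]
  refine ⟨hyV, ?_⟩
  have h1 := hV.ends_subset_proj hc hJ (starRetr (ζ.proj K) c y)
  rw [hV.proj_retr hc hJ hyV, hyr, ← hV.proj_retr hc hJ hxV, hJe J hJ le_rfl, hends] at h1
  refine eq_of_subset_of_ncard_le h1 ?_ (toFinite _)
  rw [ncard_pair hab]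
  exact one_lt_ncard_iff_nontrivial.2 (hV.nontrivial_ends hst hc (hL.map_retr hyV))

/-- Each sheet that takes the turn meets the central section in its center, which can serve as `y`.
-/
theorem IsStandardStarNhd.transversal_eq (hst : ζ.IsStabilized) (hζ : ζ.IsProper)
    (hV : ζ.IsStandardStarNhd V p) (hc : IsStarChart V p c η) (hab : a ≠ b) (q : ζ.G K) :
    {z | ∃ y ∈ ζ.centralSection (turnSet p c a b) p, ζ.TunnelParam (turnSet p c a b) y q z} =
      {z | z ∈ ζ.turnTunnel (turnSet p c a b) ∧ ζ.proj K z = q} := by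
  have hL := hV.starLift_proj hc
  ext z
  constructor
  · rintro ⟨y, -, L, hT, -, hz, hq⟩
    exact ⟨⟨L, hT, hz⟩, hq⟩
  · rintro ⟨⟨L, hT, hz⟩, hq⟩
    have hT' := hT
    obtain ⟨w, hw, hends, rfl⟩ := (hV.takes_iff hst hζ hc hab).1 hT
    exact ⟨w, ⟨hw, _, hT', hL.mem_fiber_self hw⟩, _, hT', hL.mem_fiber_self hw, hz, hq⟩

theorem isTurnTransversal_iff (hst : ζ.IsStabilized) (hζ : ζ.IsProper) {H : Set ζ.X} :
    ζ.IsTurnTransversal H ↔ ∃ (K : ℕ) (V : Set (ζ.G K)) (p : ζ.G K) (m : ℕ)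
      (c : Fin m → ℝ → ζ.G K) (η : ζ.G K → ℝ) (a b : Fin m) (q : ζ.G K),
      ζ.IsStandardStarNhd V p ∧ IsStarChart V p c η ∧ a ≠ b ∧ q ∈ turnSet p c a b ∧
      H = {z | z ∈ ζ.turnTunnel (turnSet p c a b) ∧ ζ.proj K z = q} := by
  constructor
  · rintro ⟨K, V, p, I, q, hV, hI, hq, rfl⟩
    obtain ⟨m, c, η, hc, a, b, hab, rfl⟩ := hI.exists_chart
    exact ⟨K, V, p, m, c, η, a, b, q, hV, hc, hab, hq, hV.transversal_eq hst hζ hc hab q⟩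
  · rintro ⟨K, V, p, m, c, η, a, b, q, hV, hc, hab, hq, rfl⟩
    exact ⟨K, V, p, _, q, hV, hc.isTurnOf hab, hq, (hV.transversal_eq hst hζ hc hab q).symm⟩

/-- The image of the fiber at each deeper level is finite, so a connected subset has constant
coordinates. -/
theorem isTotallyDisconnected_fiber {K : ℕ} (p : ζ.G K) :
    IsTotallyDisconnected (ζ.proj K ⁻¹' {p}) := by
  intro T hT hpre x hx y hy
  refine X.ext K fun j hj => ?_
  have hfin : (ζ.proj j '' T).Finite := by
    refine (ζ.finite_fiber hj p).subset ?_
    rintro _ ⟨w, hw, rfl⟩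
    show ζ.map hj (ζ.proj j w) = p
    rw [map_proj]; exact hT hw
  by_contra hne
  exact (hpre.image _ (continuous_proj j).continuousOn).infinite_of_nontrivial
    ⟨_, mem_image_of_mem _ hx, _, mem_image_of_mem _ hy, hne⟩ hfin

theorem isTotallyDisconnected_transversal {F : Set ζ.X} (hF : ζ.IsTransversal F) :
    IsTotallyDisconnected F := by
  obtain ⟨K, V, p, I, -, -, φ, ⟨hφ, -⟩, B, -, rfl⟩ := hF
  rw [hφ.isTotallyDisconnected_image]
  rw [← IsEmbedding.subtypeVal.isTotallyDisconnected_image]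
  intro T hT
  refine isTotallyDisconnected_fiber p T (hT.trans ?_)
  rintro _ ⟨y, -, rfl⟩
  exact y.2.1

/-- Asking that `a` and `b` be ends, possibly among others, is a closed condition on the fiber over
`q`, being an intersection of conditions at finite levels. It defines the compact set `E a ∩ E b`,
which contains `H` and at most one more point, lying in the sheet of a singularity. -/
theorem isCompact_or_hasOnePointCompactificationIn (hst : ζ.IsStabilized) (hζ : ζ.IsProper)
    {H : Set ζ.X} (hH : ζ.IsTurnTransversal H) :
    IsCompact H ∨ ζ.HasOnePointCompactificationIn H := by
  obtain ⟨K, V, p, m, c, η, a, b, q, hV, hc, hab, hq, rfl⟩ := (isTurnTransversal_iff hst hζ).1 hH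
  have hL := hV.starLift_proj hc
  have hqV := turnSet_subset hc hq
  set H : Set ζ.X := {z | z ∈ ζ.turnTunnel (turnSet p c a b) ∧ ζ.proj K z = q} with hHdef
  let E : Fin m → Set ζ.X := fun d => {x | ζ.proj K x = q ∧
    d ∈ ends c (ζ.proj K) (starRetr (ζ.proj K) c x)}
  have hE : ∀ d, IsCompact (E d) := fun d => by
    have : E d = ⋂ (j : ℕ) (hj : K ≤ j), ζ.proj j ⁻¹' {y | ζ.map hj y = q ∧
        d ∈ ends c (ζ.map hj) (starRetr (ζ.map hj) c y)} := by
      ext x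
      simp only [E, mem_ofPred_eq, mem_iInter, mem_preimage, map_proj]
      constructor
      · rintro ⟨h1, h2⟩ j hj
        refine ⟨h1, ?_⟩
        rw [← hV.proj_retr hc hj (by rwa [h1])]
        exact (hV.mem_ends_iff hc _ d).1 h2 j hj
      · intro h
        have h1 := (h K le_rfl).1
        refine ⟨h1, (hV.mem_ends_iff hc _ d).2 fun j hj => ?_⟩
        rw [hV.proj_retr hc hj (by rwa [h1])]
        exact (h j hj).2
    rw [this]
    exact (isClosed_iInter fun j => isClosed_iInter fun hj => ((ζ.finite_fiber hj q).subset
      fun y hy => hy.1).isClosed.preimage (continuous_proj j)).isCompact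
  have hD : IsCompact (E a ∩ E b) := (hE a).inter (hE b)
  have hHD : H ⊆ E a ∩ E b := by
    rintro x ⟨hx, hxq⟩
    have h1 := ((hV.mem_turnTunnel hst hζ hc hab).1 hx).2
    exact ⟨⟨hxq, by rw [h1]; exact Or.inl rfl⟩, ⟨hxq, by rw [h1]; exact Or.inr rfl⟩⟩
  have hpres : ∀ x ∈ (E a ∩ E b) \ H, starRetr (ζ.proj K) c x ∈ ζ.Sing := by
    rintro x ⟨⟨⟨hxq, ha⟩, -, hb⟩, hxH⟩
    have hxV : ζ.proj K x ∈ V := by rwa [hxq]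
    rw [hV.mem_Sing_iff hst hc (hL.map_retr hxV)]
    by_contra hlt
    refine hxH ⟨(hV.mem_turnTunnel hst hζ hc hab).2 ⟨hxV, ?_⟩, hxq⟩
    refine (eq_of_subset_of_ncard_le ?_ ?_ (toFinite _)).symm
    · rintro d (rfl | rfl)
      exacts [ha, hb]
    · rw [ncard_pair hab]; exact not_lt.1 hlt
  -- At most one singularity lies over `p`, and its sheet has at most one point over `q`.
  have hone : ((E a ∩ E b) \ H).Subsingleton := by
    intro x hx y hy
    have hxs := hpres x hx
    have hys := hpres y hy
    have hxV : ζ.proj K x ∈ V := by rw [hx.1.1.1]; exact hqV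
    have hyV : ζ.proj K y ∈ V := by rw [hy.1.1.1]; exact hqV
    have hzx := hL.map_retr hxV
    have hzy := hL.map_retr hyV
    have hnat := isNatural_of_mem_Sing hst hζ hxs K
    have he : starRetr (ζ.proj K) c x = starRetr (ζ.proj K) c y :=
      hst.natural_fiber K _ hnat ⟨⟨0, fun j _ => isNatural_of_mem_Sing hst hζ hxs j⟩, rfl⟩
        ⟨⟨0, fun j _ => isNatural_of_mem_Sing hst hζ hys j⟩, hzy.trans hzx.symm⟩
    exact hV.injOn_proj_fiber hst hc hzy ⟨hxV, he⟩ ⟨hyV, rfl⟩ (hx.1.1.1.trans hy.1.1.1.symm)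
  by_cases hemp : ((E a ∩ E b) \ H) = ∅
  · left
    rwa [← Subset.antisymm (sdiff_eq_empty.1 hemp) hHD]
  · right
    obtain ⟨w, hw⟩ := nonempty_iff_ne_empty.2 hemp
    have hins : insert w H = E a ∩ E b := by
      refine Subset.antisymm (insert_subset hw.1 hHD) fun x hx => ?_
      by_cases hxH : x ∈ H
      · exact Or.inr hxH
      · exact Or.inl (hone ⟨hx, hxH⟩ hw)
    have hcomp : CompactSpace ↥(insert w H) := by
      rw [hins]; exact isCompact_iff_compactSpace.1 hD
    let f : H → ↥(insert w H) := fun x => ⟨x.1, Or.inr x.2⟩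
    have hf : IsEmbedding f := by
      refine .of_comp (Continuous.subtype_mk continuous_subtype_val _) continuous_subtype_val ?_
      exact IsEmbedding.subtypeVal
    have hrange : range f = {(⟨w, Or.inl rfl⟩ : ↥(insert w H))}ᶜ := by
      ext x
      constructor
      · rintro ⟨y, rfl⟩ h
        have h1 : y.1 = w := congrArg Subtype.val h
        exact hw.2 (h1 ▸ y.2)
      · exact fun h => ⟨⟨x.1, x.2.resolve_left fun h' => h (Subtype.ext h')⟩, rfl⟩
    refine ⟨w, hw.2, OnePoint.equivOfIsEmbeddingOfRangeEq _ f hf hrange, ?_, fun y => ?_⟩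
    · rw [OnePoint.equivOfIsEmbeddingOfRangeEq_apply_infty]
    · rw [OnePoint.equivOfIsEmbeddingOfRangeEq_apply_coe]

/-- Turn transversals inside `H` are open in it because tunnels are open and `H` has finite image at
every level. They are arbitrarily small since around a point of `H` there are deep standard
neighborhoods inside the tunnel. -/
theorem isTopologicalBasis_turnTransversal (hst : ζ.IsStabilized) (hζ : ζ.IsProper)
    {H : Set ζ.X} (hH : ζ.IsTurnTransversal H) : TopologicalSpace.IsTopologicalBasis
      {B : Set ↥H | ζ.IsTurnTransversal (Subtype.val '' B)} := by
  obtain ⟨K, V, p, m, c, η, a, b, q, hV, hc, hab, hq, rfl⟩ := (isTurnTransversal_iff hst hζ).1 hH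
  have htun := hV.isOpen_turnTunnel hst hζ hc hab
  refine TopologicalSpace.isTopologicalBasis_of_isOpen_of_nhds ?_ ?_
  · intro B hB
    obtain ⟨K', V', p', m', c', η', a', b', q', hV', hc', hab', -, he⟩ :=
      (isTurnTransversal_iff hst hζ).1 hB
    -- Finiteness makes the condition of lying over `q'` relatively open in `H`, whichever of the
    -- two levels is deeper.
    have hfin : (ζ.proj K' '' {z | z ∈ ζ.turnTunnel (turnSet p c a b) ∧ ζ.proj K z = q}).Finite := by
      rcases le_total K K' with h | h
      · refine (ζ.finite_fiber h q).subset ?_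
        rintro _ ⟨x, ⟨-, hx⟩, rfl⟩
        show ζ.map h (ζ.proj K' x) = q
        rw [map_proj, hx]
      · refine (finite_singleton (ζ.map h q)).subset ?_
        rintro _ ⟨x, ⟨-, hx⟩, rfl⟩
        rw [mem_singleton_iff, ← hx, map_proj]
    have hcl := (hfin.subset (sdiff_subset (t := {q'}))).isClosed
    have : B = Subtype.val ⁻¹' (ζ.turnTunnel (turnSet p' c' a' b') ∩ (ζ.proj K' ⁻¹'
        (ζ.proj K' '' {z | z ∈ ζ.turnTunnel (turnSet p c a b) ∧ ζ.proj K z = q} \ {q'}))ᶜ) := by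
      ext x
      have hx : x ∈ B ↔ x.1 ∈ Subtype.val '' B := Subtype.val_injective.mem_set_image.symm
      rw [hx, he]
      refine and_congr_right fun _ => ⟨fun h h' => h'.2 h, fun h => ?_⟩
      by_contra hne
      exact h ⟨⟨x.1, x.2, rfl⟩, hne⟩
    rw [this]
    exact ((hV'.isOpen_turnTunnel hst hζ hc' hab').inter
      (hcl.preimage (continuous_proj K')).isOpen_compl).preimage continuous_subtype_val
  · rintro ⟨x, hxT, hxq⟩ U hxU hU
    obtain ⟨U', hU', rfl⟩ := isOpen_induced_iff.1 hU
    -- With `K ≤ K'` and the center at the projection of `x`, the transversal over the center has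
    -- constant projection `q` at level `K` and so lies in `H`.
    obtain ⟨K', hK', V', hV', hsub⟩ := exists_standardNhd hζ x
      ((hU'.inter htun).mem_nhds ⟨hxU, hxT⟩) K
    obtain ⟨m', c', η', hc'⟩ := hV'.exists_chart
    have hL' := hV'.starLift_proj hc'
    have hxs : x ∉ ζ.Sing := by
      obtain ⟨L, hT, hxL⟩ := hxT
      exact disjoint_left.1 ((isLeafSegment_iff hst hζ).1 hT.1).2 hxL
    obtain ⟨a', ha', b', hb', hab'⟩ := hV'.nontrivial_ends hst hc' (z := x) rfl
    have hends : ends c' (ζ.proj K') x = {a', b'} := by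
      refine (eq_of_subset_of_ncard_le ?_ ?_ (toFinite _)).symm
      · rintro d (rfl | rfl)
        exacts [ha', hb']
      · rw [ncard_pair hab']
        exact not_lt.1 (mt (hV'.mem_Sing_iff hst hc' rfl).2 hxs)
    have hxT' : x ∈ ζ.turnTunnel (turnSet (ζ.proj K' x) c' a' b') :=
      (hV'.mem_turnTunnel hst hζ hc' hab').2 ⟨hV'.mem, by rw [hL'.retr_fiber rfl, hends]⟩
    have hsubT : ∀ y, y ∈ ζ.turnTunnel (turnSet (ζ.proj K' x) c' a' b') →
        y ∈ U' ∩ ζ.turnTunnel (turnSet p c a b) := fun y hy =>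
      hsub ((hV'.mem_turnTunnel hst hζ hc' hab').1 hy).1
    refine ⟨{y | y.1 ∈ ζ.turnTunnel (turnSet (ζ.proj K' x) c' a' b') ∧
      ζ.proj K' y.1 = ζ.proj K' x}, ?_, ⟨hxT', rfl⟩, fun y hy => (hsubT _ hy.1).1⟩
    refine (isTurnTransversal_iff hst hζ).2 ⟨K', V', _, m', c', η', a', b', ζ.proj K' x, hV', hc',
      hab', Or.inl rfl, ?_⟩
    ext y
    constructor
    · rintro ⟨y, hy, rfl⟩; exact hy
    · rintro hy
      refine ⟨⟨y, (hsubT _ hy.1).2, ?_⟩, hy, rfl⟩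
      rw [← map_proj hK' y, hy.2, map_proj, hxq]

end SplitSequence
-- Leaves and partial leaves as path components.
namespace SplitSequence

variable {n : ℕ} {ζ : SplitSequence.{u} n}

theorem finite_optimal (hζ : ζ.IsProper) : {p : ζ.G 0 | ζ.IsOptimalPoint p}.Finite := by
  have h1 := finite_special hζ 0
  refine (h1.union (finite_midpoints (ζ.core 0).valence
    (h1.subset fun p hp => IsSpecial.of_isNatural hp))).subset ?_
  rintro p (hp | hp)
  · exact Or.inl hp
  · exact Or.inr hp

/-- The optimal points subdivide `G 0`. There is a natural one since `G 0` is the target of a fold,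
and the midpoints remove the loops. The open stars of this subdivision are star sets, they cover,
and they are maximal by connectedness. -/
theorem exists_mem_isOptimalStarNhd (hζ : ζ.IsProper) (x : ζ.G 0) :
    ∃ V p, ζ.IsOptimalStarNhd V p ∧ x ∈ V := by
  let F : Set (ζ.G 0) := {p | ζ.IsOptimalPoint p}
  have hfin : F.Finite := finite_optimal hζ
  have hG := (ζ.core 0).valence
  have hF : ∀ p, IsNatural p → p ∈ F := fun p hp => Or.inl (.of_isNatural hp)
  obtain ⟨v, hv⟩ := (ζ.fold 0).exists_isNatural_target (ζ.core 1).valence hG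
  obtain ⟨p, hp, hx⟩ := exists_mem_edgeStar hG hF hfin ⟨v, hF v hv⟩ x
  have hloop : ∀ e ℓ, IsEdgeArc F e ℓ → e 0 ≠ e ℓ := fun e ℓ he =>
    he.initial_ne_terminal hG hF hfin ⟨v, hv⟩ fun e ℓ h1 h2 => Or.inr ⟨e, ℓ, h1, h2, rfl⟩
  refine ⟨edgeStar F p, p, ⟨⟨⟨isOpen_edgeStar hG hF hfin hp,
    isStarSet_edgeStar hG hF hfin hp hloop, fun q hq hne hs => ?_⟩, hp, fun q hq hne hs => ?_⟩,
    fun W hW hsub => hsub.2 ?_⟩, hx⟩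
  · exact hne (edgeStar_inter_subset hq (Or.inl hs))
  · exact hne (edgeStar_inter_subset hq hs)
  · obtain ⟨m, hm⟩ := hW.1.2.1
    obtain ⟨σ, η, hch⟩ := hm.exists_chart
    refine subset_edgeStar hG hF hfin hp hch.isPathConnected.isConnected.isPreconnected
      hch.center_mem fun y hy hyF => ?_
    by_contra hne
    exact hW.2.2 y hy hne hyF

/-! ### Concatenations -/

/-- Two members of a class of sets whose intersection contains a leaf segment. -/
def Adjacent (ζ : SplitSequence.{u} n) (C : Set ζ.X → Prop) (A B : Set ζ.X) : Prop :=
  C A ∧ C B ∧ ∃ L, ζ.IsLeafSegment L ∧ L ⊆ A ∩ B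

theorem Adjacent.symm {C : Set ζ.X → Prop} {A B : Set ζ.X} (h : ζ.Adjacent C A B) :
    ζ.Adjacent C B A := by
  obtain ⟨h1, h2, L, hL, hsub⟩ := h
  exact ⟨h2, h1, L, hL, by rwa [inter_comm]⟩

theorem exists_chain {C : Set ζ.X → Prop} {A B : Set ζ.X} (hA : C A)
    (h : Relation.ReflTransGen (ζ.Adjacent C) A B) :
    ∃ (m : ℕ) (V : Fin (m + 1) → Set ζ.X), (∀ i, C (V i)) ∧
      (∀ i : Fin m, ∃ L, ζ.IsLeafSegment L ∧ L ⊆ V i.castSucc ∩ V i.succ) ∧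
      V 0 = A ∧ V (Fin.last m) = B := by
  induction h with
  | refl => exact ⟨0, fun _ => A, fun _ => hA, fun i => i.elim0, rfl, rfl⟩
  | @tail B D _ hBD ih =>
    obtain ⟨m, V, h1, h2, h3, h4⟩ := ih
    refine ⟨m + 1, Fin.snoc (α := fun _ => Set ζ.X) V D, ?_, ?_, ?_, ?_⟩
    · intro i
      induction i using Fin.lastCases with
      | last => rw [Fin.snoc_last]; exact hBD.2.1
      | cast i => rw [Fin.snoc_castSucc]; exact h1 i
    · intro i
      induction i using Fin.lastCases with
      | last =>
        rw [Fin.snoc_castSucc, Fin.succ_last, Fin.snoc_last, h4]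
        exact hBD.2.2
      | cast i =>
        rw [Fin.snoc_castSucc, Fin.succ_castSucc, Fin.snoc_castSucc]
        exact h2 i
    · rw [← Fin.castSucc_zero, Fin.snoc_castSucc, h3]
    · rw [Fin.snoc_last]

/-- Adjacency is symmetric, so any two members of a chain are joined by a chain beginning at the
first and ending at the second. -/
theorem inConcatenation_iff {C : Set ζ.X → Prop} {x y : ζ.X} :
    ζ.InConcatenation C x y ↔
      ∃ A B, C A ∧ x ∈ A ∧ y ∈ B ∧ Relation.ReflTransGen (ζ.Adjacent C) A B := by
  constructor
  · rintro ⟨m, V, hC, hL, hx, hy⟩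
    obtain ⟨i, hi⟩ := mem_iUnion.1 hx
    obtain ⟨j, hj⟩ := mem_iUnion.1 hy
    refine ⟨V i, V j, hC i, hi, hj, ?_⟩
    have h0 : ∀ i, Relation.ReflTransGen (ζ.Adjacent C) (V 0) (V i) := by
      intro i
      induction i using Fin.induction with
      | zero => exact .refl
      | succ i ih => exact ih.tail ⟨hC _, hC _, hL i⟩
    have hsymm : ∀ {A B}, Relation.ReflTransGen (ζ.Adjacent C) A B →
        Relation.ReflTransGen (ζ.Adjacent C) B A := fun h => by
      induction h with
      | refl => exact .refl
      | tail _ h ih => exact ih.head h.symm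
    exact (hsymm (h0 i)).trans (h0 j)
  · rintro ⟨A, B, hA, hx, hy, h⟩
    obtain ⟨m, V, h1, h2, rfl, rfl⟩ := exists_chain hA h
    exact ⟨m, V, h1, h2, mem_iUnion.2 ⟨0, hx⟩, mem_iUnion.2 ⟨_, hy⟩⟩

theorem IsStandardPlaque.nonempty {P : Set ζ.X} (h : ζ.IsStandardPlaque P) : P.Nonempty := by
  obtain ⟨O, -, x, hx, rfl⟩ := h
  exact ⟨x, mem_pathComponentIn_self hx⟩

theorem IsPlaqueOf.eq_pathComponentIn {O P : Set ζ.X} (h : ζ.IsPlaqueOf O P) {x : ζ.X}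
    (hx : x ∈ P) : x ∈ O ∧ P = pathComponentIn O x := by
  obtain ⟨w, hw, rfl⟩ := h
  have h1 : x ∈ O := pathComponentIn_subset hx
  exact ⟨h1, (pathComponentIn_congr hx).symm⟩

/-- The concatenation classes of a class of plaques covering `U` are the path components of `U`. -/
theorem setOf_inConcatenation_eq {C : Set ζ.X → Prop} {U : Set ζ.X}
    (hpath : ∀ P, C P → IsPathConnected P ∧ P ⊆ U)
    (hcov : ∀ x ∈ U, ∃ O, IsOpen O ∧ x ∈ O ∧ C (pathComponentIn O x))
    (hmeet : ∀ P Q, C P → C Q → (P ∩ Q).Nonempty → ∃ L, ζ.IsLeafSegment L ∧ L ⊆ P ∩ Q)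
    {x : ζ.X} (hx : x ∈ U) :
    {y | ζ.InConcatenation C x y} = pathComponentIn U x := by
  have hC : ∀ {A B}, C A → Relation.ReflTransGen (ζ.Adjacent C) A B → C B := fun hA h => by
    induction h with
    | refl => exact hA
    | tail _ h _ => exact h.2.1
  -- A chain ending in a member through `w` can be prolonged by `P`, since members that meet share a
  -- leaf segment.
  have hext : ∀ {w w' P}, ζ.InConcatenation C x w → C P → w ∈ P → w' ∈ P →
      ζ.InConcatenation C x w' := fun {w w' P} h hP hw hw' => by
    obtain ⟨A, B, hA, hxA, hwB, hAB⟩ := inConcatenation_iff.1 h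
    have hB := hC hA hAB
    exact inConcatenation_iff.2 ⟨A, P, hA, hxA, hw', hAB.tail ⟨hB, hP, hmeet B P hB hP
      ⟨w, hwB, hw⟩⟩⟩
  ext y
  constructor
  · intro h
    obtain ⟨A, B, hA, hxA, hyB, hAB⟩ := inConcatenation_iff.1 h
    have : B ⊆ pathComponentIn U x := by
      clear hyB h
      induction hAB with
      | refl => exact (hpath A hA).1.subset_pathComponentIn hxA (hpath A hA).2
      | @tail B D _ hBD ih =>
        obtain ⟨hB, hD, L, hL, hsub⟩ := hBD
        obtain ⟨w, hw⟩ := hL.2.1.nonempty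
        rw [← pathComponentIn_congr (ih (hsub hw).1)]
        exact (hpath D hD).1.subset_pathComponentIn (hsub hw).2 (hpath D hD).2
    exact this hyB
  · intro h
    obtain ⟨γ, hγ⟩ := h
    have : LocallyPathConnectedSpace unitInterval := (convex_Icc 0 1).locallyPathConnectedSpace
    -- A short piece of the path lies in a single plaque of the class, so membership in the
    -- concatenation class is locally constant along the path.
    have hloc : ∀ t : unitInterval, ∀ᶠ s in 𝓝 t,
        (ζ.InConcatenation C x (γ s) ↔ ζ.InConcatenation C x (γ t)) := by
      intro t
      obtain ⟨O, hO, htO, hP⟩ := hcov _ (hγ t)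
      have hnhds : γ ⁻¹' O ∈ 𝓝 t := (hO.preimage γ.continuous).mem_nhds htO
      obtain ⟨J, ⟨hJ, hJc⟩, hJO⟩ := (LocallyPathConnectedSpace.path_connected_basis t).mem_iff.1 hnhds
      filter_upwards [hJ] with s hs
      have hsub : γ '' J ⊆ pathComponentIn O (γ t) :=
        (hJc.image γ.continuous).subset_pathComponentIn ⟨t, mem_of_mem_nhds hJ, rfl⟩
          (image_subset_iff.2 hJO)
      have hsP := hsub ⟨s, hs, rfl⟩
      have htP := mem_pathComponentIn_self htO
      exact ⟨fun h => hext h hP hsP htP, fun h => hext h hP htP hsP⟩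
    have hcl : IsClopen {t : unitInterval | ζ.InConcatenation C x (γ t)} := by
      refine ⟨isOpen_compl_iff.1 (isOpen_iff_mem_nhds.2 fun t ht => ?_),
        isOpen_iff_mem_nhds.2 fun t ht => ?_⟩
      · filter_upwards [hloc t] with s hs h
        exact ht (hs.1 h)
      · filter_upwards [hloc t] with s hs
        exact hs.2 ht
    have h0 : (0 : unitInterval) ∈ {t : unitInterval | ζ.InConcatenation C x (γ t)} := by
      obtain ⟨O, hO, hxO, hP⟩ := hcov x hx
      have := mem_pathComponentIn_self hxO
      show ζ.InConcatenation C x (γ 0)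
      rw [γ.source]
      exact inConcatenation_iff.2 ⟨_, _, hP, this, this, .refl⟩
    have h1 : (1 : unitInterval) ∈ {t : unitInterval | ζ.InConcatenation C x (γ t)} := by
      rw [hcl.eq_univ ⟨0, h0⟩]; trivial
    have h2 : ζ.InConcatenation C x (γ 1) := h1
    rwa [γ.target] at h2

theorem isOpen_compl_Sing (hst : ζ.IsStabilized) (hζ : ζ.IsProper) : IsOpen ζ.Singᶜ :=
  (finite_Sing hst hζ).isClosed.isOpen_compl

theorem exists_isStandardNhd (hζ : ζ.IsProper) (x : ζ.X) {W : Set ζ.X} (hW : W ∈ 𝓝 x) :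
    ∃ O, ζ.IsStandardNhd O ∧ x ∈ O ∧ O ⊆ W := by
  obtain ⟨K, -, V, hV, hsub⟩ := exists_standardNhd hζ x hW 0
  exact ⟨_, hV.isStandardNhd, hV.mem, hsub⟩

theorem isLeafSegment_of_subset (hst : ζ.IsStabilized) (hζ : ζ.IsProper) {O : Set ζ.X}
    (hO : ζ.IsStandardNhd O) (hsub : O ⊆ ζ.Singᶜ) {x : ζ.X} (hx : x ∈ O) :
    ζ.IsLeafSegment (pathComponentIn O x) :=
  (isLeafSegment_iff hst hζ).2 ⟨⟨O, hO, x, hx, rfl⟩,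
    disjoint_left.2 fun _ hy hs => hsub (pathComponentIn_subset hy) hs⟩

/-- The point `x` may be singular, so a point on a prong of its plaque is used instead. It is not
singular and has a standard neighborhood in `W` without singularities. -/
theorem exists_isLeafSegment_subset (hst : ζ.IsStabilized) (hζ : ζ.IsProper) {W : Set ζ.X}
    (hW : IsOpen W) {x : ζ.X} (hx : x ∈ W) :
    ∃ L, ζ.IsLeafSegment L ∧ L ⊆ pathComponentIn W x := by
  obtain ⟨O, hO, hxO, hOW⟩ := exists_isStandardNhd hζ x (hW.mem_nhds hx)
  obtain ⟨k, z, σ, η, hk, hch, -, hns⟩ := hO.exists_chart hst hζ hxO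
  have hI : (1 / 2 : ℝ) ∈ Ioo (0 : ℝ) 1 := StarLift.half_mem
  let j : Fin k := ⟨0, by omega⟩
  have hy := hch.mem j (Ioo_subset_Ico_self hI)
  have hys := hns _ hy (hch.σ_ne hI)
  have hyO : σ j (1 / 2) ∈ O := pathComponentIn_subset hy
  obtain ⟨O', hO', hyO', hsub⟩ := exists_isStandardNhd hζ (σ j (1 / 2))
    ((hO.isOpen.inter (isOpen_compl_Sing hst hζ)).mem_nhds ⟨hyO, hys⟩)
  refine ⟨_, isLeafSegment_of_subset hst hζ hO' (fun w hw => (hsub hw).2) hyO', ?_⟩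
  have h1 : pathComponentIn O x ⊆ pathComponentIn W x := pathComponentIn_mono hOW
  refine Subset.trans ?_ h1
  rw [← pathComponentIn_congr hy]
  exact pathComponentIn_mono fun w hw => (hsub hw).1

theorem exists_isLeafSegment_inter (hst : ζ.IsStabilized) (hζ : ζ.IsProper) {O O' P Q : Set ζ.X}
    (hO : IsOpen O) (hO' : IsOpen O') (hP : ζ.IsPlaqueOf O P) (hQ : ζ.IsPlaqueOf O' Q)
    (hne : (P ∩ Q).Nonempty) : ∃ L, ζ.IsLeafSegment L ∧ L ⊆ P ∩ Q := by
  obtain ⟨x, hxP, hxQ⟩ := hne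
  obtain ⟨h1, rfl⟩ := hP.eq_pathComponentIn hxP
  obtain ⟨h2, rfl⟩ := hQ.eq_pathComponentIn hxQ
  obtain ⟨L, hL, hsub⟩ := exists_isLeafSegment_subset hst hζ (hO.inter hO') ⟨h1, h2⟩
  exact ⟨L, hL, hsub.trans (subset_inter (pathComponentIn_mono inter_subset_left)
    (pathComponentIn_mono inter_subset_right))⟩

theorem isLeaf_iff (hst : ζ.IsStabilized) (hζ : ζ.IsProper) (L : Set ζ.X) :
    ζ.IsLeaf L ↔ ∃ x, L = pathComponent x := by
  refine exists_congr fun x => ?_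
  have := setOf_inConcatenation_eq (C := ζ.IsOptimalPlaque) (U := univ) ?_ ?_ ?_ (mem_univ x)
  · rw [pathComponentIn_univ] at this
    rw [← this]; rfl
  · rintro P ⟨V, p, -, y, hy, rfl⟩
    exact ⟨isPathConnected_pathComponentIn hy, subset_univ _⟩
  · intro y _
    obtain ⟨V, p, hV, hy⟩ := exists_mem_isOptimalStarNhd hζ (ζ.proj 0 y)
    exact ⟨_, hV.1.1.1.preimage (continuous_proj 0), hy, V, p, hV, y, hy, rfl⟩
  · rintro P Q ⟨V, p, hV, hP⟩ ⟨V', p', hV', hQ⟩ hne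
    exact exists_isLeafSegment_inter hst hζ (hV.1.1.1.preimage (continuous_proj 0))
      (hV'.1.1.1.preimage (continuous_proj 0)) hP hQ hne

theorem isPartialLeaf_iff (hst : ζ.IsStabilized) (hζ : ζ.IsProper) (L : Set ζ.X) :
    ζ.IsPartialLeaf L ↔ ∃ x ∈ ζ.Singᶜ, L = pathComponentIn ζ.Singᶜ x := by
  refine exists_congr fun x => and_congr_right fun hx => ?_
  have hleaf := fun L => (isLeafSegment_iff (L := L) hst hζ).1
  have := setOf_inConcatenation_eq (C := ζ.IsLeafSegment) (U := ζ.Singᶜ) ?_ ?_ ?_ hx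
  · have h2 : {y | y ∉ ζ.Sing ∧ ζ.LeafEquiv x y} = pathComponentIn ζ.Singᶜ x := by
      rw [← this]
      refine Subset.antisymm (fun y hy => hy.2) fun y hy => ⟨?_, hy⟩
      rw [this] at hy
      exact pathComponentIn_subset hy
    rw [h2]
  · intro P hP
    obtain ⟨⟨O, hO, y, hy, rfl⟩, hd⟩ := hleaf P hP
    exact ⟨isPathConnected_pathComponentIn hy, hd.subset_compl_right⟩
  · intro y hy
    obtain ⟨O, hO, hyO, hsub⟩ := exists_isStandardNhd hζ y
      ((isOpen_compl_Sing hst hζ).mem_nhds hy)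
    exact ⟨O, hO.isOpen, hyO, isLeafSegment_of_subset hst hζ hO hsub hyO⟩
  · intro P Q hP hQ hne
    obtain ⟨⟨O, hO, hPO⟩, -⟩ := hleaf P hP
    obtain ⟨⟨O', hO', hQO⟩, -⟩ := hleaf Q hQ
    exact exists_isLeafSegment_inter hst hζ hO.isOpen hO'.isOpen hPO hQO hne

end SplitSequence

/-! ### Star sets under embeddings, and countability of chains. -/

theorem isStarSet_image_iff {Y Z : Type*} [TopologicalSpace Y] [TopologicalSpace Z] {f : Y → Z}
    {S : Set Y} (hf : IsEmbedding (S.domRestrict f)) {n : ℕ} {c : Y} (hc : c ∈ S) :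
    IsStarSet (f '' S) n (f c) ↔ IsStarSet S n c := by
  have hr : range (S.domRestrict f) = f '' S := range_domRestrict f S
  let e : S ≃ₜ ↥(f '' S) := hf.toHomeomorph.trans (Homeomorph.setCongr hr)
  have he : ∀ y : S, (e y : Z) = f y := fun y => rfl
  refine and_congr_right fun _ => ⟨?_, ?_⟩
  · rintro ⟨h, hh⟩
    refine ⟨h.trans e.symm, ?_⟩
    have : h (ModelStar.center n) = e ⟨c, hc⟩ := Subtype.ext (by rw [hh, he])
    simp [this]
  · rintro ⟨h, hh⟩
    refine ⟨h.trans e, ?_⟩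
    rw [Homeomorph.trans_apply, he, hh]

theorem isStarSet_coe_image_iff {Y : Type*} [TopologicalSpace Y] {L : Set Y} {S : Set L} {n : ℕ}
    {c : L} (hc : c ∈ S) : IsStarSet (Subtype.val '' S) n (c : Y) ↔ IsStarSet S n c :=
  isStarSet_image_iff (f := Subtype.val) (IsEmbedding.subtypeVal.comp IsEmbedding.subtypeVal) hc

theorem IsStarSet.center_mem {Y : Type*} [TopologicalSpace Y] {S : Set Y} {n : ℕ} {c : Y}
    (h : IsStarSet S n c) : c ∈ S := by
  obtain ⟨-, e, rfl⟩ := h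
  exact (e _).2

theorem nonempty_modelStar_two_homeo : Nonempty (ModelStar 2 ≃ₜ ℝ) := by
  have h : IsStarChart (Metric.ball (0 : ℝ) 1) 0
      (fun (j : Fin 2) t => if j = 0 then t else -t) (fun x => |x|) := by
    refine ⟨fun j => ?_, fun j => ?_, by fun_prop, by simp, fun j t ht => ?_, fun y => ?_,
      fun j k t ht he => ?_⟩
    · fin_cases j
      · exact continuousOn_id
      · exact continuousOn_neg
    · fin_cases j <;> simp
    · fin_cases j <;> simp [abs_of_nonneg ht.1]
    · rw [Metric.mem_ball, dist_zero_right, Real.norm_eq_abs]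
      constructor
      · intro h
        rcases lt_trichotomy y 0 with hy | hy | hy
        · exact Or.inr ⟨1, -y, ⟨by linarith, by rwa [abs_of_neg hy] at h⟩, by simp⟩
        · exact Or.inl hy
        · exact Or.inr ⟨0, y, ⟨hy, by rwa [abs_of_pos hy] at h⟩, by simp⟩
      · rintro (rfl | ⟨j, t, ht, rfl⟩)
        · simp
        · fin_cases j <;> simp [abs_of_pos ht.1, ht.2]
    · have := ht.1
      fin_cases j <;> fin_cases k <;> simp at he ⊢ <;> linarith
  obtain ⟨e, -⟩ := h.exists_homeo
  exact ⟨e.trans Homeomorph.unitBall.symm⟩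

/-- Away from the center there is a two-pronged substar centered at the point, to which the central
case applies. Thus plaques cut out relatively open sets of a star. -/
theorem IsStarChart.pathComponentIn_mem_nhdsWithin' {Y ι : Type*} [TopologicalSpace Y] [T2Space Y]
    [Finite ι] {S : Set Y} {z : Y} {σ : ι → ℝ → Y} {η : Y → ℝ} (h : IsStarChart S z σ η) {y : Y}
    (hy : y ∈ S) {N : Set Y} (hN : N ∈ 𝓝 y) : pathComponentIn N y ∈ 𝓝[S] y := by
  by_cases hz : y = z
  · subst hz
    exact h.pathComponentIn_mem_nhdsWithin (mem_nhdsWithin_of_mem_nhds hN)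
  · obtain ⟨ht, j, hj⟩ := h.eq_σ hy hz
    have hδ : 0 < min (η y) (1 - η y) := lt_min ht.1 (by linarith [ht.2])
    have hc := h.interior j ht hδ (min_le_left _ _) (min_le_right _ _)
    have hn := h.prong_mem_nhdsWithin j ht (a := η y - min (η y) (1 - η y))
      (b := η y + min (η y) (1 - η y)) ⟨by linarith, by linarith⟩
    rw [← hj] at hc hn
    have h1 := hc.pathComponentIn_mem_nhdsWithin (mem_nhdsWithin_of_mem_nhds hN)
    have h2 := Filter.mem_of_superset hn (image_mono inter_subset_right)
    rw [← nhdsWithin_inter_of_mem h2] 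
    exact nhdsWithin_mono _ inter_subset_left h1

/-- Near a point off its center, a star has two prongs. -/
theorem IsStarChart.exists_two_pronged {Y ι : Type*} [TopologicalSpace Y] [T2Space Y]
    {S : Set Y} {z : Y} {σ : ι → ℝ → Y} {η : Y → ℝ} (h : IsStarChart S z σ η) {y : Y}
    (hy : y ∈ S) (hz : y ≠ z) : ∃ I ⊆ S, ∃ (τ : Fin 2 → ℝ → Y) (θ : Y → ℝ),
      IsStarChart I y τ θ := by
  obtain ⟨ht, j, hj⟩ := h.eq_σ hy hz
  have hδ : 0 < min (η y) (1 - η y) := lt_min ht.1 (by linarith [ht.2])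
  have hc := h.interior j ht hδ (min_le_left _ _) (min_le_right _ _)
  rw [← hj] at hc
  refine ⟨_, ?_, _, _, hc⟩
  rintro _ ⟨t, ht', rfl⟩
  have h1 := min_le_left (η y) (1 - η y)
  have h2 := min_le_right (η y) (1 - η y)
  exact h.mem j ⟨by linarith [ht'.1], by linarith [ht'.2]⟩

theorem countable_reflTransGen {α : Type*} {r : α → α → Prop} (h : ∀ a, {b | r a b}.Countable)
    (a : α) : {b | Relation.ReflTransGen r a b}.Countable := by
  let T : ℕ → Set α := fun k => Nat.rec {a} (fun _ s => ⋃ b ∈ s, {d | r b d}) k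
  have hT : ∀ k, (T k).Countable := fun k => by
    induction k with
    | zero => exact countable_singleton a
    | succ k ih => exact ih.biUnion fun b _ => h b
  refine (countable_iUnion hT).mono fun b hb => ?_
  induction hb with
  | refl => exact mem_iUnion.2 ⟨0, rfl⟩
  | tail _ hr ih =>
    obtain ⟨k, hk⟩ := mem_iUnion.1 ih
    exact mem_iUnion.2 ⟨k + 1, mem_biUnion hk hr⟩

namespace SplitSequence

variable {n : ℕ} {ζ : SplitSequence.{u} n}

/-- Every point has arbitrarily small standard neighborhoods in which its plaque is a star
centered at the point. -/
theorem exists_centered_plaque (hst : ζ.IsStabilized) (hζ : ζ.IsProper) (x : ζ.X) {W : Set ζ.X}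
    (hW : W ∈ 𝓝 x) : ∃ O, ζ.IsStandardNhd O ∧ x ∈ O ∧ O ⊆ W ∧
      ∃ (k : ℕ) (σ : Fin k → ℝ → ζ.X) (η : ζ.X → ℝ), 2 ≤ k ∧
        IsStarChart (pathComponentIn O x) x σ η ∧ (2 < k ↔ x ∈ ζ.Sing) := by
  obtain ⟨K, -, V, hV, hsub⟩ := exists_standardNhd hζ x hW 0
  obtain ⟨m, c, η, hc⟩ := hV.exists_chart
  obtain ⟨σ, -, hF⟩ := hV.exists_plaque_chart hst hc (z := x) rfl
  refine ⟨_, hV.isStandardNhd, hV.mem, hsub, ?_⟩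
  rw [hV.pathComponentIn_center hc rfl]
  refine ⟨_, _, _, ?_, hF.reindex (Finite.equivFin _).symm, ?_⟩
  · rw [Nat.card_coe_set_eq]
    exact one_lt_ncard_iff_nontrivial.2 (hV.nontrivial_ends hst hc rfl)
  · rw [Nat.card_coe_set_eq, hV.mem_Sing_iff hst hc rfl]

theorem isTopologicalBasis_standardNhd (hζ : ζ.IsProper) :
    TopologicalSpace.IsTopologicalBasis {O : Set ζ.X | ζ.IsStandardNhd O} :=
  TopologicalSpace.isTopologicalBasis_of_isOpen_of_nhds (fun _ hO => hO.isOpen) fun x W hx hW =>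
    exists_isStandardNhd hζ x (hW.mem_nhds hx)

/-! ### Plaques as a basis of `Γ_L`, for a path component `L` of an open set `U`. -/

section GraphImmersion

variable {U L : Set ζ.X}

theorem plaque_subset (hLU : ∀ y ∈ L, pathComponentIn U y = L) {O : Set ζ.X} (hOU : O ⊆ U)
    {y : ζ.X} (hy : y ∈ L) : pathComponentIn O y ⊆ L := by
  have := pathComponentIn_mono (x := y) hOU
  rwa [hLU y hy] at this

theorem image_plaque (hLU : ∀ y ∈ L, pathComponentIn U y = L) {O : Set ζ.X} (hOU : O ⊆ U)
    {y : ζ.X} (hy : y ∈ L) :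
    Subtype.val '' (Subtype.val ⁻¹' pathComponentIn O y : Set L) = pathComponentIn O y := by
  rw [Subtype.image_preimage_coe, inter_eq_right]
  exact plaque_subset hLU hOU hy

/-- A star set of `L` centered at a point of the plaque lies in the plaque near that point, so it
has no more prongs than the plaque has there. -/
theorem isProngMaximal_plaque (hst : ζ.IsStabilized) (hζ : ζ.IsProper)
    (hLU : ∀ y ∈ L, pathComponentIn U y = L) {O : Set ζ.X}
    (hO : ζ.IsStandardNhd O) (hOU : O ⊆ U) {y : ζ.X} (hy : y ∈ L) (hyO : y ∈ O) :
    IsProngMaximal (Subtype.val ⁻¹' pathComponentIn O y : Set L) := by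
  obtain ⟨k, z, σ, η, hk, hch, -, -⟩ := hO.exists_chart hst hζ hyO
  have himg := image_plaque hLU hOU hy
  have hzL : z ∈ L := plaque_subset hLU hOU hy hch.center_mem
  have hcz : (⟨z, hzL⟩ : L) ∈ (Subtype.val ⁻¹' pathComponentIn O y : Set L) := hch.center_mem
  have key : ∀ w ∈ pathComponentIn O y, ∀ W : Set ζ.X, pathComponentIn O y ∈ 𝓝[W] w ↔
      pathComponentIn O w ∈ 𝓝[W] w := fun w hw W => by rw [pathComponentIn_congr hw]
  refine ⟨k, ⟨z, hzL⟩, (isStarSet_coe_image_iff (c := (⟨z, hzL⟩ : L)) hcz).1 ?_, fun m W hW => ?_,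
    fun w hw hne m W hW => ?_⟩
  · rw [himg]; exact hch.isStarSet hk
  · obtain ⟨τ, θ, hτ⟩ := ((isStarSet_coe_image_iff hW.center_mem).2 hW).exists_chart
    have h1 := (hτ.card_le hch ((key z hch.center_mem _).2 (hτ.pathComponentIn_mem_nhdsWithin
      (mem_nhdsWithin_of_mem_nhds (hO.isOpen.mem_nhds (pathComponentIn_subset hch.center_mem)))))).1
    rwa [Nat.card_fin, Nat.card_fin] at h1
  · obtain ⟨τ, θ, hτ⟩ := ((isStarSet_coe_image_iff hW.center_mem).2 hW).exists_chart
    have h1 := hch.card_le_two hτ hw (fun h => hne (Subtype.ext h))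
      ((key _ hw _).2 (hτ.pathComponentIn_mem_nhdsWithin
        (mem_nhdsWithin_of_mem_nhds (hO.isOpen.mem_nhds (pathComponentIn_subset hw)))))
    rwa [Nat.card_fin] at h1

/-- A plaque centered at `y` is a star in `L`, so prong-maximality bounds its prongs by those of `S`
at `y`. Near `y` the set `S` lies in the plaque, and with this count the equality case of `card_le`
makes `S` a neighborhood of `y` in the plaque. A smaller plaque then lies in `S`. -/
theorem exists_plaque_subset_of_isProngMaximal (hst : ζ.IsStabilized) (hζ : ζ.IsProper)
    (hU : IsOpen U) (hLsub : L ⊆ U) (hLU : ∀ y ∈ L, pathComponentIn U y = L) {S : Set L}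
    (hS : IsProngMaximal S) {y : L} (hy : y ∈ S) : ∃ O, ζ.IsStandardNhd O ∧ O ⊆ U ∧ y.1 ∈ O ∧
      Subtype.val ⁻¹' pathComponentIn O y.1 ⊆ S := by
  obtain ⟨s, c, hSc, hmax, htwo⟩ := hS
  obtain ⟨O, hO, hyO, hOU, k, σ, η, hk, hch, -⟩ :=
    exists_centered_plaque hst hζ y.1 (hU.mem_nhds (hLsub y.2))
  have hstar : IsStarSet (Subtype.val ⁻¹' pathComponentIn O y.1 : Set L) k y := by
    refine (isStarSet_coe_image_iff (c := y) (show y ∈ Subtype.val ⁻¹' pathComponentIn O y.1 from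
      hch.center_mem)).1 ?_
    rw [image_plaque hLU hOU y.2]; exact hch.isStarSet hk
  obtain ⟨τ, θ, hτ⟩ := ((isStarSet_coe_image_iff hSc.center_mem).2 hSc).exists_chart
  have hnear : ∀ (W : Set ζ.X) {ι : Type} [Finite ι] {τ : ι → ℝ → ζ.X} {θ : ζ.X → ℝ},
      IsStarChart W y.1 τ θ → pathComponentIn O y.1 ∈ 𝓝[W] y.1 := fun _ _ _ _ _ h =>
    h.pathComponentIn_mem_nhdsWithin (mem_nhdsWithin_of_mem_nhds (hO.isOpen.mem_nhds hyO))
  have hmem : Subtype.val '' S ∈ 𝓝[pathComponentIn O y.1] y.1 := by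
    by_cases hyc : y = c
    · subst hyc
      exact (hτ.card_le hch (hnear _ hτ)).2 (by
        rw [Nat.card_fin, Nat.card_fin]; exact hmax k _ hstar)
    · obtain ⟨I, hIS, τ', θ', hτ'⟩ := hτ.exists_two_pronged ⟨y, hy, rfl⟩
        (fun h => hyc (Subtype.ext h))
      exact Filter.mem_of_superset ((hτ'.card_le hch (hnear _ hτ')).2 (by
        rw [Nat.card_fin, Nat.card_fin]; exact htwo y hy hyc k _ hstar)) hIS
  obtain ⟨N, hN, hyN, hNS⟩ := mem_nhdsWithin.1 hmem
  obtain ⟨O', hO', hyO', hsub⟩ := exists_isStandardNhd hζ y.1 ((hN.inter hO.isOpen).mem_nhds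
    ⟨hyN, hyO⟩)
  refine ⟨O', hO', fun w hw => hOU (hsub hw).2, hyO', fun w hw => ?_⟩
  have h1 : w.1 ∈ N := (hsub (pathComponentIn_subset hw)).1
  have h2 : w.1 ∈ pathComponentIn O y.1 := pathComponentIn_mono (fun w hw => (hsub hw).2) hw
  obtain ⟨w', hw', he⟩ := hNS ⟨h1, h2⟩
  rwa [← Subtype.ext he]

theorem isOpen_graphImmersion_plaque (hst : ζ.IsStabilized) (hζ : ζ.IsProper)
    (hLU : ∀ y ∈ L, pathComponentIn U y = L) {O : Set ζ.X}
    (hO : ζ.IsStandardNhd O) (hOU : O ⊆ U) {y : ζ.X} (hy : y ∈ L) (hyO : y ∈ O) :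
    @IsOpen (GraphImmersion L) _ (Subtype.val ⁻¹' pathComponentIn O y : Set L) :=
  TopologicalSpace.isOpen_generateFrom_of_mem (isProngMaximal_plaque hst hζ hLU hO hOU hy hyO)

theorem isOpen_graphImmersion_iff (hst : ζ.IsStabilized) (hζ : ζ.IsProper)
    (hU : IsOpen U) (hLsub : L ⊆ U) (hLU : ∀ y ∈ L, pathComponentIn U y = L) (S : Set L) :
    @IsOpen (GraphImmersion L) _ S ↔ ∀ y ∈ S, ∃ O, ζ.IsStandardNhd O ∧ O ⊆ U ∧ y.1 ∈ O ∧
      Subtype.val ⁻¹' pathComponentIn O y.1 ⊆ S := by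
  constructor
  · intro h
    induction h with
    | basic S hS => exact fun y hy =>
        exists_plaque_subset_of_isProngMaximal hst hζ hU hLsub hLU hS hy
    | univ =>
      intro y _
      obtain ⟨O, hO, hyO, hOU⟩ := exists_isStandardNhd hζ y.1 (hU.mem_nhds (hLsub y.2))
      exact ⟨O, hO, hOU, hyO, subset_univ _⟩
    | inter S T _ _ ihS ihT =>
      rintro y ⟨hyS, hyT⟩
      obtain ⟨O, hO, hOU, hyO, hsub⟩ := ihS y hyS
      obtain ⟨O', hO', hOU', hyO', hsub'⟩ := ihT y hyT
      obtain ⟨Q, hQ, hyQ, hQsub⟩ := exists_isStandardNhd hζ y.1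
        ((hO.isOpen.inter hO'.isOpen).mem_nhds ⟨hyO, hyO'⟩)
      exact ⟨Q, hQ, fun w hw => hOU (hQsub hw).1, hyQ, fun w hw =>
        ⟨hsub (pathComponentIn_mono (fun w hw => (hQsub hw).1) hw),
          hsub' (pathComponentIn_mono (fun w hw => (hQsub hw).2) hw)⟩⟩
    | sUnion T _ ih =>
      rintro y ⟨S, hS, hy⟩
      obtain ⟨O, hO, hOU, hyO, hsub⟩ := ih S hS y hy
      exact ⟨O, hO, hOU, hyO, hsub.trans (subset_sUnion_of_mem hS)⟩
  · intro h
    refine isOpen_iff_mem_nhds.2 fun y hy => ?_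
    obtain ⟨O, hO, hOU, hyO, hsub⟩ := h y hy
    exact Filter.mem_of_superset ((isOpen_graphImmersion_plaque hst hζ hLU hO hOU y.2
      hyO).mem_nhds (mem_pathComponentIn_self hyO)) hsub

theorem continuous_toSubspace (hst : ζ.IsStabilized) (hζ : ζ.IsProper)
    (hU : IsOpen U) (hLsub : L ⊆ U) (hLU : ∀ y ∈ L, pathComponentIn U y = L) :
    Continuous (GraphImmersion.toSubspace L) := by
  refine continuous_def.2 fun S hS => ?_
  obtain ⟨W, hW, rfl⟩ := isOpen_induced_iff.1 hS
  refine (isOpen_graphImmersion_iff hst hζ hU hLsub hLU _).2 fun y hy => ?_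
  obtain ⟨O, hO, hyO, hsub⟩ := exists_isStandardNhd hζ y.1
    ((hU.inter hW).mem_nhds ⟨hLsub y.2, hy⟩)
  exact ⟨O, hO, fun w hw => (hsub hw).1, hyO, fun w hw => (hsub (pathComponentIn_subset hw)).2⟩

/-- Inside a plaque, which is a star, smaller plaques are neighborhoods for the subspace topology.
Hence the finer topology of `Γ_L` induces the same topology on the plaque. -/
theorem isEmbedding_plaque (hst : ζ.IsStabilized) (hζ : ζ.IsProper)
    (hU : IsOpen U) (hLsub : L ⊆ U) (hLU : ∀ y ∈ L, pathComponentIn U y = L) {O : Set ζ.X}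
    (hO : ζ.IsStandardNhd O) {y : ζ.X} (hyO : y ∈ O) :
    IsEmbedding (Set.domRestrict (α := GraphImmersion L) (Subtype.val ⁻¹' pathComponentIn O y : Set L)
      (GraphImmersion.toSubspace L)) := by
  obtain ⟨k, z, σ, η, hk, hch, -, -⟩ := hO.exists_chart hst hζ hyO
  have hcont := (continuous_toSubspace hst hζ hU hLsub hLU).comp
    (continuous_subtype_val (p := fun w : GraphImmersion L =>
      w ∈ (Subtype.val ⁻¹' pathComponentIn O y : Set L)))
  refine ⟨isInducing_iff_nhds.2 fun w => le_antisymm hcont.continuousAt.le_comap ?_,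
    fun _ _ h => Subtype.ext h⟩
  intro T hT
  obtain ⟨T', hT', hTT⟩ := mem_nhds_subtype _ _ _ |>.1 hT
  obtain ⟨S, hST, hS, hwS⟩ := mem_nhds_iff.1 hT'
  obtain ⟨Q, hQ, hQU, hwQ, hQS⟩ := (isOpen_graphImmersion_iff hst hζ hU hLsub hLU S).1 hS _ hwS
  have h1 := hch.pathComponentIn_mem_nhdsWithin' w.2 (hQ.isOpen.mem_nhds hwQ)
  obtain ⟨N, hN, hwN, hNsub⟩ := mem_nhdsWithin.1 h1
  refine Filter.mem_comap.2 ⟨Subtype.val ⁻¹' N, (hN.preimage continuous_subtype_val).mem_nhds hwN,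
    fun v hv => hTT (hST (hQS (hNsub ⟨hv, v.2⟩)))⟩

/-- Plaques of a countable basis of standard neighborhoods already reach all of `L` by chains. Each
plaque is adjacent to countably many others, so countably many plaques cover `L`; they are open in
`Γ_L` and second countable as embedded subspaces. -/
theorem secondCountable_graphImmersion (hst : ζ.IsStabilized) (hζ : ζ.IsProper)
    (hU : IsOpen U) {x : ζ.X} (hx : x ∈ U) :
    SecondCountableTopology (GraphImmersion (pathComponentIn U x)) := by
  have hLsub : pathComponentIn U x ⊆ U := pathComponentIn_subset
  have hLU : ∀ y ∈ pathComponentIn U x, pathComponentIn U y = pathComponentIn U x :=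
    fun y hy => pathComponentIn_congr hy
  obtain ⟨𝒪, h𝒪, hcount, hbasis⟩ := (isTopologicalBasis_standardNhd hζ).exists_countable
  let C : Set ζ.X → Prop := fun P => ∃ O ∈ 𝒪, O ⊆ U ∧ ζ.IsPlaqueOf O P
  have hchain := setOf_inConcatenation_eq (C := C) (U := U) ?_ ?_ ?_ hx
  rotate_left
  · rintro P ⟨O, -, hOU, y, hy, rfl⟩
    exact ⟨isPathConnected_pathComponentIn hy, pathComponentIn_subset.trans hOU⟩
  · intro y hy
    obtain ⟨O, hO, hyO, hOU⟩ := hbasis.exists_subset_of_mem_open hy hU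
    exact ⟨O, (h𝒪 hO).isOpen, hyO, O, hO, hOU, y, hyO, rfl⟩
  · rintro P Q ⟨O, hO, -, hP⟩ ⟨O', hO', -, hQ⟩ hne
    exact exists_isLeafSegment_inter hst hζ (h𝒪 hO).isOpen (h𝒪 hO').isOpen hP hQ hne
  have hstart : {A | C A ∧ x ∈ A}.Countable := by
    refine (hcount.image fun O => pathComponentIn O x).mono ?_
    rintro A ⟨⟨O, hO, -, hP⟩, hxA⟩
    exact ⟨O, hO, (hP.eq_pathComponentIn hxA).2.symm⟩
  have hadj : ∀ A, {B | ζ.Adjacent C A B}.Countable := by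
    intro A
    by_cases hA : C A
    swap
    · have : {B | ζ.Adjacent C A B} = ∅ := eq_empty_of_forall_notMem fun B hB => hA hB.1
      rw [this]; exact countable_empty
    obtain ⟨O, hO, -, y, hy, rfl⟩ := hA
    obtain ⟨k, z, σ, η, hk, hch, -, -⟩ := (h𝒪 hO).exists_chart hst hζ hy
    have hsub : {B | ζ.Adjacent C (pathComponentIn O y) B} ⊆ ⋃ O' ∈ 𝒪,
        {B | ζ.IsPlaqueOf O' B ∧ (pathComponentIn O y ∩ B).Nonempty} := by
      rintro B ⟨-, ⟨O', hO', -, hB⟩, D, hD, hDs⟩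
      exact mem_biUnion hO' ⟨hB, hD.2.1.nonempty.mono hDs⟩
    refine (hcount.biUnion fun O' hO' => ?_).mono hsub
    -- Different plaques of one neighborhood cut the given plaque in disjoint nonempty relatively
    -- open sets, and a separable space has only countably many of these.
    refine Set.PairwiseDisjoint.countable_of_isOpen
      (s := fun B : Set ζ.X => (Subtype.val ⁻¹' B : Set (pathComponentIn O y))) ?_ ?_ ?_
    · rintro B ⟨hB, -⟩ B' ⟨hB', -⟩ hne
      refine disjoint_left.2 fun w hw hw' => hne ?_
      rw [(hB.eq_pathComponentIn hw).2, (hB'.eq_pathComponentIn hw').2]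
    · rintro B ⟨hB, -⟩
      rw [isOpen_iff_mem_nhds]
      intro w hw
      obtain ⟨hwO', hBe⟩ := hB.eq_pathComponentIn hw
      rw [preimage_coe_mem_nhds_subtype, hBe]
      exact hch.pathComponentIn_mem_nhdsWithin' w.2 ((h𝒪 hO').isOpen.mem_nhds hwO')
    · rintro B ⟨-, w, hwA, hwB⟩
      exact ⟨⟨w, hwA⟩, hwB⟩
  let R : Set (Set ζ.X) := ⋃ A ∈ {A | C A ∧ x ∈ A}, {B | Relation.ReflTransGen (ζ.Adjacent C) A B}
  have hR : R.Countable := hstart.biUnion fun A _ => countable_reflTransGen hadj A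
  have hRC : ∀ B ∈ R, C B := by
    intro B hB
    obtain ⟨A, ⟨hA, -⟩, hAB⟩ := mem_iUnion₂.1 hB
    rcases Relation.ReflTransGen.cases_tail hAB with h | ⟨D, -, h⟩
    · rwa [h]
    · exact h.2.1
  have hRL : ∀ y ∈ pathComponentIn U x, ∃ B ∈ R, y ∈ B := by
    intro y hy
    rw [← hchain] at hy
    obtain ⟨A, B, hA, hxA, hyB, hAB⟩ := inConcatenation_iff.1 hy
    exact ⟨B, mem_biUnion (show A ∈ {A | C A ∧ x ∈ A} from ⟨hA, hxA⟩) hAB, hyB⟩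
  let R' : Set (Set ζ.X) := {B ∈ R | (B ∩ pathComponentIn U x).Nonempty}
  have hQ : Countable R' := (hR.mono fun B hB => hB.1).to_subtype
  let G : R' → Set (GraphImmersion (pathComponentIn U x)) := fun B =>
    (Subtype.val ⁻¹' B.1 : Set (pathComponentIn U x))
  have hG : ∀ B, IsOpen (G B) ∧ SecondCountableTopology (G B) := by
    rintro ⟨B, hB, w, hwB, hwL⟩
    obtain ⟨O, hO, hOU, hBO⟩ := hRC B hB
    obtain ⟨hwO, rfl⟩ := hBO.eq_pathComponentIn hwB
    refine ⟨isOpen_graphImmersion_plaque hst hζ hLU (h𝒪 hO) hOU hwL hwO, ?_⟩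
    exact (isEmbedding_plaque hst hζ hU hLsub hLU (h𝒪 hO) hwO).secondCountableTopology
  have := fun B => (hG B).2
  refine TopologicalSpace.secondCountableTopology_of_countable_cover (fun B => (hG B).1) ?_
  refine eq_univ_of_forall fun y => ?_
  obtain ⟨B, hB, hyB⟩ := hRL y.1 y.2
  exact mem_iUnion.2 ⟨⟨B, hB, y.1, hyB, y.2⟩, hyB⟩

theorem isTopologicalImmersion_toSubspace (hst : ζ.IsStabilized) (hζ : ζ.IsProper)
    (hU : IsOpen U) (hLsub : L ⊆ U) (hLU : ∀ y ∈ L, pathComponentIn U y = L) :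
    IsTopologicalImmersion (GraphImmersion.toSubspace L) := by
  refine ⟨continuous_toSubspace hst hζ hU hLsub hLU, fun y => ?_⟩
  obtain ⟨O, hO, hyO, hOU⟩ := exists_isStandardNhd hζ (y : L).1 (hU.mem_nhds (hLsub (y : L).2))
  exact ⟨_, (isOpen_graphImmersion_plaque hst hζ hLU hO hOU (y : L).2 hyO).mem_nhds
    (mem_pathComponentIn_self hyO), isEmbedding_plaque hst hζ hU hLsub hLU hO hyO⟩

theorem exists_star_graphImmersion (hst : ζ.IsStabilized) (hζ : ζ.IsProper)
    (hU : IsOpen U) (hLsub : L ⊆ U) (hLU : ∀ y ∈ L, pathComponentIn U y = L)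
    (y : GraphImmersion L) : ∃ (S : Set (GraphImmersion L)) (k : ℕ), IsOpen S ∧ IsStarSet S k y ∧
      (2 < k ↔ (GraphImmersion.toSubspace L y).1 ∈ ζ.Sing) := by
  let y' : L := y
  obtain ⟨O, hO, hyO, hOU, k, σ, η, hk, hch, hs⟩ :=
    exists_centered_plaque hst hζ y'.1 (hU.mem_nhds (hLsub y'.2))
  refine ⟨_, k, isOpen_graphImmersion_plaque hst hζ hLU hO hOU y'.2 hyO, ?_, hs⟩
  refine (isStarSet_image_iff (isEmbedding_plaque hst hζ hU hLsub hLU hO hyO)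
    (mem_pathComponentIn_self hyO)).1 ?_
  have : GraphImmersion.toSubspace L '' (Subtype.val ⁻¹' pathComponentIn O y'.1 : Set L) =
    (Subtype.val ⁻¹' pathComponentIn O y'.1 : Set L) := image_id _
  rw [this]
  refine (isStarSet_coe_image_iff (c := y') (show y' ∈ Subtype.val ⁻¹' pathComponentIn O y'.1 from
    mem_pathComponentIn_self hyO)).1 ?_
  rw [image_plaque hLU hOU y'.2]
  exact hch.isStarSet hk

theorem bijective_toSubspace (L : Set ζ.X) : Function.Bijective (GraphImmersion.toSubspace L) :=
  Function.bijective_id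

theorem isTopologicalGraph_graphImmersion (hst : ζ.IsStabilized) (hζ : ζ.IsProper)
    (hU : IsOpen U) {x : ζ.X} (hx : x ∈ U) :
    IsTopologicalGraph (GraphImmersion (pathComponentIn U x)) := by
  have hLsub : pathComponentIn U x ⊆ U := pathComponentIn_subset
  have hLU : ∀ y ∈ pathComponentIn U x, pathComponentIn U y = pathComponentIn U x :=
    fun y hy => pathComponentIn_congr hy
  refine ⟨T2Space.of_injective_continuous (bijective_toSubspace _).1
    (continuous_toSubspace hst hζ hU hLsub hLU), secondCountable_graphImmersion hst hζ hU hx,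
    fun y => ?_⟩
  obtain ⟨S, k, hS, hk, -⟩ := exists_star_graphImmersion hst hζ hU hLsub hLU y
  exact ⟨S, k, hS, hk⟩

theorem isOneManifold_graphImmersion (hst : ζ.IsStabilized) (hζ : ζ.IsProper) {x : ζ.X}
    (hx : x ∈ ζ.Singᶜ) : IsOneManifold (GraphImmersion (pathComponentIn ζ.Singᶜ x)) := by
  have hU := isOpen_compl_Sing hst hζ
  have hLsub : pathComponentIn ζ.Singᶜ x ⊆ ζ.Singᶜ := pathComponentIn_subset
  have hLU : ∀ y ∈ pathComponentIn ζ.Singᶜ x, pathComponentIn ζ.Singᶜ y =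
    pathComponentIn ζ.Singᶜ x := fun y hy => pathComponentIn_congr hy
  have hgr := isTopologicalGraph_graphImmersion hst hζ hU hx
  refine ⟨hgr.1, hgr.2.1, fun y => ?_⟩
  obtain ⟨S, k, hS, hk, hs⟩ := exists_star_graphImmersion hst hζ hU hLsub hLU y
  have hns : (GraphImmersion.toSubspace _ y).1 ∉ ζ.Sing :=
    hLsub (GraphImmersion.toSubspace _ y).2
  refine ⟨S, hS, hk.center_mem, ?_⟩
  obtain ⟨h2, e, -⟩ := hk
  obtain rfl : k = 2 := by
    have := mt hs.1 hns
    omega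
  obtain ⟨e'⟩ := nonempty_modelStar_two_homeo
  exact ⟨e.symm.trans e'⟩

end GraphImmersion

end SplitSequence
end SplitSolenoid

theorem mainTheorem8 {n : ℕ} (ζ : SplitSolenoid.SplitSequence.{u} n) (hproper : ζ.IsProper)
    (hstab : ζ.IsStabilized) :
    (∀ L : Set ζ.X, ζ.IsLeaf L ↔ ∃ x, L = pathComponent x) ∧
    (∀ L : Set ζ.X, ζ.IsPartialLeaf L ↔ ∃ x ∈ ζ.Singᶜ, L = pathComponentIn ζ.Singᶜ x) ∧
    (∀ L : Set ζ.X, ζ.IsLeaf L →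
      SplitSolenoid.IsTopologicalGraph (SplitSolenoid.GraphImmersion L) ∧
        Function.Bijective (SplitSolenoid.GraphImmersion.toSubspace L) ∧
        SplitSolenoid.IsTopologicalImmersion (SplitSolenoid.GraphImmersion.toSubspace L)) ∧
    (∀ L : Set ζ.X, ζ.IsPartialLeaf L →
      SplitSolenoid.IsOneManifold (SplitSolenoid.GraphImmersion L) ∧
        Function.Bijective (SplitSolenoid.GraphImmersion.toSubspace L) ∧
        SplitSolenoid.IsTopologicalImmersion (SplitSolenoid.GraphImmersion.toSubspace L)) ∧
    (∀ F : Set ζ.X, ζ.IsTransversal F → IsTotallyDisconnected F) ∧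
    (∀ H : Set ζ.X, ζ.IsTurnTransversal H →
      IsCompact H ∨ ζ.HasOnePointCompactificationIn H) ∧
    (∀ H : Set ζ.X, ζ.IsTurnTransversal H →
      TopologicalSpace.IsTopologicalBasis
        {B : Set ↥H | ζ.IsTurnTransversal (Subtype.val '' B)}) := by
  refine ⟨SplitSolenoid.SplitSequence.isLeaf_iff hstab hproper,
    SplitSolenoid.SplitSequence.isPartialLeaf_iff hstab hproper, fun L hL => ?_, fun L hL => ?_,
    fun F hF => SplitSolenoid.SplitSequence.isTotallyDisconnected_transversal hF,
    fun H hH => SplitSolenoid.SplitSequence.isCompact_or_hasOnePointCompactificationIn hstab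
      hproper hH,
    fun H hH => SplitSolenoid.SplitSequence.isTopologicalBasis_turnTransversal hstab hproper hH⟩
  · obtain ⟨x, rfl⟩ := (SplitSolenoid.SplitSequence.isLeaf_iff hstab hproper L).1 hL
    rw [← pathComponentIn_univ]
    exact ⟨SplitSolenoid.SplitSequence.isTopologicalGraph_graphImmersion hstab hproper isOpen_univ
      (mem_univ x), SplitSolenoid.SplitSequence.bijective_toSubspace _,
      SplitSolenoid.SplitSequence.isTopologicalImmersion_toSubspace hstab hproper isOpen_univ
        (subset_univ _) fun y hy => pathComponentIn_congr hy⟩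
  · obtain ⟨x, hx, rfl⟩ := (SplitSolenoid.SplitSequence.isPartialLeaf_iff hstab hproper L).1 hL
    exact ⟨SplitSolenoid.SplitSequence.isOneManifold_graphImmersion hstab hproper hx,
      SplitSolenoid.SplitSequence.bijective_toSubspace _,
      SplitSolenoid.SplitSequence.isTopologicalImmersion_toSubspace hstab hproper
        (SplitSolenoid.SplitSequence.isOpen_compl_Sing hstab hproper) pathComponentIn_subset
        fun y hy => pathComponentIn_congr hy⟩
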